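/- **Setting.** Let $\mathsf N$ be a number of sites, $\eta\in\mathbb C\setminus\{0\}$, and let $V=\mathbb C^{1|2}$ be the superspace with basis $v_1$ (even), $v_2,v_3$ (odd), with parities $\bar 1=0$, $\bar 2=\bar 3=1$. On graded tensor products of copies of $V$ let $\mathbb P_{ab}$ be the graded permutation of the factors $a,b$ (for two factors, $\mathbb P(v_i\otimes v_j)=(-1)^{\bar i\bar j}v_j\otimes v_i$) and $R_{ab}(\lambda)=\lambda+\eta\,\mathbb P_{ab}$. Let $\hat K=\mathrm{diag}(0,K_2)$, where $K_2$ is a $2\times2$ complex matrix with eigenvalues $\mathsf k_2\ne \mathsf k_3$, both nonzero. For $\xi=(\xi_1,\dots,\xi_{\mathsf N})\in\mathbb C^{\mathsf N}$ define on $\mathcal H=V_1\otimes\cdots\otimes V_{\mathsf N}$ the transfer matrix $$T_1^{(\hat K)}(\lambda)=\mathrm{str}_0\,\hat K_0R_{0\mathsf N}(\lambda-\xi_{\mathsf N})\cdots R_{01}(\lambda-\xi_1).$$ For a covector $\langle S|$ on $\mathcal H$ put $\langle h_1,\dots,h_{\mathsf N}|=\langle S|\prod_{n}T_1^{(\hat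 K)}(\xi_n)^{h_n}$ with $h_n\in\{0,1,2\}$. We call $\langle S|$ an SoV covector (for $\xi$) if these $3^{\mathsf N}$ covectors form a basis of $\mathcal H^*$. Let $d(\lambda)=\prod_n(\lambda-\xi_n)$ and $$f^{(m)}_a(\lambda)=\prod_{b\ne a}\frac{\lambda-\xi_b}{\xi_a-\xi_b}\ \prod_{b=1}^{\mathsf N}\prod_{r=1}^{m-1}\frac1{\xi_a-\xi_b+r\eta}.$$ An eigenvalue of $T_1^{(\hat K)}$ is a function $t(\lambda)$ such that some $\lambda$-independent vector $|t\rangle\neq0$ satisfies $T_1^{(\hat K)}(\lambda)|t\rangle=t(\lambda)|t\rangle$ for all $\lambda\in\mathbb C$; such a $|t\rangle$ is an eigenvector for $t$. Below, "almost all" points of a space $\mathbb C^m$ means all points outside the zero set of some nonzero polynomial. **Theorem 3.1.** For almost all $\xi$ (the exceptional polynomial may depend on $\eta$ and $K_2$) among those with $\xi_a-\xi_b\notin\eta\mathbb Z$ for all $a\neq b$, the following hold. 1. The set of eigenvalues of $T_1^{(\hat K)}$ is exactly the set $\Sigma$ of the polynomials $$t_1(\lambda)=-(\mathsf k_2+\mathsf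 k_3)\prod_{a=1}^{\mathsf N}(\lambda-\xi_a)+\sum_{a=1}^{\mathsf N}f_a^{(1)}(\lambda)\,x_a,$$ where $(x_1,\dots,x_{\mathsf N})\in\mathbb C^{\mathsf N}$ runs through all solutions of the system of $\mathsf N$ cubic equations $$x_a\Big[\mathsf k_2\mathsf k_3\,d(\xi_a+\eta)+\sum_{r=1}^{\mathsf N}f_r^{(2)}(\xi_a+\eta)\,t_1(\xi_r+\eta)\,x_r\Big]=0,\qquad a=1,\dots,\mathsf N.$$ 2. $T_1^{(\hat K)}(\lambda)$ is diagonalizable with simple spectrum: $\mathcal H$ has a basis of ($\lambda$-independent) eigenvectors, whose eigenvalues are pairwise distinct functions of $\lambda$. 3. Almost every covector $\langle S|$ is an SoV covector. 4. For every SoV covector $\langle S|$ and every $t_1\in\Sigma$, the eigenvector $|t\rangle$ for $t_1$ is unique up to normalization and, suitably normalized, satisfies $$\langle h_1,\dots,h_{\mathsf N}|t\rangle=\prod_{n=1}^{\mathsf N}t_1(\xi_n)^{h_n}\qquad\text{for all }h_1,\dots,h_{\mathsf N}\in\{0,1,2\}.$$ Moreover, let $s_1,\dots,s_{\mathsf N}$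 be covectors on $\mathbb C^3$, none of which vanishes on any eigenvector of $\hat K$. Then the product covector $\langle S|$ with value $\prod_n s_n(v_{i_n})$ on $v_{i_1}\otimes\cdots\otimes v_{i_{\mathsf N}}$ is an SoV covector for almost all $\xi$ among those with $\xi_a-\xi_b\notin\eta\mathbb Z$ for all $a\neq b$ (here the exceptional polynomial may also depend on the $s_n$). -/

import Mathlib

open Matrix

noncomputable section

namespace GL12

/-- Parity of the basis vectors of `ℂ^{1|2}`: `v₀` is even, `v₁` and `v₂` are odd. -/
def parity : Fin 3 → ℕ := ![0, 1, 1]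

/-- Labels of the tensored basis `v_{σ 0} ⊗ v_{σ 1} ⊗ …` of `(ℂ^{1|2})^{⊗ L}`. -/
abbrev Conf (L : ℕ) : Type := Fin L → Fin 3

/-- Linear operators on `(ℂ^{1|2})^{⊗ L}`, as matrices in the tensored basis: the column of index
`τ` is the image of the basis vector of index `τ`. -/
abbrev Op (L : ℕ) : Type := Matrix (Conf L) (Conf L) ℂ

/-- The elementary operator with `v_j ↦ v_i`, placed at site `a` of the graded tensor product
`1 ⊗ ⋯ ⊗ e ⊗ ⋯ ⊗ 1`. It has parity `parity i + parity j`, and the sign is the one it picks up when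
it moves through the vectors of the sites to the left of `a`. -/
def siteE {L : ℕ} (a : Fin L) (i j : Fin 3) : Op L :=
  Matrix.of fun σ τ =>
    if τ a = j ∧ σ = Function.update τ a i then
      (-1 : ℂ) ^ ((parity i + parity j) * ∑ c ∈ Finset.Iio a, parity (τ c))
    else 0

/-- The operator with matrix `X` at site `a` of the graded tensor product. -/
def siteOp {L : ℕ} (a : Fin L) (X : Matrix (Fin 3) (Fin 3) ℂ) : Op L :=
  ∑ i, ∑ j, X i j • siteE a i j

/-- The graded permutation operator of two distinct sites `a`, `b`,
`∑ α β, (-1)^β (v_β ↦ v_α at site a) (v_α ↦ v_β at site b)`. -/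
def gradedPerm {L : ℕ} (a b : Fin L) : Op L :=
  ∑ α, ∑ β, (-1 : ℂ) ^ parity β • (siteE a α β * siteE b β α)

/-- The rational `R`-matrix `u + η ℙ` acting on the sites `a`, `b`. -/
def rMatrix {L : ℕ} (η : ℂ) (a b : Fin L) (u : ℂ) : Op L :=
  u • (1 : Op L) + η • gradedPerm a b

/-- The monodromy matrix `K₀ R_{0N}(u - ξ_N) ⋯ R_{01}(u - ξ_1)`; site `0` is the auxiliary space
and site `n.succ` is the quantum space with inhomogeneity `ξ n`. -/
def monodromy {N : ℕ} (η : ℂ) (K : Matrix (Fin 3) (Fin 3) ℂ) (ξ : Fin N → ℂ) (u : ℂ) :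
    Op (N + 1) :=
  siteOp 0 K *
    ((List.finRange N).reverse.map fun n => rMatrix η 0 n.succ (u - ξ n)).prod

/-- Supertrace over the auxiliary space `0` of an even operator: the alternating sum of the
diagonal blocks (these are even operators on the other sites, so that no further sign occurs). -/
def superTrace₀ {N : ℕ} (M : Op (N + 1)) : Op N :=
  Matrix.of fun σ τ => ∑ j : Fin 3, (-1 : ℂ) ^ parity j *
    M (Fin.cons j σ : Conf (N + 1)) (Fin.cons j τ : Conf (N + 1))

/-- The transfer matrix `T₁^{(K)}(u)`. -/
def transfer {N : ℕ} (η : ℂ) (K : Matrix (Fin 3) (Fin 3) ℂ) (ξ : Fin N → ℂ) (u : ℂ) : Op N :=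
  superTrace₀ (monodromy η K ξ u)

/-- The block-diagonal twist `diag(0, K₂)`. -/
def twist (K₂ : Matrix (Fin 2) (Fin 2) ℂ) : Matrix (Fin 3) (Fin 3) ℂ :=
  !![0, 0, 0;
     0, K₂ 0 0, K₂ 0 1;
     0, K₂ 1 0, K₂ 1 1]

/-- The inhomogeneities are pairwise distinct modulo `η`. -/
def InhomCond {N : ℕ} (η : ℂ) (ξ : Fin N → ℂ) : Prop :=
  ∀ a b, a ≠ b → ∀ m : ℤ, ξ a - ξ b ≠ m * η

/-- `v` is a (`u`-independent) solution of `T₁(u) v = t(u) v` for all `u`. -/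
def IsEigen {N : ℕ} (η : ℂ) (K : Matrix (Fin 3) (Fin 3) ℂ) (ξ : Fin N → ℂ)
    (t : ℂ → ℂ) (v : Conf N → ℂ) : Prop :=
  ∀ u, transfer η K ξ u *ᵥ v = t u • v

/-- The eigenvalue spectrum of `T₁(u)`: the set of functions `t` of the spectral parameter that are
eigenvalues of the transfer matrix. -/
def eigenvalueSpectrum {N : ℕ} (η : ℂ) (K : Matrix (Fin 3) (Fin 3) ℂ) (ξ : Fin N → ℂ) :
    Set (ℂ → ℂ) :=
  {t | ∃ v : Conf N → ℂ, v ≠ 0 ∧ IsEigen η K ξ t v}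

/-- `T₁(u)` is diagonalizable with simple spectrum: the space has a basis of eigenvectors, whose
eigenvalues are pairwise different functions of the spectral parameter. -/
def DiagonalizableSimple {N : ℕ} (η : ℂ) (K : Matrix (Fin 3) (Fin 3) ℂ) (ξ : Fin N → ℂ) : Prop :=
  ∃ (b : Module.Basis (Conf N) ℂ (Conf N → ℂ)) (t : Conf N → ℂ → ℂ),
    Function.Injective t ∧ ∀ i, IsEigen η K ξ (t i) (b i)

/-- `d(u) = ∏ₙ (u - ξₙ)`. -/
def d {N : ℕ} (ξ : Fin N → ℂ) (u : ℂ) : ℂ := ∏ n, (u - ξ n)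

/-- `f_a^{(m)}(u) = ∏_{b ≠ a} (u - ξ_b)/(ξ_a - ξ_b) ∏_b ∏_{r=1}^{m-1} 1/(ξ_a - ξ_b + r η)`. -/
def f {N : ℕ} (η : ℂ) (ξ : Fin N → ℂ) (m : ℕ) (a : Fin N) (u : ℂ) : ℂ :=
  (∏ b ∈ Finset.univ.erase a, (u - ξ b) / (ξ a - ξ b)) *
    ∏ b, ∏ r ∈ Finset.Ico 1 m, 1 / (ξ a - (ξ b - r * η))

/-- The polynomial function
`t₁(u | x) = -(k₂ + k₃) ∏_a (u - ξ_a) + ∑_a f_a^{(1)}(u) x_a`. -/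
def t₁ {N : ℕ} (η k₂ k₃ : ℂ) (ξ x : Fin N → ℂ) (u : ℂ) : ℂ :=
  -(k₂ + k₃) * ∏ a, (u - ξ a) + ∑ a, f η ξ 1 a u * x a

/-- The solutions of the system of `N` cubic equations in the unknowns `x_1, …, x_N`. -/
def solutionSet {N : ℕ} (η k₂ k₃ : ℂ) (ξ : Fin N → ℂ) : Set (Fin N → ℂ) :=
  {x | ∀ a, x a * (k₂ * k₃ * d ξ (ξ a + η) +
    ∑ r, f η ξ 2 r (ξ a + η) * t₁ η k₂ k₃ ξ x (ξ r + η) * x r) = 0}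

/-- The set of the polynomials `t₁(· | x)`, where `x` solves the cubic system. -/
def sigmaSet {N : ℕ} (η k₂ k₃ : ℂ) (ξ : Fin N → ℂ) : Set (ℂ → ℂ) :=
  {t | ∃ x ∈ solutionSet η k₂ k₃ ξ, t = t₁ η k₂ k₃ ξ x}

/-- The covector `⟨h₁, …, h_N| = ⟨S| ∏ₙ T₁(ξₙ)^{hₙ}`. Covectors are given by their values on the
tensored basis. -/
def sovCovector {N : ℕ} (η : ℂ) (K : Matrix (Fin 3) (Fin 3) ℂ) (ξ : Fin N → ℂ)
    (S : Conf N → ℂ) (h : Fin N → Fin 3) : Conf N → ℂ :=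
  S ᵥ* ((List.finRange N).map fun n => transfer η K ξ (ξ n) ^ (h n : ℕ)).prod

/-- The covectors `⟨h₁, …, h_N|`, `hₙ ∈ {0, 1, 2}`, form a basis of the space of covectors. -/
def IsSoVBasis {N : ℕ} (η : ℂ) (K : Matrix (Fin 3) (Fin 3) ℂ) (ξ : Fin N → ℂ)
    (S : Conf N → ℂ) : Prop :=
  LinearIndependent ℂ (sovCovector η K ξ S) ∧
    Submodule.span ℂ (Set.range (sovCovector η K ξ S)) = ⊤

/-- The covector that takes the value `∏ₙ sₙ(v_{σ n})` on the basis vector of index `σ`. -/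
def productCovector {N : ℕ} (s : Fin N → Fin 3 → ℂ) : Conf N → ℂ :=
  fun σ => ∏ n, s n (σ n)

end GL12

end

/-! Write T(u) for the transfer matrix and K for the twist. The Yang–Baxter equation makes the T(u)
commute (`transfer_commute`), and T has degree N in u with top coefficient str K, so it is
determined by the N operators T(ξ_a).

Fusion closes the system. The transfer matrix T₂ whose auxiliary space is the graded symmetric
square has degree 2N, equals T(ξ_a) T(ξ_a + η) at ξ_a (`fusedTransfer_inhomogeneity`) and vanishes
at ξ_a - η (`fusedTransfer_eq_zero`). Hence T₂(u) = d(u + η) F(u), with F interpolated from the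
T(ξ_a) (`d_smul_fusedInterpolation`). Moreover T(ξ_a) T₂(ξ_a + η) = 0
(`transfer_mul_fusedTransfer`): site a acts as a third auxiliary space, the product factors through
the graded symmetric cube, and K ⊗ K ⊗ K vanishes there because K kills the even vector and the cube
of an odd plane is Λ³ℂ² = 0. Dividing by d yields the cubic system for the operators T(ξ_a), and
applying it to an eigenvector puts every eigenvalue in Σ.

The converse is a dimension count. A commutative algebra generated by N elements obeying the cubic
relations has dimension at most 3^N (`span_spanFamily_eq_top`). Given a solution x, apply this to
the algebra B generated by the pairs (T(ξ_a), x_a). An SoV covector S gives a surjection b ↦ S b.1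
from B onto a space of dimension 3^N, which is therefore bijective. So b ↦ b.2 is a linear
functional of S b.1, that is, evaluation on a vector v, and v is the required eigenvector
(`exists_eigenvector`). An SoV covector also forces joint eigenspaces to be lines.

For diagonalizability, if the trace form on the 3^N monomials in the T(ξ_a) is nondegenerate, the
algebra they generate has no nilpotents, so each T(ξ_a) is semisimple
(`diagonalizableSimple_of_gram`).

Both generic conditions are the nonvanishing of a polynomial in ξ. When the inhomogeneities move far
apart, the rescaled T(ξ_a) tends to K at site a, so it suffices to check 3 × 3 determinants for K
(`det_vecMul_pow_ne_zero`, `det_trace_twist_ne_zero`); these are nonzero because 0, k₂, k₃ are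
distinct and S avoids the eigenvectors of K. -/

noncomputable section

namespace GL12

/-! ### Sign calculus of elementary operators and graded permutations -/

variable {L : ℕ}

/-- The total parity of the sites to the left of `a`. -/
def leftParity (a : Fin L) (τ : Conf L) : ℕ := ∑ c ∈ Finset.Iio a, parity (τ c)

lemma siteE_apply (a : Fin L) (i j : Fin 3) (σ τ : Conf L) :
    siteE a i j σ τ = if τ a = j ∧ σ = Function.update τ a i then
      (-1 : ℂ) ^ ((parity i + parity j) * leftParity a τ) else 0 := rfl

lemma mul_siteE_apply (X : Op L) (b : Fin L) (k l : Fin 3) (σ τ : Conf L) :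
    (X * siteE b k l) σ τ = if τ b = l then
      (-1 : ℂ) ^ ((parity k + parity l) * leftParity b τ) * X σ (Function.update τ b k) else 0 := by
  rw [Matrix.mul_apply]
  by_cases h : τ b = l
  · simp [siteE_apply, h, mul_comm]
  · simp [siteE_apply, h]

lemma leftParity_update_of_le {a b : Fin L} (h : a ≤ b) (τ : Conf L) (k : Fin 3) :
    leftParity a (Function.update τ b k) = leftParity a τ := by
  unfold leftParity
  refine Finset.sum_congr rfl fun c hc => ?_
  rw [Function.update_of_ne]
  exact ((Finset.mem_Iio.1 hc).trans_le h).ne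

/-- The additive form avoids subtraction of natural numbers; this change of parity is the source of
all graded signs below. -/
lemma leftParity_update_of_lt {a b : Fin L} (h : b < a) (τ : Conf L) (k : Fin 3) :
    leftParity a (Function.update τ b k) + parity (τ b) = leftParity a τ + parity k := by
  unfold leftParity
  have hb : b ∈ Finset.Iio a := Finset.mem_Iio.2 h
  rw [← Finset.add_sum_erase _ _ hb, ← Finset.add_sum_erase _ (fun c => parity (τ c)) hb]
  have : ∑ x ∈ (Finset.Iio a).erase b, parity (Function.update τ b k x) =
      ∑ x ∈ (Finset.Iio a).erase b, parity (τ x) := by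
    refine Finset.sum_congr rfl fun c hc => ?_
    rw [Function.update_of_ne (Finset.ne_of_mem_erase hc)]
  rw [this]
  simp
  ring

lemma neg_one_pow_eq_of_even_add {m n : ℕ} (h : Even (m + n)) : (-1 : ℂ) ^ m = (-1) ^ n := by
  rw [neg_one_pow_congr]
  simpa [Nat.even_add] using h

lemma siteE_mul_siteE_same (a : Fin L) (i j k l : Fin 3) :
    siteE a i j * siteE a k l = if j = k then siteE a i l else 0 := by
  ext σ τ
  rw [mul_siteE_apply, siteE_apply]
  simp only [Function.update_self, Function.update_idem, leftParity_update_of_le le_rfl]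
  by_cases h : τ a = l <;> by_cases h' : k = j
  · subst h'
    by_cases h2 : σ = Function.update τ a i
    · simp only [h, h2, if_true, and_true, siteE_apply, ← pow_add]
      refine neg_one_pow_eq_of_even_add ⟨(parity k + parity l + parity i) * leftParity a τ, ?_⟩
      ring
    · simp [h, h2, siteE_apply]
  · simp [h', show ¬ j = k from fun e => h' e.symm]
  · subst h'
    simp [h, siteE_apply]
  · simp [h', show ¬ j = k from fun e => h' e.symm]

lemma siteE_mul_siteE_of_lt {a b : Fin L} (hab : a < b) (i j k l : Fin 3) :
    siteE a i j * siteE b k l =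
      (-1 : ℂ) ^ ((parity i + parity j) * (parity k + parity l)) • (siteE b k l * siteE a i j) := by
  ext σ τ
  rw [Matrix.smul_apply, mul_siteE_apply, mul_siteE_apply, siteE_apply, siteE_apply,
    leftParity_update_of_le hab.le, Function.update_of_ne hab.ne, Function.update_of_ne hab.ne',
    Function.update_comm hab.ne']
  by_cases h1 : τ b = l <;> by_cases h2 : τ a = j <;> simp only [h1, h2, true_and, false_and,
    if_true, if_false, mul_zero, smul_zero]
  by_cases h3 : σ = Function.update (Function.update τ a i) b k <;>
    simp only [h3, if_true, if_false, mul_zero, smul_zero]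
  have h4 := leftParity_update_of_lt hab τ i
  rw [h2] at h4
  rw [smul_eq_mul, ← pow_add, ← pow_add, ← pow_add]
  refine neg_one_pow_eq_of_even_add ⟨(parity k + parity l) * (leftParity b τ + parity i) +
    (parity i + parity j) * leftParity a τ, ?_⟩
  linear_combination (parity k + parity l) * h4

/-- Elementary operators at different sites commute in the graded sense. -/
lemma siteE_mul_siteE_of_ne {a b : Fin L} (hab : a ≠ b) (i j k l : Fin 3) :
    siteE a i j * siteE b k l =
      (-1 : ℂ) ^ ((parity i + parity j) * (parity k + parity l)) • (siteE b k l * siteE a i j) := by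
  rcases lt_or_gt_of_ne hab with h | h
  · exact siteE_mul_siteE_of_lt h i j k l
  · rw [siteE_mul_siteE_of_lt h k l i j, smul_smul, ← pow_add, Even.neg_one_pow, one_smul]
    exact ⟨(parity i + parity j) * (parity k + parity l), by ring⟩

lemma sum_siteE_diag (a : Fin L) : ∑ i, siteE a i i = (1 : Op L) := by
  ext σ τ
  rw [Matrix.sum_apply, Finset.sum_eq_single (τ a)]
  · rw [siteE_apply, Matrix.one_apply]
    simp only [Function.update_eq_self, true_and]
    congr 1
    rw [Even.neg_one_pow]
    exact ⟨parity (τ a) * leftParity a τ, by ring⟩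
  · intro b _ hb
    simp [siteE_apply, hb.symm]
  · simp

lemma siteE_commute_of_even {a b : Fin L} (hab : a ≠ b) (i j k l : Fin 3)
    (h : Even (parity k + parity l)) : Commute (siteE a i j) (siteE b k l) := by
  rw [Commute, SemiconjBy, siteE_mul_siteE_of_ne hab, Even.neg_one_pow (h.mul_left _), one_smul]

/-! ### Graded permutations -/

lemma gradedPerm_comm {a b : Fin L} (hab : a ≠ b) : gradedPerm a b = gradedPerm b a := by
  unfold gradedPerm
  rw [Finset.sum_comm]
  refine Finset.sum_congr rfl fun β _ => Finset.sum_congr rfl fun α _ => ?_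
  rw [siteE_mul_siteE_of_ne hab, smul_smul, ← pow_add]
  congr 1
  refine neg_one_pow_eq_of_even_add ?_
  fin_cases α <;> fin_cases β <;> decide

/-- No sign appears, even for odd operators, since `siteE` already contains the sign of its
embedding. -/
lemma gradedPerm_mul_siteE_right (a b : Fin L) (k l : Fin 3) :
    gradedPerm a b * siteE b k l = siteE a k l * gradedPerm a b := by
  unfold gradedPerm
  simp only [Finset.sum_mul, Finset.mul_sum, smul_mul_assoc, mul_smul_comm, mul_assoc,
    siteE_mul_siteE_same]
  simp only [← mul_assoc, siteE_mul_siteE_same]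
  simp only [mul_ite, mul_zero, smul_ite, smul_zero, ite_mul, zero_mul]
  rw [Finset.sum_comm]
  conv_rhs => rw [Finset.sum_comm]
  refine Finset.sum_congr rfl fun β _ => ?_
  simp

lemma gradedPerm_mul_siteE_left {a b : Fin L} (hab : a ≠ b) (k l : Fin 3) :
    gradedPerm a b * siteE a k l = siteE b k l * gradedPerm a b := by
  rw [gradedPerm_comm hab, gradedPerm_mul_siteE_right]

lemma gradedPerm_mul_self {a b : Fin L} (hab : a ≠ b) : gradedPerm a b * gradedPerm a b = 1 := by
  have key : ∀ α β : Fin 3, ∀ γ δ : Fin 3,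
      ((-1 : ℂ) ^ parity β • (siteE a α β * siteE b β α)) *
        ((-1 : ℂ) ^ parity δ • (siteE a γ δ * siteE b δ γ)) =
      if β = γ then if α = δ then siteE a α α * siteE b β β else 0 else 0 := by
    intro α β γ δ
    have h1 : (siteE a α β * siteE b β α) * (siteE a γ δ * siteE b δ γ) =
        (-1 : ℂ) ^ ((parity β + parity α) * (parity γ + parity δ)) •
          ((siteE a α β * siteE a γ δ) * (siteE b β α * siteE b δ γ)) := by
      rw [mul_assoc, ← mul_assoc (siteE b β α), siteE_mul_siteE_of_ne hab.symm]
      simp only [smul_mul_assoc, mul_smul_comm, mul_assoc]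
    rw [smul_mul_smul_comm, h1, siteE_mul_siteE_same, siteE_mul_siteE_same, smul_smul]
    by_cases h2 : β = γ
    · by_cases h3 : α = δ
      · subst h2 h3
        simp only [if_true]
        rw [← pow_add, ← pow_add, Even.neg_one_pow, one_smul]
        fin_cases α <;> fin_cases β <;> decide
      · simp [h3]
    · simp [h2]
  have h2 : gradedPerm a b * gradedPerm a b =
      ∑ α, ∑ β, ∑ γ, ∑ δ, ((-1 : ℂ) ^ parity β • (siteE a α β * siteE b β α)) *
        ((-1 : ℂ) ^ parity δ • (siteE a γ δ * siteE b δ γ)) := by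
    unfold gradedPerm
    rw [Finset.sum_mul]
    refine Finset.sum_congr rfl fun α _ => ?_
    rw [Finset.sum_mul]
    refine Finset.sum_congr rfl fun β _ => ?_
    rw [Finset.mul_sum]
    refine Finset.sum_congr rfl fun γ _ => ?_
    rw [Finset.mul_sum]
  rw [h2]
  simp only [key]
  simp only [Finset.sum_ite_eq, Finset.mem_univ, if_true, Finset.sum_ite_irrel,
    Finset.sum_const_zero]
  simp only [← Finset.mul_sum, sum_siteE_diag, mul_one]

/-- Each summand of the permutation is a product of two factors of equal parity, so the two signs
cancel. -/
lemma siteE_commute_gradedPerm {a b c : Fin L} (ha : c ≠ a) (hb : c ≠ b)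
    (k l : Fin 3) : Commute (siteE c k l) (gradedPerm a b) := by
  unfold gradedPerm
  refine Commute.sum_right _ _ _ fun α _ => Commute.sum_right _ _ _ fun β _ =>
    Commute.smul_right ?_ _
  rw [Commute, SemiconjBy, ← mul_assoc, siteE_mul_siteE_of_ne ha, smul_mul_assoc, mul_assoc,
    siteE_mul_siteE_of_ne hb, mul_smul_comm, smul_smul, ← pow_add, Even.neg_one_pow, one_smul,
    mul_assoc]
  exact ⟨(parity k + parity l) * (parity α + parity β), by ring⟩

/-- The permutation of a and b carries the site b inside the second permutation to a. With symmetry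
and involutivity this gives the symmetric group relations used for the Yang–Baxter equation and
fusion. -/
lemma gradedPerm_mul_gradedPerm {a b c : Fin L} (hac : a ≠ c) (hbc : b ≠ c) :
    gradedPerm a b * gradedPerm b c = gradedPerm a c * gradedPerm a b := by
  conv_lhs => rw [gradedPerm.eq_1 b c]
  conv_rhs => rw [gradedPerm.eq_1 a c]
  simp only [Finset.sum_mul, Finset.mul_sum, smul_mul_assoc, mul_smul_comm, ← mul_assoc,
    gradedPerm_mul_siteE_right]
  simp only [mul_assoc, (siteE_commute_gradedPerm hac.symm hbc.symm _ _).eq]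

lemma gradedPerm_commute {a b c e : Fin L} (hac : a ≠ c) (hae : a ≠ e) (hbc : b ≠ c)
    (hbe : b ≠ e) : Commute (gradedPerm a b) (gradedPerm c e) := by
  conv => rw [gradedPerm.eq_1 c e]
  refine Commute.sum_right _ _ _ fun α _ => Commute.sum_right _ _ _ fun β _ =>
    Commute.smul_right (Commute.mul_right ?_ ?_) _
  · exact (siteE_commute_gradedPerm hac.symm hbc.symm _ _).symm
  · exact (siteE_commute_gradedPerm hae.symm hbe.symm _ _).symm

/-! ### Operators at a single site -/

/-- Matrices that preserve the parity. -/
def IsEvenMatrix (X : Matrix (Fin 3) (Fin 3) ℂ) : Prop :=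
  ∀ i j, X i j ≠ 0 → parity i = parity j

lemma gradedPerm_mul_siteOp_left {a b : Fin L} (hab : a ≠ b) (X : Matrix (Fin 3) (Fin 3) ℂ) :
    gradedPerm a b * siteOp a X = siteOp b X * gradedPerm a b := by
  unfold siteOp
  simp only [Finset.sum_mul, Finset.mul_sum, smul_mul_assoc, mul_smul_comm,
    gradedPerm_mul_siteE_left hab]

lemma gradedPerm_mul_siteOp_right (a b : Fin L) (X : Matrix (Fin 3) (Fin 3) ℂ) :
    gradedPerm a b * siteOp b X = siteOp a X * gradedPerm a b := by
  unfold siteOp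
  simp only [Finset.sum_mul, Finset.mul_sum, smul_mul_assoc, mul_smul_comm,
    gradedPerm_mul_siteE_right]

lemma siteOp_commute_gradedPerm {a b c : Fin L} (ha : c ≠ a) (hb : c ≠ b)
    (X : Matrix (Fin 3) (Fin 3) ℂ) : Commute (siteOp c X) (gradedPerm a b) := by
  unfold siteOp
  exact Commute.sum_left _ _ _ fun i _ => Commute.sum_left _ _ _ fun j _ =>
    Commute.smul_left (siteE_commute_gradedPerm ha hb i j) _

lemma siteE_commute_siteOp {a b : Fin L} (hab : a ≠ b) {X : Matrix (Fin 3) (Fin 3) ℂ}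
    (hX : IsEvenMatrix X) (i j : Fin 3) : Commute (siteE a i j) (siteOp b X) := by
  unfold siteOp
  refine Commute.sum_right _ _ _ fun k _ => Commute.sum_right _ _ _ fun l _ => ?_
  by_cases h : X k l = 0
  · simp [h]
  · exact Commute.smul_right (siteE_commute_of_even hab i j k l (by rw [hX k l h]; simp)) _

lemma siteOp_commute_siteOp {a b : Fin L} (hab : a ≠ b) (X : Matrix (Fin 3) (Fin 3) ℂ)
    {Y : Matrix (Fin 3) (Fin 3) ℂ} (hY : IsEvenMatrix Y) :
    Commute (siteOp a X) (siteOp b Y) := by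
  rw [siteOp.eq_1 a X]
  exact Commute.sum_left _ _ _ fun i _ => Commute.sum_left _ _ _ fun j _ =>
    Commute.smul_left (siteE_commute_siteOp hab hY i j) _

lemma twist_isEven (K₂ : Matrix (Fin 2) (Fin 2) ℂ) : IsEvenMatrix (twist K₂) := by
  intro i j
  fin_cases i <;> fin_cases j <;> simp [twist, parity]

/-- Equal odd vectors acquire a minus sign when exchanged; this is what makes graded symmetric
tensors antisymmetric on the odd part. -/
lemma gradedPerm_mul_diag_diag {a b : Fin L} (hab : a ≠ b) (i : Fin 3) :
    gradedPerm a b * (siteE a i i * siteE b i i) =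
      (-1 : ℂ) ^ parity i • (siteE a i i * siteE b i i) := by
  have h : ∀ α β, siteE a α β * siteE b β α * (siteE a i i * siteE b i i) =
      if β = i then if α = i then siteE a i i * siteE b i i else 0 else 0 := by
    intro α β
    rw [mul_assoc, ← mul_assoc (siteE b β α),
      (siteE_commute_of_even hab.symm β α i i ⟨_, rfl⟩).eq, mul_assoc, ← mul_assoc,
      siteE_mul_siteE_same, siteE_mul_siteE_same]
    by_cases h1 : β = i <;> by_cases h2 : α = i <;> simp [h1, h2]
  unfold gradedPerm
  simp [Finset.sum_mul, h]

end GL12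

end

/-! ### Adjoining a site in front, and partial supertraces -/

noncomputable section

namespace GL12

variable {L N : ℕ}

lemma sum_conf_succ {M : Type*} [AddCommMonoid M] (g : Conf (L + 1) → M) :
    ∑ σ, g σ = ∑ j : Fin 3, ∑ σ : Conf L, g (Fin.cons j σ) := by
  rw [← (Fin.consEquiv fun _ : Fin (L + 1) => Fin 3).sum_comp, Fintype.sum_prod_type]
  rfl

lemma op_ext_cons {X Y : Op (L + 1)}
    (h : ∀ s σ t τ, X (Fin.cons s σ) (Fin.cons t τ) = Y (Fin.cons s σ) (Fin.cons t τ)) : X = Y := by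
  ext σ τ
  rw [← Fin.cons_self_tail σ, ← Fin.cons_self_tail τ]
  exact h _ _ _ _

/-- The operator `1 ⊗ X`, acting trivially on an additional site in front. -/
def lift : Op L →ₐ[ℂ] Op (L + 1) :=
  AlgHom.ofLinearMap
    { toFun := fun X => Matrix.of fun σ τ => if σ 0 = τ 0 then X (Fin.tail σ) (Fin.tail τ) else 0
      map_add' := fun X Y => by ext σ τ; by_cases h : σ 0 = τ 0 <;> simp [h]
      map_smul' := fun c X => by ext σ τ; simp }
    (by
      refine op_ext_cons fun s σ t τ => ?_
      simp [Matrix.one_apply, Fin.cons_inj, ite_and])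
    (by
      intro X Y
      refine op_ext_cons fun s σ t τ => ?_
      simp only [LinearMap.coe_mk, AddHom.coe_mk, Matrix.of_apply, Fin.cons_zero, Fin.tail_cons,
        Matrix.mul_apply, sum_conf_succ]
      rw [Finset.sum_eq_single s]
      · by_cases h : s = t <;> simp [h]
      · intro b _ hb
        simp [hb.symm]
      · simp)

lemma lift_apply_cons (X : Op L) (s t : Fin 3) (σ τ : Conf L) :
    lift X (Fin.cons s σ) (Fin.cons t τ) = if s = t then X σ τ else 0 := by
  simp [lift]

lemma lift_mul_apply (X : Op L) (Y : Op (L + 1)) (s : Fin 3) (σ : Conf L) (τ : Conf (L + 1)) :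
    (lift X * Y) (Fin.cons s σ) τ = ∑ ρ, X σ ρ * Y (Fin.cons s ρ) τ := by
  rw [Matrix.mul_apply, sum_conf_succ, Finset.sum_eq_single s]
  · simp [lift_apply_cons]
  · intro b _ hb
    simp [lift_apply_cons, hb.symm]
  · simp

lemma mul_lift_apply (X : Op L) (Y : Op (L + 1)) (t : Fin 3) (τ : Conf L) (σ : Conf (L + 1)) :
    (Y * lift X) σ (Fin.cons t τ) = ∑ ρ, Y σ (Fin.cons t ρ) * X ρ τ := by
  rw [Matrix.mul_apply, sum_conf_succ, Finset.sum_eq_single t]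
  · simp [lift_apply_cons]
  · intro b _ hb
    simp [lift_apply_cons, hb]
  · simp

/-- `superTrace₀` as a linear map. -/
def strLin : Op (N + 1) →ₗ[ℂ] Op N where
  toFun := superTrace₀
  map_add' X Y := by
    ext σ τ; simp [superTrace₀, mul_add, Finset.sum_add_distrib]
  map_smul' c X := by
    ext σ τ; simp [superTrace₀, Finset.mul_sum, mul_left_comm]

lemma strLin_apply_apply (X : Op (N + 1)) (σ τ : Conf N) :
    strLin X σ τ = ∑ j : Fin 3, (-1 : ℂ) ^ parity j * X (Fin.cons j σ) (Fin.cons j τ) := rfl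

lemma strLin_lift_mul (X : Op N) (Y : Op (N + 1)) : strLin (lift X * Y) = X * strLin Y := by
  ext σ τ
  simp only [strLin_apply_apply, lift_mul_apply]
  simp only [Matrix.mul_apply, strLin_apply_apply, Finset.mul_sum]
  rw [Finset.sum_comm]
  exact Finset.sum_congr rfl fun _ _ => Finset.sum_congr rfl fun _ _ => by ring

lemma strLin_mul_lift (X : Op N) (Y : Op (N + 1)) : strLin (Y * lift X) = strLin Y * X := by
  ext σ τ
  simp only [strLin_apply_apply, mul_lift_apply]
  simp only [Matrix.mul_apply, strLin_apply_apply, Finset.mul_sum, Finset.sum_mul]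
  rw [Finset.sum_comm]
  exact Finset.sum_congr rfl fun _ _ => Finset.sum_congr rfl fun _ _ => by ring

lemma leftParity_zero (τ : Conf (L + 1)) : leftParity 0 τ = 0 := by
  simp [leftParity]

lemma leftParity_succ_cons (a : Fin L) (t : Fin 3) (τ : Conf L) :
    leftParity a.succ (Fin.cons t τ : Conf (L + 1)) = parity t + leftParity a τ := by
  have h : ∀ {M : ℕ} (b : Fin M) (g : Fin M → ℕ),
      ∑ c ∈ Finset.Iio b, g c = ∑ c, if c < b then g c else 0 := by
    intro M b g
    rw [← Finset.sum_filter]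
    congr 1
    ext; simp
  rw [leftParity, leftParity, h, h, Fin.sum_univ_succ]
  simp

lemma siteE_zero_apply_cons (i j s t : Fin 3) (σ τ : Conf L) :
    siteE 0 i j (Fin.cons s σ : Conf (L + 1)) (Fin.cons t τ) =
      if t = j ∧ s = i ∧ σ = τ then 1 else 0 := by
  rw [siteE_apply, leftParity_zero, Fin.update_cons_zero]
  simp [Fin.cons_inj]

lemma siteE_succ_apply_cons (a : Fin L) (i j s t : Fin 3) (σ τ : Conf L) :
    siteE a.succ i j (Fin.cons s σ : Conf (L + 1)) (Fin.cons t τ) =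
      if s = t then (-1 : ℂ) ^ ((parity i + parity j) * parity t) * siteE a i j σ τ else 0 := by
  rw [siteE_apply, leftParity_succ_cons, ← Fin.cons_update, siteE_apply]
  by_cases h : s = t
  · by_cases h1 : τ a = j <;> by_cases h2 : σ = Function.update τ a i <;>
      simp [h, h1, h2, Fin.cons_inj, mul_add, pow_add, -Fin.cons_update]
  · simp [h, Fin.cons_inj, -Fin.cons_update]

lemma gradedPerm_succ_succ (a b : Fin L) :
    gradedPerm a.succ b.succ = lift (gradedPerm a b) := by
  unfold gradedPerm
  simp only [map_sum, map_smul]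
  refine Finset.sum_congr rfl fun α _ => Finset.sum_congr rfl fun β _ => congrArg _ ?_
  refine op_ext_cons fun s σ t τ => ?_
  rw [lift_apply_cons, Matrix.mul_apply, sum_conf_succ, Finset.sum_eq_single s]
  · by_cases h : s = t
    · subst h
      simp only [siteE_succ_apply_cons, if_true, Matrix.mul_apply]
      refine Finset.sum_congr rfl fun ρ _ => ?_
      have h1 : (-1 : ℂ) ^ ((parity α + parity β) * parity s) *
          (-1 : ℂ) ^ ((parity β + parity α) * parity s) = 1 := by
        rw [← pow_add, Even.neg_one_pow]
        exact ⟨(parity α + parity β) * parity s, by ring⟩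
      linear_combination (siteE a α β σ ρ * siteE b β α ρ τ) * h1
    · simp [siteE_succ_apply_cons, h]
  · intro r _ hr
    simp [siteE_succ_apply_cons, hr.symm]
  · simp

/-- Evenness is what removes the sign for passing the new site. -/
lemma siteOp_succ (a : Fin L) {X : Matrix (Fin 3) (Fin 3) ℂ} (hX : IsEvenMatrix X) :
    siteOp a.succ X = lift (siteOp a X) := by
  unfold siteOp
  simp only [map_sum, map_smul]
  refine Finset.sum_congr rfl fun i _ => Finset.sum_congr rfl fun j _ => ?_
  by_cases h0 : X i j = 0
  · simp [h0]
  refine congrArg _ (op_ext_cons fun s σ t τ => ?_)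
  rw [siteE_succ_apply_cons, lift_apply_cons, hX i j h0, Even.neg_one_pow, one_mul]
  exact ⟨parity j * parity t, by ring⟩

lemma gradedPerm_zero_succ_apply (a : Fin L) (s t : Fin 3) (σ τ : Conf L) :
    gradedPerm 0 a.succ (Fin.cons s σ : Conf (L + 1)) (Fin.cons t τ) =
      (-1 : ℂ) ^ (parity s * parity t) * siteE a t s σ τ := by
  have key : ∀ α β, (siteE 0 α β * siteE a.succ β α : Op (L + 1)) (Fin.cons s σ) (Fin.cons t τ) =
      if s = α then if t = β then
        (-1 : ℂ) ^ ((parity β + parity α) * parity t) * siteE a β α σ τ else 0 else 0 := by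
    intro α β
    rw [Matrix.mul_apply, sum_conf_succ, Finset.sum_eq_single t, Finset.sum_eq_single σ]
    · by_cases h1 : s = α <;> by_cases h2 : t = β <;>
        simp [siteE_zero_apply_cons, siteE_succ_apply_cons, h1, h2]
    · intro ρ _ hρ
      simp [siteE_zero_apply_cons, hρ.symm]
    · simp
    · intro r _ hr
      simp [siteE_succ_apply_cons, hr]
    · simp
  unfold gradedPerm
  simp only [Matrix.sum_apply, Matrix.smul_apply, key]
  simp only [smul_ite, smul_zero, Finset.sum_ite_irrel, Finset.sum_ite_eq, Finset.mem_univ,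
    if_true, Finset.sum_const_zero]
  rw [smul_eq_mul, ← mul_assoc, ← pow_add]
  congr 1
  refine neg_one_pow_eq_of_even_add ?_
  fin_cases s <;> fin_cases t <;> decide

/-- The sign in the supertrace cancels the sign of the graded exchange, leaving the sum of the
diagonal units at a. -/
lemma strLin_gradedPerm_zero (a : Fin N) : strLin (gradedPerm 0 a.succ) = 1 := by
  rw [← sum_siteE_diag a]
  ext σ τ
  rw [strLin_apply_apply, Matrix.sum_apply]
  refine Finset.sum_congr rfl fun s _ => ?_
  rw [gradedPerm_zero_succ_apply, ← mul_assoc, ← pow_add, Even.neg_one_pow, one_mul]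
  fin_cases s <;> decide

lemma gradedPerm_zero_one_apply (s k t l : Fin 3) (σ τ : Conf N) :
    (gradedPerm 0 1 : Op (N + 2)) (Fin.cons s (Fin.cons k σ : Conf (N + 1)) : Conf (N + 2))
      (Fin.cons t (Fin.cons l τ : Conf (N + 1))) =
      if l = s ∧ k = t ∧ σ = τ then (-1 : ℂ) ^ (parity s * parity t) else 0 := by
  rw [← Fin.succ_zero_eq_one, gradedPerm_zero_succ_apply, siteE_zero_apply_cons]
  simp

lemma gradedPerm_zero_one_mul_apply (X : Op (N + 2)) (s k : Fin 3) (σ : Conf N)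
    (τ : Conf (N + 2)) :
    (gradedPerm 0 1 * X : Op (N + 2)) (Fin.cons s (Fin.cons k σ : Conf (N + 1))) τ =
      (-1 : ℂ) ^ (parity s * parity k) * X (Fin.cons k (Fin.cons s σ : Conf (N + 1))) τ := by
  rw [Matrix.mul_apply, sum_conf_succ, Finset.sum_eq_single k, sum_conf_succ,
    Finset.sum_eq_single s, Finset.sum_eq_single σ]
  · simp [gradedPerm_zero_one_apply]
  · intro b _ hb
    simp [gradedPerm_zero_one_apply, hb.symm]
  · simp
  · intro b _ hb
    simp [gradedPerm_zero_one_apply, hb]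
  · simp
  · intro b _ hb
    simp [sum_conf_succ, gradedPerm_zero_one_apply, hb.symm]
  · simp

lemma mul_gradedPerm_zero_one_apply (X : Op (N + 2)) (t l : Fin 3) (τ : Conf N)
    (σ : Conf (N + 2)) :
    (X * gradedPerm 0 1 : Op (N + 2)) σ (Fin.cons t (Fin.cons l τ : Conf (N + 1))) =
      (-1 : ℂ) ^ (parity t * parity l) * X σ (Fin.cons l (Fin.cons t τ : Conf (N + 1))) := by
  rw [Matrix.mul_apply, sum_conf_succ, Finset.sum_eq_single l, sum_conf_succ,
    Finset.sum_eq_single t, Finset.sum_eq_single τ]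
  · simp [gradedPerm_zero_one_apply, mul_comm]
  · intro b _ hb
    simp [gradedPerm_zero_one_apply, hb]
  · simp
  · intro b _ hb
    simp [gradedPerm_zero_one_apply, hb]
  · simp
  · intro b _ hb
    simp [sum_conf_succ, gradedPerm_zero_one_apply, hb.symm]
  · simp

lemma strLin_strLin_apply (X : Op (N + 2)) (σ τ : Conf N) :
    strLin (strLin X) σ τ = ∑ k : Fin 3, ∑ s : Fin 3, (-1 : ℂ) ^ (parity k + parity s) *
      X (Fin.cons s (Fin.cons k σ : Conf (N + 1))) (Fin.cons s (Fin.cons k τ : Conf (N + 1))) := by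
  simp only [strLin_apply_apply, Finset.mul_sum, pow_add, mul_assoc]

/-- The supertrace over the first two sites is invariant under their graded permutation. -/
lemma strLin_strLin_gradedPerm_comm (X : Op (N + 2)) :
    strLin (strLin (gradedPerm 0 1 * X)) =
      strLin (strLin (X * gradedPerm 0 1)) := by
  ext σ τ
  simp only [strLin_strLin_apply, gradedPerm_zero_one_mul_apply, mul_gradedPerm_zero_one_apply]
  rw [Finset.sum_comm]
  refine Finset.sum_congr rfl fun _ _ => Finset.sum_congr rfl fun _ _ => ?_
  rw [add_comm, mul_comm (parity _) (parity _)]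

/-- Conjugation exchanges the two front sites, so tracing over site 0 now traces the auxiliary site
of X. This lets a double supertrace of two monodromies split into a product of transfer matrices. -/
lemma strLin_conj_lift (X : Op (N + 1)) :
    strLin (gradedPerm 0 1 * lift X * gradedPerm 0 1) =
      lift (strLin X) := by
  refine op_ext_cons fun k σ l τ => ?_
  rw [lift_apply_cons, strLin_apply_apply, strLin_apply_apply]
  simp only [mul_assoc, gradedPerm_zero_one_mul_apply]
  simp only [mul_gradedPerm_zero_one_apply, lift_apply_cons]
  by_cases h : k = l
  · subst h
    simp only [if_true]
    refine Finset.sum_congr rfl fun s _ => ?_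
    have h1 : (-1 : ℂ) ^ (parity s * parity k) * (-1 : ℂ) ^ (parity s * parity k) = 1 := by
      rw [← pow_add, Even.neg_one_pow ⟨_, rfl⟩]
    linear_combination ((-1 : ℂ) ^ parity s * X (Fin.cons s σ) (Fin.cons s τ)) * h1
  · simp [h]

lemma strLin_siteOp_zero (X : Matrix (Fin 3) (Fin 3) ℂ) :
    strLin (siteOp (0 : Fin (N + 1)) X) = (∑ i, (-1 : ℂ) ^ parity i * X i i) • (1 : Op N) := by
  ext σ τ
  simp only [strLin_apply_apply, siteOp, Matrix.sum_apply, Matrix.smul_apply,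
    siteE_zero_apply_cons, Matrix.one_apply]
  by_cases h : σ = τ
  · simp [h, ite_and]
  · simp [h]

end GL12

end

/-! ### Yang–Baxter equation, commuting transfer matrices, values at the inhomogeneities -/

noncomputable section

namespace GL12

variable {L N : ℕ}

/-! ### Local relations of the R-matrix -/

lemma rMatrix_commute {η u v : ℂ} {a b c e : Fin L} (hac : a ≠ c) (hae : a ≠ e) (hbc : b ≠ c)
    (hbe : b ≠ e) : Commute (rMatrix η a b u) (rMatrix η c e v) := by
  unfold rMatrix
  have h : Commute (gradedPerm a b) (gradedPerm c e) := gradedPerm_commute hac hae hbc hbe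
  exact Commute.add_left (((Commute.one_left _).smul_left _)) <|
    (Commute.add_right ((Commute.one_right _).smul_right _) (h.smul_right _)).smul_left _

lemma siteOp_commute_rMatrix {η u : ℂ} {a b c : Fin L} (ha : c ≠ a) (hb : c ≠ b)
    (X : Matrix (Fin 3) (Fin 3) ℂ) : Commute (siteOp c X) (rMatrix η a b u) := by
  unfold rMatrix
  exact Commute.add_right ((Commute.one_right _).smul_right _)
    ((siteOp_commute_gradedPerm ha hb X).smul_right _)

lemma gradedPerm_commute_rMatrix {η u : ℂ} {a b c e : Fin L} (hac : a ≠ c) (hae : a ≠ e)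
    (hbc : b ≠ c) (hbe : b ≠ e) : Commute (gradedPerm a b) (rMatrix η c e u) := by
  unfold rMatrix
  exact Commute.add_right ((Commute.one_right _).smul_right _)
    ((gradedPerm_commute hac hae hbc hbe).smul_right _)

lemma gradedPerm_mul_rMatrix {η u : ℂ} {a b c : Fin L} (hac : a ≠ c) (hbc : b ≠ c) :
    gradedPerm a b * rMatrix η b c u = rMatrix η a c u * gradedPerm a b := by
  simp only [rMatrix, mul_add, add_mul, mul_smul_comm, smul_mul_assoc, mul_one, one_mul,
    gradedPerm_mul_gradedPerm hac hbc]

/-- The Yang–Baxter equation. -/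
lemma yangBaxter (η u v : ℂ) {a b c : Fin L} (hab : a ≠ b) (hac : a ≠ c) (hbc : b ≠ c) :
    rMatrix η a b (u - v) * (rMatrix η a c u * rMatrix η b c v) =
      rMatrix η b c v * rMatrix η a c u * rMatrix η a b (u - v) := by
  -- Every product of two distinct transpositions is one of the two 3-cycles P_ab P_ac and P_ac
  -- P_ab; after this reduction only scalar coefficients remain to be compared.
  have e1 : gradedPerm a c * gradedPerm b c = gradedPerm a b * gradedPerm a c := by
    rw [gradedPerm_comm hbc, gradedPerm_mul_gradedPerm hab hbc.symm]
  have e2 : gradedPerm b c * gradedPerm a b = gradedPerm a b * gradedPerm a c := by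
    rw [gradedPerm_comm hab, gradedPerm_mul_gradedPerm hbc hac]
  have e3 : gradedPerm a b * gradedPerm b c = gradedPerm a c * gradedPerm a b :=
    gradedPerm_mul_gradedPerm hac hbc
  have e4 : gradedPerm b c * gradedPerm a c = gradedPerm a c * gradedPerm a b := by
    rw [gradedPerm_comm hac, gradedPerm_mul_gradedPerm hab.symm hac.symm, gradedPerm_comm hab.symm,
      gradedPerm_comm hac.symm, e3]
  have e5 : gradedPerm a b * (gradedPerm a c * gradedPerm b c) =
      gradedPerm b c * gradedPerm a c * gradedPerm a b := by
    rw [e1, ← mul_assoc, gradedPerm_mul_self hab, one_mul, e4, mul_assoc, gradedPerm_mul_self hab,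
      mul_one]
  simp only [rMatrix, mul_add, add_mul, mul_smul_comm, smul_mul_assoc, mul_one, one_mul]
  rw [e5, e1, e2, e3, e4]
  module

/-- At x - y = -η the R-matrix degenerates to η(P - 1), so the Yang–Baxter equation says that the
pair of R-matrices preserves graded symmetric vectors. This is the mechanism of fusion. -/
lemma gradedPerm_mul_of_invariant {η : ℂ} (hη : η ≠ 0) (x y : ℂ) (hxy : y = x + η)
    {a b c : Fin L} (hab : a ≠ b) (hac : a ≠ c) (hbc : b ≠ c) {Y : Op L}
    (hY : gradedPerm a b * Y = Y) :
    gradedPerm a b * (rMatrix η a c x * rMatrix η b c y * Y) =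
      rMatrix η a c x * rMatrix η b c y * Y := by
  have h0 : ∀ Z : Op L, rMatrix η a b (x - y) * Z = η • (gradedPerm a b * Z - Z) := by
    intro Z
    rw [rMatrix, add_mul, smul_mul_assoc, smul_mul_assoc, one_mul, hxy]
    module
  have h1 : rMatrix η a b (x - y) * (rMatrix η a c x * rMatrix η b c y * Y) = 0 := by
    rw [← mul_assoc, yangBaxter η x y hab hac hbc, mul_assoc, h0, hY, sub_self, smul_zero,
      mul_zero]
  rw [h0] at h1
  exact sub_eq_zero.1 ((smul_eq_zero.1 h1).resolve_left hη)

lemma rMatrix_zero (η : ℂ) (a b : Fin L) : rMatrix η a b 0 = η • gradedPerm a b := by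
  simp [rMatrix]

/-! ### Products over lists of sites -/

lemma list_prod_map_mul_of_commute {ι M : Type*} [Monoid M] {l : List ι} (hl : l.Nodup)
    {f g : ι → M} (h : ∀ i ∈ l, ∀ j ∈ l, i ≠ j → Commute (f i) (g j)) :
    (l.map f).prod * (l.map g).prod = (l.map fun i => f i * g i).prod := by
  induction l with
  | nil => simp
  | cons a l ih =>
    rw [List.nodup_cons] at hl
    have h1 : Commute (l.map f).prod (g a) := by
      refine Commute.list_prod_left _ _ fun x hx => ?_
      obtain ⟨i, hi, rfl⟩ := List.mem_map.1 hx
      exact h i (List.mem_cons_of_mem _ hi) a List.mem_cons_self fun e => hl.1 (e ▸ hi)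
    rw [List.map_cons, List.map_cons, List.map_cons, List.prod_cons, List.prod_cons,
      List.prod_cons, ← ih hl.2 fun i hi j hj =>
        h i (List.mem_cons_of_mem _ hi) j (List.mem_cons_of_mem _ hj)]
    rw [mul_assoc, ← mul_assoc (l.map f).prod, h1.eq]
    simp only [mul_assoc]

lemma commute_list_map_prod {ι M : Type*} [Monoid M] {l : List ι} {f : ι → M} {x : M}
    (h : ∀ i ∈ l, Commute x (f i)) : Commute x (l.map f).prod := by
  refine Commute.list_prod_right _ _ fun y hy => ?_
  obtain ⟨i, hi, rfl⟩ := List.mem_map.1 hy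
  exact h i hi

lemma semiconj_list_map_prod {ι M : Type*} [Monoid M] {l : List ι} {f g : ι → M} {x : M}
    (h : ∀ i ∈ l, x * f i = g i * x) : x * (l.map f).prod = (l.map g).prod * x := by
  induction l with
  | nil => simp
  | cons a l ih =>
    rw [List.map_cons, List.map_cons, List.prod_cons, List.prod_cons, ← mul_assoc,
      h a List.mem_cons_self, mul_assoc, ih fun i hi => h i (List.mem_cons_of_mem _ hi), mul_assoc]

lemma invariant_list_map_prod {ι M : Type*} [Monoid M] {l : List ι} {f : ι → M} {p : M}
    (h : ∀ i ∈ l, ∀ Y, p * Y = Y → p * (f i * Y) = f i * Y) {Y : M} (hY : p * Y = Y) :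
    p * ((l.map f).prod * Y) = (l.map f).prod * Y := by
  induction l with
  | nil => simpa using hY
  | cons a l ih =>
    rw [List.map_cons, List.prod_cons, mul_assoc]
    exact h a List.mem_cons_self _ (ih fun i hi => h i (List.mem_cons_of_mem _ hi))

/-! ### The monodromy with two auxiliary spaces -/

variable (η : ℂ) (K : Matrix (Fin 3) (Fin 3) ℂ) (ξ : Fin N → ℂ)

/-- The quantum sites, in the order of the factors of the monodromy matrix. -/
abbrev sites (N : ℕ) : List (Fin N) := (List.finRange N).reverse

lemma sites_nodup (N : ℕ) : (sites N).Nodup := List.nodup_reverse.2 (List.nodup_finRange N)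

/-- The monodromy matrix with auxiliary space `c`, where the sites `0` and `1` are two auxiliary
spaces and `n.succ.succ` are the quantum spaces. -/
def auxMonodromy (c : Fin (N + 2)) (u : ℂ) : Op (N + 2) :=
  siteOp c K * ((sites N).map fun n => rMatrix η c n.succ.succ (u - ξ n)).prod

lemma lift_rMatrix (a b : Fin L) (u : ℂ) :
    lift (rMatrix η a b u) = rMatrix η a.succ b.succ u := by
  simp [rMatrix, gradedPerm_succ_succ]

variable {K} in
lemma lift_monodromy (hK : IsEvenMatrix K) (u : ℂ) :
    lift (monodromy η K ξ u) = auxMonodromy η K ξ 1 u := by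
  rw [monodromy, auxMonodromy, map_mul, ← siteOp_succ _ hK, map_list_prod, List.map_map]
  simp only [Function.comp_def, lift_rMatrix, Fin.succ_zero_eq_one]

lemma conj_auxMonodromy (u : ℂ) :
    gradedPerm 0 1 * auxMonodromy η K ξ 1 u * gradedPerm 0 1 = auxMonodromy η K ξ 0 u := by
  have h01 : (0 : Fin (N + 2)) ≠ 1 := by simp
  have h : gradedPerm (0 : Fin (N + 2)) 1 * auxMonodromy η K ξ 1 u =
      auxMonodromy η K ξ 0 u * gradedPerm 0 1 := by
    rw [auxMonodromy, ← mul_assoc, gradedPerm_mul_siteOp_right, mul_assoc,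
      semiconj_list_map_prod (g := fun n : Fin N => rMatrix η 0 n.succ.succ (u - ξ n)),
      auxMonodromy, mul_assoc]
    intro n _
    refine gradedPerm_mul_rMatrix (Fin.succ_ne_zero _).symm ?_
    rw [← Fin.succ_zero_eq_one]
    exact fun e => Fin.succ_ne_zero _ (Fin.succ_injective _ e).symm
  rw [h, mul_assoc, gradedPerm_mul_self h01, mul_one]

lemma transfer_eq (u : ℂ) : transfer η K ξ u = strLin (monodromy η K ξ u) := rfl

variable {K} in
lemma strLin_auxMonodromy_zero (hK : IsEvenMatrix K) (u : ℂ) :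
    strLin (auxMonodromy η K ξ 0 u) = lift (transfer η K ξ u) := by
  rw [← conj_auxMonodromy, ← lift_monodromy η ξ hK, strLin_conj_lift, transfer_eq]

-- A lifted factor can be pulled out of one supertrace at a time; the conjugation lemma converts the
-- other auxiliary space.
variable {K} in
lemma transfer_mul_transfer (hK : IsEvenMatrix K) (u v : ℂ) :
    transfer η K ξ u * transfer η K ξ v =
      strLin (strLin (auxMonodromy η K ξ 0 u * auxMonodromy η K ξ 1 v)) := by
  rw [← lift_monodromy η ξ hK, strLin_mul_lift, strLin_auxMonodromy_zero η ξ hK, strLin_lift_mul,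
    transfer_eq η K ξ v]

variable {K} in
lemma transfer_mul_transfer' (hK : IsEvenMatrix K) (u v : ℂ) :
    transfer η K ξ v * transfer η K ξ u =
      strLin (strLin (auxMonodromy η K ξ 1 v * auxMonodromy η K ξ 0 u)) := by
  rw [← lift_monodromy η ξ hK, strLin_lift_mul, strLin_auxMonodromy_zero η ξ hK, strLin_mul_lift,
    transfer_eq η K ξ v]

lemma zero_ne_one_fin : (0 : Fin (N + 2)) ≠ 1 := by simp

lemma zero_ne_succ_succ (n : Fin N) : (0 : Fin (N + 2)) ≠ n.succ.succ := (Fin.succ_ne_zero _).symm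

lemma one_ne_succ_succ (n : Fin N) : (1 : Fin (N + 2)) ≠ n.succ.succ := by
  rw [← Fin.succ_zero_eq_one]
  exact fun e => Fin.succ_ne_zero _ (Fin.succ_injective _ e).symm

lemma succ_succ_ne {n m : Fin N} (h : n ≠ m) : n.succ.succ ≠ m.succ.succ := by
  simpa using h

lemma auxMonodromy_mul_eq {c e : Fin (N + 2)} (hce : c ≠ e)
    (hc : ∀ n : Fin N, c ≠ n.succ.succ) (he : ∀ n : Fin N, e ≠ n.succ.succ) (u v : ℂ) :
    auxMonodromy η K ξ c u * auxMonodromy η K ξ e v = siteOp c K * siteOp e K *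
      ((sites N).map fun n =>
        rMatrix η c n.succ.succ (u - ξ n) * rMatrix η e n.succ.succ (v - ξ n)).prod := by
  rw [← list_prod_map_mul_of_commute (sites_nodup N)]
  · have h : Commute (siteOp e K)
        ((sites N).map fun n => rMatrix η c n.succ.succ (u - ξ n)).prod :=
      commute_list_map_prod fun n _ => siteOp_commute_rMatrix hce.symm (he n) K
    rw [auxMonodromy, auxMonodromy, mul_assoc, ← mul_assoc _ (siteOp e K), ← h.eq]
    simp only [mul_assoc]
  · intro n _ m _ hnm
    exact rMatrix_commute hce (hc m) (he n).symm (succ_succ_ne hnm)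

variable {K} in
/-- The `RTT` relation. -/
lemma rMatrix_mul_auxMonodromy (hK : IsEvenMatrix K) (u v : ℂ) :
    rMatrix η 0 1 (u - v) * (auxMonodromy η K ξ 0 u * auxMonodromy η K ξ 1 v) =
      auxMonodromy η K ξ 1 v * auxMonodromy η K ξ 0 u * rMatrix η 0 1 (u - v) := by
  rw [auxMonodromy_mul_eq η K ξ zero_ne_one_fin zero_ne_succ_succ one_ne_succ_succ,
    auxMonodromy_mul_eq η K ξ zero_ne_one_fin.symm one_ne_succ_succ zero_ne_succ_succ]
  have hKK : Commute (siteOp (0 : Fin (N + 2)) K) (siteOp 1 K) :=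
    siteOp_commute_siteOp zero_ne_one_fin K hK
  have h1 : rMatrix η (0 : Fin (N + 2)) 1 (u - v) * (siteOp 0 K * siteOp 1 K) =
      siteOp 1 K * siteOp 0 K * rMatrix η 0 1 (u - v) := by
    have h2 : gradedPerm (0 : Fin (N + 2)) 1 * (siteOp 0 K * siteOp 1 K) =
        siteOp 1 K * siteOp 0 K * gradedPerm 0 1 := by
      rw [← mul_assoc, gradedPerm_mul_siteOp_left zero_ne_one_fin, mul_assoc,
        gradedPerm_mul_siteOp_right, mul_assoc]
    rw [rMatrix, add_mul, mul_add, smul_mul_assoc, smul_mul_assoc, h2, hKK.eq]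
    simp
  rw [← mul_assoc, h1, mul_assoc, mul_assoc (siteOp 1 K * siteOp 0 K)]
  congr 1
  refine semiconj_list_map_prod fun n _ => ?_
  have := yangBaxter η (u - ξ n) (v - ξ n) zero_ne_one_fin (zero_ne_succ_succ n)
    (one_ne_succ_succ n)
  rwa [sub_sub_sub_cancel_right] at this

variable {K} in
lemma transfer_commute_of_ne (hK : IsEvenMatrix K) {u v : ℂ} (huv : (u - v) ^ 2 ≠ η ^ 2) :
    transfer η K ξ u * transfer η K ξ v = transfer η K ξ v * transfer η K ξ u := by
  rw [transfer_mul_transfer η ξ hK, transfer_mul_transfer' η ξ hK]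
  set X := auxMonodromy η K ξ 0 u * auxMonodromy η K ξ 1 v with hX
  set X' := auxMonodromy η K ξ 1 v * auxMonodromy η K ξ 0 u with hX'
  have hR : rMatrix η 0 1 (u - v) * X = X' * rMatrix η 0 1 (u - v) :=
    rMatrix_mul_auxMonodromy η ξ hK u v
  -- Up to the scalar (u - v)² - η², this is the inverse of R(u - v). Conjugating the RTT relation
  -- needs cyclicity of the double supertrace only for P and scalars.
  set R' : Op (N + 2) := (u - v) • (1 : Op (N + 2)) - η • gradedPerm 0 1 with hR'
  have hP : gradedPerm (0 : Fin (N + 2)) 1 * gradedPerm 0 1 = 1 :=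
    gradedPerm_mul_self zero_ne_one_fin
  have e1 : R' * rMatrix η 0 1 (u - v) = ((u - v) ^ 2 - η ^ 2) • (1 : Op (N + 2)) := by
    simp only [hR', rMatrix, sub_mul, mul_add, smul_mul_assoc, mul_smul_comm, one_mul,
      mul_one, hP]
    module
  have e2 : rMatrix η 0 1 (u - v) * R' = ((u - v) ^ 2 - η ^ 2) • (1 : Op (N + 2)) := by
    simp only [hR', rMatrix, mul_sub, add_mul, smul_mul_assoc, mul_smul_comm, one_mul,
      mul_one, hP]
    module
  have e3 : strLin (strLin (R' * (X' * rMatrix η 0 1 (u - v)))) =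
      strLin (strLin (X' * rMatrix η 0 1 (u - v) * R')) := by
    simp only [hR', sub_mul, mul_sub, smul_mul_assoc, mul_smul_comm, one_mul, mul_one, map_sub,
      map_smul, strLin_strLin_gradedPerm_comm]
  rw [← hR, ← mul_assoc, e1, hR, mul_assoc, e2] at e3
  simp only [smul_mul_assoc, mul_smul_comm, one_mul, mul_one, map_smul] at e3
  exact smul_right_injective _ (sub_ne_zero.2 huv) e3

/-! ### The transfer matrix at the inhomogeneities -/

lemma exists_sites_split (a : Fin N) :
    ∃ l₁ l₂ : List (Fin N), sites N = l₁ ++ a :: l₂ ∧ l₁.Nodup ∧ l₂.Nodup ∧ a ∉ l₁ ∧ a ∉ l₂ ∧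
      (∀ i ∈ l₁, i ∉ l₂) ∧ ∀ i, i ≠ a → i ∈ l₁ ∨ i ∈ l₂ := by
  have ha : a ∈ sites N := List.mem_reverse.2 (List.mem_finRange a)
  obtain ⟨l₁, l₂, h⟩ := List.append_of_mem ha
  have hn := sites_nodup N
  have hmem : ∀ i, i ∈ sites N := fun i => List.mem_reverse.2 (List.mem_finRange i)
  rw [h, List.nodup_append] at hn
  obtain ⟨h1, h2, h3⟩ := hn
  rw [List.nodup_cons] at h2
  refine ⟨l₁, l₂, h, h1, h2.2, fun h4 => h3 a h4 a List.mem_cons_self rfl, h2.1,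
    fun i hi hi' => h3 i hi i (List.mem_cons_of_mem _ hi') rfl, fun i hi => ?_⟩
  have := hmem i
  rw [h, List.mem_append, List.mem_cons] at this
  tauto

-- R(0) = ηP transfers the auxiliary space to site a, after which the supertrace sees only P and
-- gives the identity. The result no longer involves an auxiliary space and is visibly polynomial in
-- ξ.
variable {K} in
lemma transfer_inhomogeneity (hK : IsEvenMatrix K) {a : Fin N} {l₁ l₂ : List (Fin N)}
    (hl : sites N = l₁ ++ a :: l₂) (h₁ : a ∉ l₁) (h₂ : a ∉ l₂) (h₁₂ : ∀ i ∈ l₁, i ∉ l₂) :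
    transfer η K ξ (ξ a) = η • ((l₂.map fun n => rMatrix η a n (ξ a - ξ n)).prod * siteOp a K *
      (l₁.map fun n => rMatrix η a n (ξ a - ξ n)).prod) := by
  have hne : ∀ {l : List (Fin N)}, a ∉ l → ∀ n ∈ l, a ≠ n := fun h n hn e => h (e ▸ hn)
  set A := (l₁.map fun n : Fin N => rMatrix η 0 n.succ (ξ a - ξ n)).prod with hA
  set B := (l₂.map fun n : Fin N => rMatrix η 0 n.succ (ξ a - ξ n)).prod with hB
  set A' := (l₁.map fun n : Fin N => rMatrix η a.succ n.succ (ξ a - ξ n)).prod with hA'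
  set B' := (l₂.map fun n : Fin N => rMatrix η a.succ n.succ (ξ a - ξ n)).prod with hB'
  have hlift : ∀ l : List (Fin N), lift (l.map fun n => rMatrix η a n (ξ a - ξ n)).prod =
      (l.map fun n : Fin N => rMatrix η a.succ n.succ (ξ a - ξ n)).prod := by
    intro l
    rw [map_list_prod, List.map_map]
    simp only [Function.comp_def, lift_rMatrix]
  have h0 : monodromy η K ξ (ξ a) = η • (siteOp 0 K * A * gradedPerm 0 a.succ * B) := by
    rw [monodromy, ← sites, hl, List.map_append, List.map_cons, List.prod_append, List.prod_cons,
      sub_self, rMatrix_zero]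
    simp only [smul_mul_assoc, mul_smul_comm, mul_assoc, hA, hB]
  have h3 : ∀ l : List (Fin N), a ∉ l →
      gradedPerm 0 a.succ * (l.map fun n : Fin N => rMatrix η 0 n.succ (ξ a - ξ n)).prod =
        (l.map fun n : Fin N => rMatrix η a.succ n.succ (ξ a - ξ n)).prod *
          gradedPerm 0 a.succ := by
    intro l h
    refine semiconj_list_map_prod fun n hn => ?_
    rw [gradedPerm_comm (Fin.succ_ne_zero a).symm]
    exact gradedPerm_mul_rMatrix (by simpa using hne h n hn) (Fin.succ_ne_zero n).symm
  have h4 : ∀ l : List (Fin N), a ∉ l →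
      gradedPerm 0 a.succ * (l.map fun n : Fin N => rMatrix η a.succ n.succ (ξ a - ξ n)).prod =
        (l.map fun n : Fin N => rMatrix η 0 n.succ (ξ a - ξ n)).prod * gradedPerm 0 a.succ := by
    intro l h
    refine semiconj_list_map_prod fun n hn => ?_
    exact gradedPerm_mul_rMatrix (Fin.succ_ne_zero n).symm (by simpa using hne h n hn)
  have h5 : siteOp 0 K * A * gradedPerm 0 a.succ =
      gradedPerm 0 a.succ * (siteOp a.succ K * A') := by
    rw [← mul_assoc, gradedPerm_mul_siteOp_right, mul_assoc, mul_assoc, h4 _ h₁]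
  -- One side lives on a and the sites of l₁, the other on the auxiliary site and the sites of l₂,
  -- and these are disjoint.
  have h6 : Commute (siteOp a.succ K * A') B := by
    refine Commute.mul_left (commute_list_map_prod fun n hn => ?_)
      (commute_list_map_prod fun n hn => (commute_list_map_prod fun m hm => ?_).symm)
    · exact siteOp_commute_rMatrix (Fin.succ_ne_zero a) (by simpa using hne h₂ n hn) K
    · refine rMatrix_commute (Fin.succ_ne_zero a).symm (Fin.succ_ne_zero m).symm
        (by simpa using (hne h₂ n hn).symm) ?_
      simp only [ne_eq, Fin.succ_inj]
      exact fun e => h₁₂ m hm (e ▸ hn)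
  rw [transfer_eq, h0, map_smul, h5, mul_assoc, h6.eq, ← mul_assoc, h3 _ h₂, ← hB', hA',
    ← hlift, siteOp_succ a hK, ← map_mul, hB', ← hlift, mul_assoc, strLin_lift_mul,
    strLin_mul_lift, strLin_gradedPerm_zero, one_mul, mul_assoc]

end GL12

end

/-! ### Fusion of two and three auxiliary spaces -/

noncomputable section

namespace GL12

variable {L N : ℕ}

/-! ### Fusion -/

section Fusion

variable (η : ℂ) (K : Matrix (Fin 3) (Fin 3) ℂ) (ξ : Fin N → ℂ)

/-- The pair of R-matrices that couples the two auxiliary spaces to the quantum space `n`. -/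
def pairFactor (u : ℂ) (n : Fin N) : Op (N + 2) :=
  rMatrix η 0 n.succ.succ (u - ξ n) * rMatrix η 1 n.succ.succ (u + η - ξ n)

/-- The fused transfer matrix: its auxiliary space is the graded symmetric square. -/
def fusedTransfer (u : ℂ) : Op N :=
  (1 / 2 : ℂ) • strLin (strLin (auxMonodromy η K ξ 0 u * auxMonodromy η K ξ 1 (u + η) *
    (1 + gradedPerm 0 1)))

lemma auxMonodromy_mul_pair (u : ℂ) :
    auxMonodromy η K ξ 0 u * auxMonodromy η K ξ 1 (u + η) =
      siteOp 0 K * siteOp 1 K * ((sites N).map (pairFactor η ξ u)).prod :=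
  auxMonodromy_mul_eq η K ξ zero_ne_one_fin zero_ne_succ_succ one_ne_succ_succ u (u + η)

variable {η K}

lemma pairFactor_invariant (hη : η ≠ 0) (u : ℂ) (n : Fin N) {Y : Op (N + 2)}
    (hY : gradedPerm 0 1 * Y = Y) :
    gradedPerm 0 1 * (pairFactor η ξ u n * Y) = pairFactor η ξ u n * Y :=
  gradedPerm_mul_of_invariant hη _ _ (by ring) zero_ne_one_fin (zero_ne_succ_succ n)
    (one_ne_succ_succ n) hY

lemma gradedPerm_commute_siteOp_pair (hK : IsEvenMatrix K) :
    Commute (gradedPerm (0 : Fin (N + 2)) 1) (siteOp 0 K * siteOp 1 K) := by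
  rw [Commute, SemiconjBy, ← mul_assoc, gradedPerm_mul_siteOp_left zero_ne_one_fin, mul_assoc,
    gradedPerm_mul_siteOp_right, ← mul_assoc,
    (siteOp_commute_siteOp zero_ne_one_fin K hK).eq]

lemma gradedPerm_mul_gradedPerm' {a b c : Fin L} (hab : a ≠ b) (hac : a ≠ c) (hbc : b ≠ c) :
    gradedPerm a c * gradedPerm b c = gradedPerm b c * gradedPerm a b := by
  rw [gradedPerm_comm hbc, gradedPerm_comm hab, gradedPerm_mul_gradedPerm hac.symm hab.symm,
    gradedPerm_comm hac]

lemma gradedPerm_mul_one_add {a b : Fin L} (hab : a ≠ b) :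
    gradedPerm a b * (1 + gradedPerm a b) = 1 + gradedPerm a b := by
  rw [mul_add, gradedPerm_mul_self hab, mul_one, add_comm]

/-- Here the pair of R-matrices at site a is η² P_0a (1 + P_1a), whose image is P_01-invariant, and
all factors to its left preserve invariance. So P_01 acts trivially on the product, and the
symmetrizer can be dropped under the supertrace. -/
lemma fusedTransfer_inhomogeneity (hη : η ≠ 0) (hK : IsEvenMatrix K) (a : Fin N) :
    fusedTransfer η K ξ (ξ a) = transfer η K ξ (ξ a) * transfer η K ξ (ξ a + η) := by
  rw [transfer_mul_transfer η ξ hK, fusedTransfer]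
  set W := auxMonodromy η K ξ 0 (ξ a) * auxMonodromy η K ξ 1 (ξ a + η) with hW
  have h01 : (0 : Fin (N + 2)) ≠ 1 := zero_ne_one_fin
  have hinv : gradedPerm 0 1 * W = W := by
    obtain ⟨l₁, l₂, hl, -⟩ := exists_sites_split a
    have h0a := zero_ne_succ_succ a
    have h1a := one_ne_succ_succ a
    have e0 : rMatrix η 1 a.succ.succ (ξ a + η - ξ a) =
        η • (1 + gradedPerm 1 a.succ.succ : Op (N + 2)) := by
      rw [rMatrix, smul_add, add_sub_cancel_left]
    have e1 : gradedPerm 0 1 * (gradedPerm 0 a.succ.succ * (1 + gradedPerm 1 a.succ.succ)) =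
        gradedPerm 0 a.succ.succ * (1 + gradedPerm (1 : Fin (N + 2)) a.succ.succ) := by
      rw [← mul_assoc, gradedPerm_comm h01, gradedPerm_mul_gradedPerm h1a h0a,
        gradedPerm_comm h01.symm, ← gradedPerm_mul_gradedPerm' h01 h0a h1a, mul_assoc,
        gradedPerm_mul_one_add h1a]
    have e2 : gradedPerm 0 1 * pairFactor η ξ (ξ a) a = pairFactor η ξ (ξ a) a := by
      rw [pairFactor, sub_self, rMatrix_zero, e0, smul_mul_smul_comm, mul_smul_comm, e1]
    rw [hW, auxMonodromy_mul_pair, ← mul_assoc, (gradedPerm_commute_siteOp_pair hK).eq, mul_assoc,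
      hl, List.map_append, List.map_cons, List.prod_append, List.prod_cons,
      invariant_list_map_prod (fun n _ Y hY => pairFactor_invariant ξ hη _ n hY)]
    rw [← mul_assoc, e2]
  rw [mul_add, mul_one, map_add, map_add, ← strLin_strLin_gradedPerm_comm, hinv, ← two_smul ℂ,
    smul_smul]
  norm_num

/-- The pair of R-matrices becomes η² (P_0a - 1) P_1a = η² P_1a (P_01 - 1), which kills symmetric
vectors. -/
lemma pairFactor_mul_eq_zero (a : Fin N) {Y : Op (N + 2)} (hY : gradedPerm 0 1 * Y = Y) :
    pairFactor η ξ (ξ a - η) a * Y = 0 := by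
  have e0 : rMatrix η 0 a.succ.succ (ξ a - η - ξ a) =
      η • (gradedPerm 0 a.succ.succ - 1 : Op (N + 2)) := by
    rw [rMatrix, smul_sub]
    module
  have e1 := gradedPerm_mul_gradedPerm' (zero_ne_one_fin (N := N)) (zero_ne_succ_succ a)
    (one_ne_succ_succ a)
  rw [pairFactor, sub_add_cancel, sub_self, rMatrix_zero, e0, smul_mul_smul_comm, sub_mul, e1,
    one_mul, smul_mul_assoc, sub_mul, mul_assoc, hY, sub_self, smul_zero]

lemma fusedTransfer_eq_zero (hη : η ≠ 0) (a : Fin N) :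
    fusedTransfer η K ξ (ξ a - η) = 0 := by
  obtain ⟨l₁, l₂, hl, -⟩ := exists_sites_split a
  have h : ((sites N).map (pairFactor η ξ (ξ a - η))).prod * (1 + gradedPerm 0 1) = 0 := by
    rw [hl, List.map_append, List.map_cons, List.prod_append, List.prod_cons, mul_assoc, mul_assoc,
      pairFactor_mul_eq_zero, mul_zero]
    exact invariant_list_map_prod (fun n _ Y hY => pairFactor_invariant ξ hη _ n hY)
      (gradedPerm_mul_one_add zero_ne_one_fin)
  rw [fusedTransfer, auxMonodromy_mul_pair, mul_assoc, h]
  simp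

/-! ### Vanishing of the third fused transfer matrix -/

/-- The permutation fixes V but acts by -1 on a repeated odd vector, so this component equals its
own negative. -/
lemma diag_mul_diag_mul_eq_zero {a b : Fin L} (hab : a ≠ b) {V : Op L}
    (hV : gradedPerm a b * V = V) {i : Fin 3} (hi : i ≠ 0) : siteE a i i * siteE b i i * V = 0 := by
  have h1 : (siteE a i i * siteE b i i) * gradedPerm a b =
      gradedPerm a b * (siteE a i i * siteE b i i) := by
    rw [← mul_assoc (gradedPerm a b), gradedPerm_mul_siteE_left hab, mul_assoc (siteE b i i),
      gradedPerm_mul_siteE_right,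
      ← mul_assoc, ← (siteE_commute_of_even hab i i i i ⟨_, rfl⟩).eq]
  have h2 : siteE a i i * siteE b i i * V = -(siteE a i i * siteE b i i * V) := by
    conv_lhs => rw [← hV, ← mul_assoc, h1, gradedPerm_mul_diag_diag hab]
    rw [smul_mul_assoc]
    have : (-1 : ℂ) ^ parity i = -1 := by
      fin_cases i
      · exact absurd rfl hi
      · simp [parity]
      · simp [parity]
    rw [this, neg_one_smul]
  have h3 : (2 : ℂ) • (siteE a i i * siteE b i i * V) = 0 := by
    rw [two_smul]
    nth_rewrite 1 [h2]
    exact neg_add_cancel _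
  exact (smul_eq_zero.1 h3).resolve_left two_ne_zero

/-- Pigeonhole: among three odd labels two coincide, as there are only two of them. This is Λ³ℂ² =
0. -/
lemma odd_odd_odd_mul_eq_zero {a b c : Fin L} (hab : a ≠ b) (hac : a ≠ c) (hbc : b ≠ c) {V : Op L}
    (h₁ : gradedPerm a b * V = V) (h₂ : gradedPerm a c * V = V) (h₃ : gradedPerm b c * V = V)
    {i j k : Fin 3} (hi : i ≠ 0) (hj : j ≠ 0) (hk : k ≠ 0) :
    siteE a i i * siteE b j j * siteE c k k * V = 0 := by
  have hbc' := siteE_commute_of_even hbc j j k k ⟨_, rfl⟩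
  by_cases hij : i = j
  · subst hij
    rw [mul_assoc (siteE a i i), hbc'.eq, ← mul_assoc,
      (siteE_commute_of_even hac i i k k ⟨_, rfl⟩).eq, mul_assoc, mul_assoc,
      ← mul_assoc (siteE a i i), diag_mul_diag_mul_eq_zero hab h₁ hi, mul_zero]
  by_cases hjk : j = k
  · subst hjk
    rw [mul_assoc (siteE a i i), mul_assoc, diag_mul_diag_mul_eq_zero hbc h₃ hj, mul_zero]
  have hik : i = k := by omega
  subst hik
  rw [(siteE_commute_of_even hab i i j j ⟨_, rfl⟩).eq, mul_assoc, mul_assoc,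
    ← mul_assoc (siteE a i i), diag_mul_diag_mul_eq_zero hac h₂ hi, mul_zero]

lemma siteOp_mul_diag (a : Fin L) (X : Matrix (Fin 3) (Fin 3) ℂ) (hX : ∀ i, X i 0 = 0) :
    siteOp a X = siteOp a X * (siteE a 1 1 + siteE a 2 2) := by
  rw [siteOp, Finset.sum_mul]
  refine Finset.sum_congr rfl fun i _ => ?_
  rw [Finset.sum_mul]
  simp only [smul_mul_assoc, mul_add, siteE_mul_siteE_same]
  simp [Fin.sum_univ_three, hX]

lemma mul_mul_eq_of_commute {M : Type*} [Monoid M] {A B C p q r : M} (hA : A = A * p)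
    (hB : B = B * q) (hC : C = C * r) (hp : Commute p (B * C)) (hq : Commute q C) :
    A * (B * C) = A * (B * C) * (p * q * r) := by
  have h1 : B * C = B * C * (q * r) := by
    conv_lhs => rw [hB, hC, mul_assoc, ← mul_assoc q, hq.eq]
    simp only [mul_assoc]
  conv_lhs => rw [hA, h1, mul_assoc, ← mul_assoc p, hp.eq]
  simp only [mul_assoc]

/-- Since K kills the even vector, the odd projector can be inserted at each of the three sites, and
no totally symmetric vector survives it. -/
lemma siteOp_mul_siteOp_mul_siteOp_mul_eq_zero {a b c : Fin L} (hab : a ≠ b) (hac : a ≠ c)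
    (hbc : b ≠ c) {V : Op L} (h₁ : gradedPerm a b * V = V) (h₂ : gradedPerm a c * V = V)
    (h₃ : gradedPerm b c * V = V) (hX : IsEvenMatrix K) (hX0 : ∀ i, K i 0 = 0) :
    siteOp a K * (siteOp b K * siteOp c K) * V = 0 := by
  have e1 : Commute (siteE a 1 1 + siteE a 2 2) (siteOp b K * siteOp c K) :=
    Commute.add_left
      ((siteE_commute_siteOp hab hX 1 1).mul_right (siteE_commute_siteOp hac hX 1 1))
      ((siteE_commute_siteOp hab hX 2 2).mul_right (siteE_commute_siteOp hac hX 2 2))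
  have e2 : Commute (siteE b 1 1 + siteE b 2 2) (siteOp c K) :=
    Commute.add_left (siteE_commute_siteOp hbc hX 1 1) (siteE_commute_siteOp hbc hX 2 2)
  have e3 : (siteE a 1 1 + siteE a 2 2) * (siteE b 1 1 + siteE b 2 2) *
      (siteE c 1 1 + siteE c 2 2) * V = 0 := by
    have h12 : (1 : Fin 3) ≠ 0 := by decide
    have h22 : (2 : Fin 3) ≠ 0 := by decide
    simp only [add_mul, mul_add, odd_odd_odd_mul_eq_zero hab hac hbc h₁ h₂ h₃ h12 h12 h12,
      odd_odd_odd_mul_eq_zero hab hac hbc h₁ h₂ h₃ h12 h12 h22,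
      odd_odd_odd_mul_eq_zero hab hac hbc h₁ h₂ h₃ h12 h22 h12,
      odd_odd_odd_mul_eq_zero hab hac hbc h₁ h₂ h₃ h12 h22 h22,
      odd_odd_odd_mul_eq_zero hab hac hbc h₁ h₂ h₃ h22 h12 h12,
      odd_odd_odd_mul_eq_zero hab hac hbc h₁ h₂ h₃ h22 h12 h22,
      odd_odd_odd_mul_eq_zero hab hac hbc h₁ h₂ h₃ h22 h22 h12,
      odd_odd_odd_mul_eq_zero hab hac hbc h₁ h₂ h₃ h22 h22 h22, add_zero]
  have e4 : siteOp a K * (siteOp b K * siteOp c K) * V =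
      siteOp a K * (siteOp b K * siteOp c K) * ((siteE a 1 1 + siteE a 2 2) *
        (siteE b 1 1 + siteE b 2 2) * (siteE c 1 1 + siteE c 2 2) * V) := by
    conv_lhs => rw [mul_mul_eq_of_commute (siteOp_mul_diag a K hX0) (siteOp_mul_diag b K hX0)
      (siteOp_mul_diag c K hX0) e1 e2]
    exact mul_assoc _ _ _
  rw [e4, e3, mul_zero]

/-- On P_01-invariant vectors, η² (1 + P_0a)(2 + P_1a) is a multiple of the sum over coset
representatives that completes symmetrization over three sites. -/
lemma pairFactor_mul_invariant (a : Fin N) {Y : Op (N + 2)} (hY : gradedPerm 0 1 * Y = Y) :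
    pairFactor η ξ (ξ a + η) a * Y = (2 * η ^ 2) •
      (Y + gradedPerm 0 a.succ.succ * Y + gradedPerm 1 a.succ.succ * Y) := by
  have e0 : rMatrix η 0 a.succ.succ (ξ a + η - ξ a) =
      η • (1 + gradedPerm 0 a.succ.succ : Op (N + 2)) := by
    rw [rMatrix, smul_add]; congr 2; ring
  have e1 : rMatrix η 1 a.succ.succ (ξ a + η + η - ξ a) =
      η • ((2 : ℂ) • (1 : Op (N + 2)) + gradedPerm 1 a.succ.succ : Op (N + 2)) := by
    rw [rMatrix, smul_add, smul_smul]; congr 2; ring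
  have e2 := gradedPerm_mul_gradedPerm' (zero_ne_one_fin (N := N)) (zero_ne_succ_succ a)
    (one_ne_succ_succ a)
  rw [pairFactor, e0, e1, smul_mul_smul_comm, smul_mul_assoc]
  simp only [add_mul, mul_add, one_mul, mul_one, e2, smul_mul_assoc, mul_smul_comm]
  rw [mul_assoc (gradedPerm 1 a.succ.succ), hY]
  module

/-- The transfer matrix annihilates the fused transfer matrix at the next shifted point. -/
lemma transfer_mul_fusedTransfer (hη : η ≠ 0) (hK : IsEvenMatrix K) (hK0 : ∀ i, K i 0 = 0)
    (a : Fin N) : transfer η K ξ (ξ a) * fusedTransfer η K ξ (ξ a + η) = 0 := by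
  obtain ⟨l₁, l₂, hl, hn₁, -, h₁, h₂, h₁₂, -⟩ := exists_sites_split a
  -- By `transfer_inhomogeneity`, T(ξ_a) acts through R-matrices and K at site a, which thus serves
  -- as a third auxiliary space. With the fused pair it forms the string ξ_a, ξ_a + η, ξ_a + 2η.
  set b : Fin (N + 2) := a.succ.succ with hb
  have h01 : (0 : Fin (N + 2)) ≠ 1 := zero_ne_one_fin
  have h0b : (0 : Fin (N + 2)) ≠ b := zero_ne_succ_succ a
  have h1b : (1 : Fin (N + 2)) ≠ b := one_ne_succ_succ a
  have hbn : ∀ n ∈ l₁, b ≠ n.succ.succ := fun n hn => succ_succ_ne fun e => h₁ (e ▸ hn)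
  set A := (l₁.map fun n : Fin N => rMatrix η b n.succ.succ (ξ a - ξ n)).prod with hA
  set Z₁ := (l₁.map (pairFactor η ξ (ξ a + η))).prod with hZ₁
  have hll : ∀ l : List (Fin N), lift (lift (l.map fun n => rMatrix η a n (ξ a - ξ n)).prod) =
      (l.map fun n : Fin N => rMatrix η b n.succ.succ (ξ a - ξ n)).prod := by
    intro l
    simp only [map_list_prod, List.map_map, Function.comp_def, lift_rMatrix, hb]
  obtain ⟨Y, hY⟩ : ∃ Y, Y = (l₂.map (pairFactor η ξ (ξ a + η))).prod * (1 + gradedPerm 0 1) :=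
    ⟨_, rfl⟩
  have hYinv : gradedPerm 0 1 * Y = Y := by
    rw [hY]
    exact invariant_list_map_prod (fun n _ Y hY => pairFactor_invariant ξ hη _ n hY)
      (gradedPerm_mul_one_add h01)
  set V₀ := pairFactor η ξ (ξ a + η) a * Y with hV₀
  have hV₀1 : gradedPerm 0 1 * V₀ = V₀ := pairFactor_invariant ξ hη _ a hYinv
  have hV₀0 : gradedPerm b 0 * V₀ = V₀ := by
    have e2 := gradedPerm_mul_gradedPerm' h01 h0b h1b
    rw [hV₀, pairFactor_mul_invariant ξ a hYinv, mul_smul_comm, gradedPerm_comm h0b.symm, mul_add,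
      mul_add, ← mul_assoc, ← mul_assoc, gradedPerm_mul_self h0b, one_mul, e2, mul_assoc _ _ Y,
      hYinv]
    congr 2
    exact add_comm _ _
  -- V₀ is symmetric in b, 0 and 1, and the remaining R-matrices preserve this symmetry for each
  -- adjacent pair of the string.
  set V := A * (Z₁ * V₀) with hV
  have hAZ : V = (l₁.map fun n : Fin N =>
      rMatrix η b n.succ.succ (ξ a - ξ n) * pairFactor η ξ (ξ a + η) n).prod * V₀ := by
    rw [hV, ← mul_assoc, hA, hZ₁, list_prod_map_mul_of_commute hn₁]
    intro n hn m hm hnm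
    exact Commute.mul_right
      (rMatrix_commute h0b.symm (hbn m hm) (zero_ne_succ_succ n).symm (succ_succ_ne hnm))
      (rMatrix_commute h1b.symm (hbn m hm) (one_ne_succ_succ n).symm (succ_succ_ne hnm))
  have hinv : ∀ n ∈ l₁, ∀ W : Op (N + 2), (gradedPerm 0 1 * W = W ∧ gradedPerm b 0 * W = W) →
      (gradedPerm 0 1 * (rMatrix η b n.succ.succ (ξ a - ξ n) * pairFactor η ξ (ξ a + η) n * W) =
        rMatrix η b n.succ.succ (ξ a - ξ n) * pairFactor η ξ (ξ a + η) n * W ∧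
      gradedPerm b 0 * (rMatrix η b n.succ.succ (ξ a - ξ n) * pairFactor η ξ (ξ a + η) n * W) =
        rMatrix η b n.succ.succ (ξ a - ξ n) * pairFactor η ξ (ξ a + η) n * W) := by
    rintro n hn W ⟨hW1, hW2⟩
    constructor
    · rw [mul_assoc, ← mul_assoc, (gradedPerm_commute_rMatrix h0b (zero_ne_succ_succ n) h1b
        (one_ne_succ_succ n)).eq, mul_assoc, pairFactor_invariant ξ hη _ n hW1]
    · have e (R₀ R₁ R₂ : Op (N + 2)) : R₀ * (R₁ * R₂) * W = R₀ * R₁ * (R₂ * W) := by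
        simp only [mul_assoc]
      rw [pairFactor, e]
      refine gradedPerm_mul_of_invariant hη _ _ (by ring) h0b.symm (hbn n hn)
        (zero_ne_succ_succ n) ?_
      rw [← mul_assoc, (gradedPerm_commute_rMatrix h1b.symm (hbn n hn) h01
        (zero_ne_succ_succ n)).eq, mul_assoc, hW2]
  have hVinv : gradedPerm 0 1 * V = V ∧ gradedPerm b 0 * V = V := by
    rw [hAZ]
    clear hAZ hV hA hZ₁ hl hn₁ h₁ h₁₂ hbn
    induction l₁ with
    | nil => simpa using ⟨hV₀1, hV₀0⟩
    | cons m l ih =>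
      rw [List.map_cons, List.prod_cons, mul_assoc]
      exact hinv m List.mem_cons_self _ (ih fun n hn => hinv n (List.mem_cons_of_mem _ hn))
  have hV1 : gradedPerm b 1 * V = V := by
    have e : gradedPerm b 1 * gradedPerm b 0 = gradedPerm b 0 * gradedPerm (0 : Fin (N + 2)) 1 :=
      (gradedPerm_mul_gradedPerm h1b.symm h01).symm
    calc gradedPerm b 1 * V = gradedPerm b 1 * (gradedPerm b 0 * V) := by rw [hVinv.2]
      _ = V := by rw [← mul_assoc, e, mul_assoc, hVinv.1, hVinv.2]
  have hKV : siteOp b K * (siteOp 0 K * siteOp 1 K) * V = 0 :=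
    siteOp_mul_siteOp_mul_siteOp_mul_eq_zero h0b.symm h1b.symm h01 hVinv.2 hV1 hVinv.1 hK hK0
  have hA01 : Commute A (siteOp 0 K * siteOp 1 K) :=
    (commute_list_map_prod fun n _ => Commute.mul_left
      (siteOp_commute_rMatrix h0b (zero_ne_succ_succ n) K)
      (siteOp_commute_rMatrix h1b (one_ne_succ_succ n) K)).symm
  -- A commutes past the twists of the two auxiliary spaces, so the three twists act consecutively
  -- on the symmetric V.
  have hfin : siteOp b K * A * (siteOp 0 K * siteOp 1 K *
      ((sites N).map (pairFactor η ξ (ξ a + η))).prod * (1 + gradedPerm 0 1)) = 0 := by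
    rw [← hKV, hV, hV₀, hY, hl, List.map_append, List.map_cons, List.prod_append, List.prod_cons]
    rw [mul_assoc (siteOp b K) A, ← mul_assoc A, ← mul_assoc A, hA01.eq]
    simp only [mul_assoc, hZ₁]
  have hlt : lift (lift (transfer η K ξ (ξ a))) = η • (
      (l₂.map fun n : Fin N => rMatrix η b n.succ.succ (ξ a - ξ n)).prod *
        (siteOp b K * A)) := by
    rw [transfer_inhomogeneity η ξ hK hl h₁ h₂ h₁₂, map_smul, map_smul, map_mul, map_mul, map_mul,
      map_mul, hll, hll, ← siteOp_succ a hK, ← siteOp_succ _ hK, mul_assoc]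
  rw [fusedTransfer, mul_smul_comm, ← strLin_lift_mul, ← strLin_lift_mul, auxMonodromy_mul_pair,
    hlt, smul_mul_assoc, mul_assoc _ (siteOp b K * A), hfin]
  simp

end Fusion

end GL12

end

/-! ### Interpolation in the spectral parameter and the closed operator relation -/

noncomputable section

namespace GL12

variable {L N : ℕ}

/-! ### Polynomial functions of the spectral parameter -/

section PolyFunctions

/-- `g` is a polynomial function of degree at most `n`, with coefficient `c` at degree `n`. -/
def IsPolyOf (n : ℕ) (c : ℂ) (g : ℂ → ℂ) : Prop :=
  ∃ p : Polynomial ℂ, (∀ u, g u = p.eval u) ∧ p.natDegree ≤ n ∧ p.coeff n = c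

lemma IsPolyOf.const (c : ℂ) : IsPolyOf 0 c fun _ => c :=
  ⟨Polynomial.C c, by simp, by simp, by simp⟩

lemma IsPolyOf.zero (n : ℕ) : IsPolyOf n 0 fun _ => 0 :=
  ⟨0, by simp, by simp, by simp⟩

lemma IsPolyOf.add {n : ℕ} {c c' : ℂ} {g g' : ℂ → ℂ} (h : IsPolyOf n c g)
    (h' : IsPolyOf n c' g') : IsPolyOf n (c + c') fun u => g u + g' u := by
  obtain ⟨p, hp, hd, hc⟩ := h
  obtain ⟨p', hp', hd', hc'⟩ := h'
  exact ⟨p + p', by simp [hp, hp'], (Polynomial.natDegree_add_le _ _).trans (max_le hd hd'),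
    by simp [hc, hc']⟩

lemma IsPolyOf.mul {n n' : ℕ} {c c' : ℂ} {g g' : ℂ → ℂ} (h : IsPolyOf n c g)
    (h' : IsPolyOf n' c' g') : IsPolyOf (n + n') (c * c') fun u => g u * g' u := by
  obtain ⟨p, hp, hd, hc⟩ := h
  obtain ⟨p', hp', hd', hc'⟩ := h'
  exact ⟨p * p', by simp [hp, hp'], Polynomial.natDegree_mul_le_of_le hd hd',
    by rw [Polynomial.coeff_mul_add_eq_of_natDegree_le hd hd', hc, hc']⟩

lemma IsPolyOf.const_mul {n : ℕ} {c : ℂ} {g : ℂ → ℂ} (a : ℂ) (h : IsPolyOf n c g) :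
    IsPolyOf n (a * c) fun u => a * g u := by
  have := (IsPolyOf.const a).mul h
  rwa [zero_add] at this

lemma IsPolyOf.sum {ι : Type*} {s : Finset ι} {n : ℕ} {c : ι → ℂ} {g : ι → ℂ → ℂ}
    (h : ∀ i ∈ s, IsPolyOf n (c i) (g i)) : IsPolyOf n (∑ i ∈ s, c i) fun u => ∑ i ∈ s, g i u := by
  classical
  induction s using Finset.induction_on with
  | empty => simpa using IsPolyOf.zero n
  | insert a s ha ih =>
    simp only [Finset.sum_insert ha]
    exact (h a (Finset.mem_insert_self _ _)).add (ih fun i hi => h i (Finset.mem_insert_of_mem hi))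

lemma IsPolyOf.prod {ι : Type*} {s : Finset ι} {c : ι → ℂ} {g : ι → ℂ → ℂ}
    (h : ∀ i ∈ s, IsPolyOf 1 (c i) (g i)) :
    IsPolyOf s.card (∏ i ∈ s, c i) fun u => ∏ i ∈ s, g i u := by
  classical
  induction s using Finset.induction_on with
  | empty => simpa using IsPolyOf.const 1
  | insert a s ha ih =>
    simp only [Finset.prod_insert ha, Finset.card_insert_of_notMem ha, add_comm s.card]
    exact (h a (Finset.mem_insert_self _ _)).mul (ih fun i hi => h i (Finset.mem_insert_of_mem hi))

lemma IsPolyOf.of_lt {n m : ℕ} {c : ℂ} {g : ℂ → ℂ} (h : IsPolyOf n c g) (hnm : n < m) :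
    IsPolyOf m 0 g := by
  obtain ⟨p, hp, hd, -⟩ := h
  exact ⟨p, hp, hd.trans hnm.le, Polynomial.coeff_eq_zero_of_natDegree_lt (hd.trans_lt hnm)⟩

lemma IsPolyOf.add_const (x : ℂ) : IsPolyOf 1 1 fun u => u + x :=
  ⟨Polynomial.X + Polynomial.C x, by simp, (Polynomial.natDegree_X_add_C x).le, by simp⟩

lemma IsPolyOf.sub_const (x : ℂ) : IsPolyOf 1 1 fun u => u - x := by
  simpa [sub_eq_add_neg] using IsPolyOf.add_const (-x)

/-- Lagrange interpolation with prescribed leading coefficient. -/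
lemma IsPolyOf.interpolation {ι : Type*} [Fintype ι] [DecidableEq ι] {c : ℂ} {g : ℂ → ℂ}
    (h : IsPolyOf (Fintype.card ι) c g) {p : ι → ℂ} (hp : Function.Injective p) (u : ℂ) :
    g u = c * ∏ a, (u - p a) +
      ∑ a, (∏ b ∈ Finset.univ.erase a, (u - p b) / (p a - p b)) * g (p a) := by
  obtain ⟨q, hq, hd, hc⟩ := h
  set D : Polynomial ℂ := ∏ a, (Polynomial.X - Polynomial.C (p a)) with hD
  have hDm : D.Monic := Polynomial.monic_prod_of_monic _ _ fun a _ => Polynomial.monic_X_sub_C _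
  have hDd : D.natDegree = Fintype.card ι := by
    rw [hD, Polynomial.natDegree_prod_of_monic _ _ fun a _ => Polynomial.monic_X_sub_C _]
    simp
  have hlt : (q - Polynomial.C c * D).degree < (Finset.univ : Finset ι).card := by
    rw [Polynomial.degree_lt_iff_coeff_zero]
    intro m hm
    rw [Finset.card_univ] at hm
    rcases hm.eq_or_lt with rfl | hm
    · have : D.coeff (Fintype.card ι) = 1 := by rw [← hDd]; exact hDm
      simp [hc, this]
    · rw [Polynomial.coeff_sub, Polynomial.coeff_C_mul,
        Polynomial.coeff_eq_zero_of_natDegree_lt (hd.trans_lt hm),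
        Polynomial.coeff_eq_zero_of_natDegree_lt (hDd.trans_lt hm)]
      simp
  have hI := Lagrange.eq_interpolate (s := Finset.univ) (v := p) hp.injOn hlt
  have hDu : ∀ x, D.eval x = ∏ a, (x - p a) := fun x => by simp [hD, Polynomial.eval_prod]
  have hD0 : ∀ a, D.eval (p a) = 0 := fun a => by
    rw [hDu]; exact Finset.prod_eq_zero (Finset.mem_univ a) (sub_self _)
  have h2 := congrArg (Polynomial.eval u) hI
  rw [Polynomial.eval_sub, Polynomial.eval_mul, Polynomial.eval_C, hDu, ← hq, sub_eq_iff_eq_add,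
    add_comm] at h2
  rw [h2, Lagrange.interpolate_apply, Polynomial.eval_finsetSum]
  congr 1
  refine Finset.sum_congr rfl fun a _ => ?_
  rw [Polynomial.eval_mul, Polynomial.eval_C, mul_comm, Lagrange.basis, Polynomial.eval_prod,
    Polynomial.eval_sub, Polynomial.eval_mul, hD0, mul_zero, sub_zero, ← hq]
  congr 1
  refine Finset.prod_congr rfl fun b _ => ?_
  simp [Lagrange.basisDivisor, div_eq_inv_mul]

/-- Because the top coefficients agree, n nodes suffice in degree n instead of n + 1. -/
lemma IsPolyOf.eq_of_eq_at {ι : Type*} [Fintype ι] {c : ℂ} {g g' : ℂ → ℂ}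
    (h : IsPolyOf (Fintype.card ι) c g) (h' : IsPolyOf (Fintype.card ι) c g') {p : ι → ℂ}
    (hp : Function.Injective p) (hg : ∀ a, g (p a) = g' (p a)) : g = g' := by
  classical
  funext u
  rw [h.interpolation hp, h'.interpolation hp]
  simp only [hg]

lemma IsPolyOf.eq_zero_of_infinite {n : ℕ} {c : ℂ} {g : ℂ → ℂ} (h : IsPolyOf n c g)
    (hi : {u | g u = 0}.Infinite) (u : ℂ) : g u = 0 := by
  obtain ⟨p, hp, -⟩ := h
  have : p = 0 := Polynomial.eq_zero_of_infinite_isRoot p (by simpa [hp] using hi)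
  simp [hp, this]

/-- A matrix of polynomial functions of degree at most `n`, with coefficient `C` at degree `n`. -/
def IsPolyMat {ι : Type*} (n : ℕ) (C : Matrix ι ι ℂ) (F : ℂ → Matrix ι ι ℂ) : Prop :=
  ∀ i j, IsPolyOf n (C i j) fun u => F u i j

variable {ι : Type*}

lemma IsPolyMat.const (C : Matrix ι ι ℂ) : IsPolyMat 0 C fun _ => C := fun i j => .const (C i j)

lemma IsPolyMat.add {n : ℕ} {C D : Matrix ι ι ℂ} {F G : ℂ → Matrix ι ι ℂ} (hF : IsPolyMat n C F)
    (hG : IsPolyMat n D G) : IsPolyMat n (C + D) fun u => F u + G u :=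
  fun i j => (hF i j).add (hG i j)

lemma IsPolyMat.smul_const {n : ℕ} {c : ℂ} {g : ℂ → ℂ} (h : IsPolyOf n c g) (C : Matrix ι ι ℂ) :
    IsPolyMat n (c • C) fun u => g u • C := fun i j => by
  simpa [mul_comm] using h.const_mul (C i j)

lemma IsPolyMat.const_smul {n : ℕ} {C : Matrix ι ι ℂ} {F : ℂ → Matrix ι ι ℂ} (a : ℂ)
    (h : IsPolyMat n C F) : IsPolyMat n (a • C) fun u => a • F u :=
  fun i j => (h i j).const_mul a

variable [Fintype ι]

lemma IsPolyMat.mul {n m : ℕ} {C D : Matrix ι ι ℂ} {F G : ℂ → Matrix ι ι ℂ}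
    (hF : IsPolyMat n C F) (hG : IsPolyMat m D G) :
    IsPolyMat (n + m) (C * D) fun u => F u * G u := fun i j => by
  simp only [Matrix.mul_apply]
  exact IsPolyOf.sum fun k _ => (hF i k).mul (hG k j)

lemma IsPolyMat.list_prod [DecidableEq ι] {κ : Type*} {l : List κ} {F : κ → ℂ → Matrix ι ι ℂ}
    (h : ∀ k ∈ l, IsPolyMat 1 1 (F k)) :
    IsPolyMat l.length 1 fun u => (l.map fun k => F k u).prod := by
  induction l with
  | nil => simpa using IsPolyMat.const 1
  | cons a l ih =>
    simp only [List.map_cons, List.prod_cons, List.length_cons, add_comm l.length]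
    have := (h a List.mem_cons_self).mul (ih fun k hk => h k (List.mem_cons_of_mem _ hk))
    rwa [mul_one] at this

lemma IsPolyMat.strLin {n : ℕ} {C : Op (N + 1)} {F : ℂ → Op (N + 1)} (h : IsPolyMat n C F) :
    IsPolyMat n (strLin C) fun u => strLin (F u) := fun σ τ => by
  simp only [strLin_apply_apply]
  exact IsPolyOf.sum fun j _ => (h _ _).const_mul _

lemma IsPolyMat.rMatrix_add (η x : ℂ) (a b : Fin L) :
    IsPolyMat 1 1 fun u => rMatrix η a b (u + x) := by
  have h := (IsPolyMat.smul_const (IsPolyOf.add_const x) (1 : Op L)).add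
    (IsPolyMat.smul_const ((IsPolyOf.const η).of_lt zero_lt_one) (gradedPerm a b))
  simpa [rMatrix] using h

end PolyFunctions

/-! ### Analytic properties of the transfer matrices -/

section Transfer

variable {η : ℂ} {K : Matrix (Fin 3) (Fin 3) ℂ} {ξ : Fin N → ℂ}

/-- The supertrace of a `3 × 3` matrix. -/
def superTr (K : Matrix (Fin 3) (Fin 3) ℂ) : ℂ := ∑ i, (-1 : ℂ) ^ parity i * K i i

lemma transfer_isPolyMat (η : ℂ) (K : Matrix (Fin 3) (Fin 3) ℂ) (ξ : Fin N → ℂ) :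
    IsPolyMat N (superTr K • 1) (transfer η K ξ) := by
  have h1 : IsPolyMat N (siteOp 0 K) (monodromy η K ξ) := by
    have := (IsPolyMat.const (siteOp (0 : Fin (N + 1)) K)).mul (IsPolyMat.list_prod
      (l := (List.finRange N).reverse) (F := fun n u => rMatrix η 0 n.succ (u - ξ n))
      fun n _ => by simpa [sub_eq_add_neg] using IsPolyMat.rMatrix_add η (-ξ n) 0 n.succ)
    simp only [List.length_reverse, List.length_finRange, zero_add, mul_one] at this
    exact this
  have := h1.strLin
  rwa [strLin_siteOp_zero] at this

lemma siteOp_mul_siteOp_same (a : Fin L) (X Y : Matrix (Fin 3) (Fin 3) ℂ) :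
    siteOp a X * siteOp a Y = siteOp a (X * Y) := by
  simp only [siteOp, Finset.sum_mul, Finset.mul_sum, smul_mul_smul_comm, siteE_mul_siteE_same,
    Matrix.mul_apply, Finset.sum_smul]
  simp only [smul_ite, smul_zero, Fin.sum_univ_three]
  simp
  abel

/-- All R-matrices contribute their leading term 1, leaving half the double supertrace of K₀ K₁ (1 +
P), which is the supertrace of K on the graded symmetric square. -/
lemma fusedTransfer_isPolyMat (hK : IsEvenMatrix K) :
    IsPolyMat (N + N) (((superTr K ^ 2 + superTr (K * K)) / 2) • 1) (fusedTransfer η K ξ) := by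
  have h1 : ∀ (c : Fin (N + 2)) (x : ℂ),
      IsPolyMat N (siteOp c K) fun u => auxMonodromy η K ξ c (u + x) := by
    intro c x
    have := (IsPolyMat.const (siteOp c K)).mul (IsPolyMat.list_prod (l := sites N)
      (F := fun n u => rMatrix η c n.succ.succ (u + x - ξ n)) fun n _ => by
        simpa [sub_eq_add_neg, add_assoc] using
          IsPolyMat.rMatrix_add η (x - ξ n) c n.succ.succ)
    simp only [List.length_reverse, List.length_finRange, zero_add, mul_one] at this
    exact this
  have h2 := (((h1 0 0).mul (h1 1 η)).mul
    (IsPolyMat.const (1 + gradedPerm 0 1))).strLin.strLin.const_smul (1 / 2 : ℂ)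
  have e1 : siteOp (1 : Fin (N + 2)) K = lift (siteOp 0 K) := by
    rw [← Fin.succ_zero_eq_one, siteOp_succ 0 hK]
  have e2 : siteOp (0 : Fin (N + 2)) K * siteOp 1 K * gradedPerm 0 1 =
      lift (siteOp 0 K) * (gradedPerm 0 1 * lift (siteOp 0 K)) := by
    rw [(siteOp_commute_siteOp zero_ne_one_fin K hK).eq, ← e1, gradedPerm_mul_siteOp_right,
      mul_assoc]
  have e3 : strLin (gradedPerm (0 : Fin (N + 2)) 1) = 1 := by
    rw [← Fin.succ_zero_eq_one, strLin_gradedPerm_zero]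
  rw [mul_add, mul_one, map_add, map_add, e2, strLin_lift_mul, strLin_mul_lift, e3, one_mul,
    e1, strLin_mul_lift, strLin_siteOp_zero, smul_mul_assoc, one_mul, map_smul,
    strLin_siteOp_zero, siteOp_mul_siteOp_same, strLin_siteOp_zero, ← superTr, ← superTr] at h2
  simp only [add_zero] at h2
  have e4 : (1 / 2 : ℂ) • (superTr K • superTr K • (1 : Op N) + superTr (K * K) • (1 : Op N)) =
      ((superTr K ^ 2 + superTr (K * K)) / 2) • 1 := by module
  rw [e4] at h2
  exact h2

/-- The transfer matrices form a commuting family. -/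
lemma transfer_commute (hK : IsEvenMatrix K) (u v : ℂ) :
    Commute (transfer η K ξ u) (transfer η K ξ v) := by
  rw [Commute, SemiconjBy, ← sub_eq_zero]
  have hT := transfer_isPolyMat η K ξ
  have hp := (hT.mul (IsPolyMat.const (transfer η K ξ v))).add
    (((IsPolyMat.const (transfer η K ξ v)).mul hT).const_smul (-1) |> fun h => by
      rw [add_comm 0 N] at h; exact h)
  -- The two points where R(u - v) is singular are reached by polynomial continuation.
  have hinf : {u : ℂ | (u - v) ^ 2 ≠ η ^ 2}.Infinite := by
    have : {u : ℂ | (u - v) ^ 2 ≠ η ^ 2} = ({v + η, v - η} : Set ℂ)ᶜ := by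
      ext u
      simp only [Set.mem_ofPred_eq, Set.mem_compl_iff, Set.mem_insert_iff, Set.mem_singleton_iff,
        ne_eq, sq_eq_sq_iff_eq_or_eq_neg, sub_eq_iff_eq_add']
      rw [sub_eq_add_neg]
    rw [this]
    exact (Set.toFinite _).infinite_compl
  ext i j
  have := (hp i j).eq_zero_of_infinite (hinf.mono fun w hw => by
    have := congrFun (congrFun (transfer_commute_of_ne η ξ hK hw) i) j
    simp [this]) u
  simpa [sub_eq_add_neg] using this

variable (η ξ) in
lemma f_one (a : Fin N) (u : ℂ) :
    f η ξ 1 a u = ∏ b ∈ Finset.univ.erase a, (u - ξ b) / (ξ a - ξ b) := by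
  simp [f]

-- The extra product in f^{(2)} depends only on the index a; it is exactly the factor needed to
-- divide T₂ by d(u + η) at the nodes.
variable (η ξ) in
lemma f_two (a : Fin N) (u : ℂ) : f η ξ 2 a u = f η ξ 1 a u / d ξ (ξ a + η) := by
  have : Finset.Ico 1 2 = {1} := rfl
  rw [f_one, f, this, d, div_eq_mul_inv, ← Finset.prod_inv_distrib]
  congr 1
  refine Finset.prod_congr rfl fun b _ => ?_
  rw [Finset.prod_singleton, one_div]
  congr 1
  push_cast
  ring

lemma InhomCond.injective (h : InhomCond η ξ) : Function.Injective ξ := by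
  intro a b hab
  by_contra hne
  exact h a b hne 0 (by simp [hab])

lemma InhomCond.sub_ne (h : InhomCond η ξ) (hη : η ≠ 0) (a b : Fin N) {m : ℤ} (hm : m ≠ 0) :
    ξ a - ξ b ≠ m * η := by
  by_cases hab : a = b
  · subst hab
    simp [hη, hm]
  · exact h a b hab m

lemma InhomCond.d_ne_zero (h : InhomCond η ξ) (hη : η ≠ 0) (a : Fin N) {m : ℤ} (hm : m ≠ 0) :
    d ξ (ξ a + m * η) ≠ 0 := by
  rw [d, Finset.prod_ne_zero_iff]
  intro b _ h0
  refine h.sub_ne hη a b (neg_ne_zero.2 hm) ?_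
  push_cast
  linear_combination h0

lemma f_one_self (h : InhomCond η ξ) (a b : Fin N) : f η ξ 1 a (ξ b) = if a = b then 1 else 0 := by
  rw [f_one]
  split_ifs with hab
  · subst hab
    refine Finset.prod_eq_one fun c hc => div_self (sub_ne_zero.2 ?_)
    exact h.injective.ne (Finset.ne_of_mem_erase hc).symm
  · refine Finset.prod_eq_zero (Finset.mem_erase.2 ⟨Ne.symm hab, Finset.mem_univ b⟩) ?_
    simp

lemma f_one_isPolyOf (η : ℂ) (ξ : Fin N → ℂ) (a : Fin N) : IsPolyOf N 0 (f η ξ 1 a) := by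
  have h : IsPolyOf (Finset.univ.erase a).card (∏ b ∈ Finset.univ.erase a, (ξ a - ξ b)⁻¹ * 1)
      (f η ξ 1 a) := by
    have := IsPolyOf.prod (s := Finset.univ.erase a) (c := fun b => (ξ a - ξ b)⁻¹ * 1)
      (g := fun b u => (ξ a - ξ b)⁻¹ * (u - ξ b)) fun b _ => (IsPolyOf.sub_const _).const_mul _
    convert this using 2 with u
    rw [f_one]
    exact Finset.prod_congr rfl fun b _ => div_eq_inv_mul _ _
  refine h.of_lt ?_
  rw [Finset.card_erase_of_mem (Finset.mem_univ a), Finset.card_univ, Fintype.card_fin]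
  have := a.pos
  omega

lemma d_isPolyOf (ξ : Fin N → ℂ) : IsPolyOf N 1 (d ξ) := by
  have := IsPolyOf.prod (s := Finset.univ) (c := fun _ => 1) (g := fun b u => u - ξ b)
    fun b _ => IsPolyOf.sub_const (ξ b)
  rw [Finset.card_univ, Fintype.card_fin, Finset.prod_const_one] at this
  exact this

lemma transfer_interpolation (h : InhomCond η ξ) (u : ℂ) :
    transfer η K ξ u = (superTr K * d ξ u) • 1 + ∑ a, f η ξ 1 a u • transfer η K ξ (ξ a) := by
  ext σ τ
  have h1 := transfer_isPolyMat η K ξ σ τ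
  have h2 : IsPolyOf (Fintype.card (Fin N)) ((superTr K • (1 : Op N)) σ τ)
      fun u => transfer η K ξ u σ τ := by rwa [Fintype.card_fin]
  rw [h2.interpolation h.injective u]
  simp only [Matrix.add_apply, Matrix.smul_apply, Matrix.sum_apply, smul_eq_mul, f_one, d]
  ring

/-- The interpolation formula for the fused transfer matrix, without its trivial zeros. -/
def fusedInterpolation (η : ℂ) (K : Matrix (Fin 3) (Fin 3) ℂ) (ξ : Fin N → ℂ) (u : ℂ) : Op N :=
  ((superTr K ^ 2 + superTr (K * K)) / 2 * d ξ u) • 1 +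
    ∑ r, f η ξ 2 r u • (transfer η K ξ (ξ r + η) * transfer η K ξ (ξ r))

/-- Both sides have degree 2N and the same top coefficient, so they are compared at the 2N points
ξ_r and ξ_r - η: the first by `fusedTransfer_inhomogeneity`, the second as common zeros. -/
lemma d_smul_fusedInterpolation (hη : η ≠ 0) (h : InhomCond η ξ) (hK : IsEvenMatrix K) (u : ℂ) :
    d ξ (u + η) • fusedInterpolation η K ξ u = fusedTransfer η K ξ u := by
  have hd : IsPolyOf N 1 fun u => d ξ (u + η) := by
    have := IsPolyOf.prod (s := Finset.univ) (c := fun _ => 1)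
      (g := fun b u => u + (η - ξ b)) fun b _ => IsPolyOf.add_const _
    simpa [d, add_sub_assoc] using this
  set κ := (superTr K ^ 2 + superTr (K * K)) / 2 with hκ
  ext σ τ
  have hF : IsPolyOf N (κ * (1 : Op N) σ τ) fun u => fusedInterpolation η K ξ u σ τ := by
    have h1 := ((d_isPolyOf ξ).const_mul (κ * (1 : Op N) σ τ)).add
      (IsPolyOf.sum (s := Finset.univ) fun r _ => (f_one_isPolyOf η ξ r).const_mul
        ((d ξ (ξ r + η))⁻¹ * (transfer η K ξ (ξ r + η) * transfer η K ξ (ξ r)) σ τ))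
    convert h1 using 1
    · simp
    · funext u
      simp only [fusedInterpolation, Matrix.add_apply, Matrix.smul_apply, Matrix.sum_apply,
        smul_eq_mul, f_two, ← hκ]
      congr 1
      · ring
      · exact Finset.sum_congr rfl fun r _ => by ring
  have h1 := hd.mul hF
  have h2 := fusedTransfer_isPolyMat (η := η) (ξ := ξ) hK σ τ
  rw [one_mul] at h1
  have hcard : N + N = Fintype.card (Fin N ⊕ Fin N) := by simp
  rw [hcard] at h1 h2
  have hinj : Function.Injective (Sum.elim ξ fun r => ξ r - η) := by
    refine h.injective.sumElim (fun a b hab => h.injective (sub_left_injective hab)) ?_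
    intro a b hab
    exact h.sub_ne hη a b (m := -1) (by decide) (by push_cast; linear_combination hab)
  have := congrFun (h1.eq_of_eq_at h2 hinj ?_) u
  · simpa using this
  rintro (r | r)
  · have hd0 : d ξ (ξ r) = 0 := Finset.prod_eq_zero (Finset.mem_univ r) (sub_self _)
    have hd1 : d ξ (ξ r + η) ≠ 0 := by simpa using h.d_ne_zero hη r (m := 1) one_ne_zero
    simp only [Sum.elim_inl, fusedInterpolation, f_two, f_one_self h, hd0,
      fusedTransfer_inhomogeneity ξ hη hK]
    simp [ite_div, ite_smul, hd1, (transfer_commute hK (ξ r + η) (ξ r)).eq]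
  · have hd0 : d ξ (ξ r - η + η) = 0 :=
      Finset.prod_eq_zero (Finset.mem_univ r) (by ring)
    simp only [Sum.elim_inr]
    rw [hd0, fusedTransfer_eq_zero ξ hη r, zero_mul, Matrix.zero_apply]

/-- The factor d(ξ_a + 2η) is nonzero and can be divided out of the vanishing product; this is the
operator form of the cubic system. -/
lemma transfer_mul_fusedInterpolation (hη : η ≠ 0) (h : InhomCond η ξ) (hK : IsEvenMatrix K)
    (hK0 : ∀ i, K i 0 = 0) (a : Fin N) :
    transfer η K ξ (ξ a) * fusedInterpolation η K ξ (ξ a + η) = 0 := by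
  have hd : d ξ (ξ a + η + η) ≠ 0 := by
    have := h.d_ne_zero hη a (m := 2) two_ne_zero
    convert this using 2
    push_cast
    ring
  have h1 := transfer_mul_fusedTransfer ξ hη hK hK0 a
  rw [← d_smul_fusedInterpolation hη h hK, mul_smul_comm] at h1
  exact (smul_eq_zero.1 h1).resolve_left hd

end Transfer

section Twist

variable {K₂ : Matrix (Fin 2) (Fin 2) ℂ} {k₂ k₃ : ℂ}

lemma trace_det_of_charpoly
    (hK : K₂.charpoly = (Polynomial.X - Polynomial.C k₂) * (Polynomial.X - Polynomial.C k₃)) :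
    K₂ 0 0 + K₂ 1 1 = k₂ + k₃ ∧ K₂ 0 0 * K₂ 1 1 - K₂ 0 1 * K₂ 1 0 = k₂ * k₃ := by
  rw [Matrix.charpoly_fin_two, Matrix.trace_fin_two, Matrix.det_fin_two] at hK
  have h0 := congrArg (Polynomial.eval 0) hK
  have h1 := congrArg (Polynomial.eval 1) hK
  simp at h0 h1
  exact ⟨by linear_combination h0 - h1, h0⟩

lemma superTr_twist
    (hK : K₂.charpoly = (Polynomial.X - Polynomial.C k₂) * (Polynomial.X - Polynomial.C k₃)) :
    superTr (twist K₂) = -(k₂ + k₃) := by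
  rw [← (trace_det_of_charpoly hK).1]
  simp [superTr, twist, parity, Fin.sum_univ_three]
  ring

/-- On the odd plane supertraces are negative traces, so this is (tr² - tr of the square)/2, the
determinant of K₂. -/
lemma superTr_twist_sq
    (hK : K₂.charpoly = (Polynomial.X - Polynomial.C k₂) * (Polynomial.X - Polynomial.C k₃)) :
    (superTr (twist K₂) ^ 2 + superTr (twist K₂ * twist K₂)) / 2 = k₂ * k₃ := by
  rw [← (trace_det_of_charpoly hK).2]
  simp [superTr, twist, parity, Fin.sum_univ_three, Matrix.mul_apply]
  ring

lemma twist_apply_zero (K₂ : Matrix (Fin 2) (Fin 2) ℂ) (i : Fin 3) : twist K₂ i 0 = 0 := by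
  fin_cases i <;> rfl

end Twist

end GL12

end

/-! ### The bound 3^N on the dimension of a fusion algebra -/

noncomputable section

namespace GL12

variable {N : ℕ}

/-! ### The algebra of the closed system of fusion relations -/

section FusionAlgebra

section Interp

variable {A : Type*} [Ring A] [Algebra ℂ A] (η c₁ c₂ : ℂ) (ξ : Fin N → ℂ) (x : Fin N → A)

/-- The interpolation of degree `N` with leading coefficient `c` through the values `m a` at
the inhomogeneities. -/
def interp (c : ℂ) (m : Fin N → A) (u : ℂ) : A :=
  (c * d ξ u) • (1 : A) + ∑ a, f η ξ 1 a u • m a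

/-- The fused interpolation, in terms of the values of the fundamental one. -/
def interp₂ (u : ℂ) : A :=
  (c₂ * d ξ u) • (1 : A) + ∑ r, f η ξ 2 r u • (interp η ξ c₁ x (ξ r + η) * x r)

lemma map_interp {B : Type*} [Ring B] [Algebra ℂ B] (φ : A →ₐ[ℂ] B) (c u : ℂ) :
    φ (interp η ξ c x u) = interp η ξ c (fun a => φ (x a)) u := by
  simp [interp]

/-- The relations are formulated over an arbitrary algebra so that they pass between operators,
scalars, pairs of both, and subalgebras. -/
lemma map_interp₂ {B : Type*} [Ring B] [Algebra ℂ B] (φ : A →ₐ[ℂ] B) (u : ℂ) :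
    φ (interp₂ η c₁ c₂ ξ x u) = interp₂ η c₁ c₂ ξ (fun a => φ (x a)) u := by
  simp [interp₂, map_interp]

end Interp

variable {A : Type*} [CommRing A] [Algebra ℂ A] {η : ℂ} (c₁ c₂ : ℂ) {ξ : Fin N → ℂ} (x : Fin N → A)

lemma interp₂_eq_interp (u : ℂ) : interp₂ η c₁ c₂ ξ x u =
    interp η ξ c₂ (fun r => (d ξ (ξ r + η))⁻¹ • (interp η ξ c₁ x (ξ r + η) * x r)) u := by
  simp only [interp₂, interp, f_two, smul_smul, div_eq_mul_inv]

lemma interp_inhomogeneity (h : InhomCond η ξ) (c : ℂ) (m : Fin N → A) (a : Fin N) :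
    interp η ξ c m (ξ a) = m a := by
  have hd0 : d ξ (ξ a) = 0 := Finset.prod_eq_zero (Finset.mem_univ a) (sub_self _)
  simp [interp, hd0, f_one_self h, ite_smul]

lemma d_smul_interp₂ (hη : η ≠ 0) (h : InhomCond η ξ) (a : Fin N) :
    d ξ (ξ a + η) • interp₂ η c₁ c₂ ξ x (ξ a) = interp η ξ c₁ x (ξ a + η) * x a := by
  have hd1 : d ξ (ξ a + η) ≠ 0 := by simpa using h.d_ne_zero hη a (m := 1) one_ne_zero
  rw [interp₂_eq_interp, interp_inhomogeneity h, smul_smul, mul_inv_cancel₀ hd1, one_smul]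

/-- The degree and the top coefficient are fixed, so any N distinct nodes may replace the
inhomogeneities. The freedom to adapt the nodes to a given monomial drives the spanning argument. -/
lemma interp_eq_interpolation (c : ℂ) (m : Fin N → A) {p : Fin N → ℂ} (hp : Function.Injective p)
    (u : ℂ) : interp η ξ c m u = (c * ∏ a, (u - p a)) • (1 : A) +
      ∑ a, (∏ b ∈ Finset.univ.erase a, (u - p b) / (p a - p b)) • interp η ξ c m (p a) := by
  have hd : IsPolyOf (Fintype.card (Fin N)) 1 (d ξ) := by
    rw [Fintype.card_fin]; exact d_isPolyOf ξ
  have hf : ∀ r, IsPolyOf (Fintype.card (Fin N)) 0 (f η ξ 1 r) := by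
    intro r; rw [Fintype.card_fin]; exact f_one_isPolyOf η ξ r
  set ℓ : Fin N → ℂ := fun a => ∏ b ∈ Finset.univ.erase a, (u - p b) / (p a - p b) with hℓ
  have e1 := hd.interpolation hp u
  have e2 := fun r => (hf r).interpolation hp u
  simp only [interp, smul_add, Finset.smul_sum, smul_smul, Finset.sum_add_distrib]
  rw [e1, Finset.sum_comm, ← add_assoc]
  congr 1
  · rw [← Finset.sum_smul, ← add_smul, mul_add, one_mul, Finset.mul_sum]
    congr 2
    exact Finset.sum_congr rfl fun a _ => by ring
  · refine Finset.sum_congr rfl fun r _ => ?_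
    rw [← Finset.sum_smul, e2]
    simp

lemma mul_interp_mem {W : Submodule ℂ A} {y : A} (hy : y ∈ W) (c : ℂ) (m : Fin N → A)
    {p : Fin N → ℂ} (hp : Function.Injective p) (hW : ∀ a, y * interp η ξ c m (p a) ∈ W) (u : ℂ) :
    y * interp η ξ c m u ∈ W := by
  rw [interp_eq_interpolation c m hp, mul_add, Finset.mul_sum, mul_smul_comm, mul_one]
  refine W.add_mem (W.smul_mem _ hy) (W.sum_mem fun a _ => ?_)
  rw [mul_smul_comm]
  exact W.smul_mem _ (hW a)

variable (η ξ) in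
/-- The factors of the spanning family. -/
def spanFactor (k : Fin 3) (a : Fin N) : A := ![interp₂ η c₁ c₂ ξ x (ξ a + η), 1, x a] k

variable (η ξ) in
/-- The spanning family of the fusion algebra. -/
def spanFamily (h : Fin N → Fin 3) : A := ∏ a, spanFactor η c₁ c₂ ξ x (h a) a

lemma spanFamily_update (h : Fin N → Fin 3) (a : Fin N) (k : Fin 3) :
    spanFamily η c₁ c₂ ξ x (Function.update h a k) =
      spanFactor η c₁ c₂ ξ x k a * ∏ b ∈ Finset.univ.erase a, spanFactor η c₁ c₂ ξ x (h b) b := by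
  rw [spanFamily, ← Finset.mul_prod_erase _ _ (Finset.mem_univ a), Function.update_self]
  congr 1
  refine Finset.prod_congr rfl fun b hb => ?_
  rw [Function.update_of_ne (Finset.ne_of_mem_erase hb)]

lemma spanFamily_eq (h : Fin N → Fin 3) (a : Fin N) :
    spanFamily η c₁ c₂ ξ x h = spanFactor η c₁ c₂ ξ x (h a) a *
      ∏ b ∈ Finset.univ.erase a, spanFactor η c₁ c₂ ξ x (h b) b := by
  rw [← spanFamily_update, Function.update_eq_self]

lemma InhomCond.injective_node (h : InhomCond η ξ) (hη : η ≠ 0) (P : Fin N → Prop)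
    [DecidablePred P] : Function.Injective fun a => if P a then ξ a else ξ a + η := by
  intro a b hab
  simp only at hab
  split_ifs at hab with h1 h2 h2
  · exact h.injective hab
  · exact absurd (by push_cast; linear_combination hab) (h.sub_ne hη a b (m := 1) one_ne_zero)
  · exact absurd (by push_cast; linear_combination hab) (h.sub_ne hη a b (m := -1) (by decide))
  · exact h.injective (add_right_cancel hab)

/-- Interpolate F at ξ_a when the a-th factor is F(ξ_a + η), and at ξ_a + η otherwise. Then F(ξ_a +
η) F(ξ_a) = 0 and x_a F(ξ_a + η) = 0, while a factor 1 simply becomes F(ξ_a + η): each node gives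
zero or another member of the family. -/
lemma spanFamily_mul_interp₂_mem (hη : η ≠ 0) (hξ : InhomCond η ξ)
    (hx : ∀ a, x a * interp₂ η c₁ c₂ ξ x (ξ a + η) = 0) (h : Fin N → Fin 3) (u : ℂ) :
    spanFamily η c₁ c₂ ξ x h * interp₂ η c₁ c₂ ξ x u ∈
      Submodule.span ℂ (Set.range (spanFamily η c₁ c₂ ξ x)) := by
  have hd1 : ∀ a, d ξ (ξ a + η) ≠ 0 := fun a => by
    simpa using hξ.d_ne_zero hη a (m := 1) one_ne_zero
  rw [interp₂_eq_interp]
  refine mul_interp_mem (Submodule.subset_span (Set.mem_range_self h)) _ _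
    (hξ.injective_node hη fun a => h a = 0) (fun a => ?_) u
  rw [← interp₂_eq_interp, spanFamily_eq c₁ c₂ x h a]
  set Q := ∏ b ∈ Finset.univ.erase a, spanFactor η c₁ c₂ ξ x (h b) b with hQ
  have h3 : h a = 0 ∨ h a = 1 ∨ h a = 2 := by
    generalize h a = k; fin_cases k <;> simp
  rcases h3 with h3 | h3 | h3
  · have e1 : interp₂ η c₁ c₂ ξ x (ξ a + η) * interp₂ η c₁ c₂ ξ x (ξ a) = 0 := by
      have e2 :
          d ξ (ξ a + η) • (interp₂ η c₁ c₂ ξ x (ξ a + η) * interp₂ η c₁ c₂ ξ x (ξ a)) = 0 := by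
        rw [← mul_smul_comm, d_smul_interp₂ c₁ c₂ x hη hξ]
        linear_combination (interp η ξ c₁ x (ξ a + η)) * hx a
      exact (smul_eq_zero.1 e2).resolve_left (hd1 a)
    simp only [h3, if_true, spanFactor, Matrix.cons_val_zero]
    rw [mul_right_comm, e1, zero_mul]
    exact Submodule.zero_mem _
  · have e1 : spanFactor η c₁ c₂ ξ x 1 a * Q * interp₂ η c₁ c₂ ξ x (ξ a + η) =
        spanFamily η c₁ c₂ ξ x (Function.update h a 0) := by
      rw [spanFamily_update]
      have e2 : spanFactor η c₁ c₂ ξ x 1 a = 1 := rfl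
      have e3 : spanFactor η c₁ c₂ ξ x 0 a = interp₂ η c₁ c₂ ξ x (ξ a + η) := rfl
      rw [e2, e3, hQ]
      ring
    simp only [h3, one_ne_zero, if_false]
    rw [e1]
    exact Submodule.subset_span ⟨_, rfl⟩
  · have e1 : spanFactor η c₁ c₂ ξ x 2 a * Q * interp₂ η c₁ c₂ ξ x (ξ a + η) = 0 := by
      have : spanFactor η c₁ c₂ ξ x 2 a = x a := rfl
      rw [this]
      linear_combination Q * hx a
    have h20 : (2 : Fin 3) ≠ 0 := by decide
    simp only [h3, h20, if_false]
    rw [e1]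
    exact Submodule.zero_mem _

/-- Interpolate T at ξ_a + η exactly when the a-th factor is x_a. There x_a T(ξ_a + η) is a multiple
of F(ξ_a), which reduces to the preceding lemma; at the nodes ξ_a the factor 1 becomes x_a and the
factor F(ξ_a + η) is annihilated. -/
lemma spanFamily_mul_interp_mem (hη : η ≠ 0) (hξ : InhomCond η ξ)
    (hx : ∀ a, x a * interp₂ η c₁ c₂ ξ x (ξ a + η) = 0) (h : Fin N → Fin 3) (u : ℂ) :
    spanFamily η c₁ c₂ ξ x h * interp η ξ c₁ x u ∈
      Submodule.span ℂ (Set.range (spanFamily η c₁ c₂ ξ x)) := by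
  refine mul_interp_mem (Submodule.subset_span (Set.mem_range_self h)) _ _
    (hξ.injective_node hη fun a => h a ≠ 2) (fun a => ?_) u
  rw [spanFamily_eq c₁ c₂ x h a]
  have h3 : h a = 0 ∨ h a = 1 ∨ h a = 2 := by
    generalize h a = k; fin_cases k <;> simp
  rcases h3 with h3 | h3 | h3
  · have h20 : (0 : Fin 3) ≠ 2 := by decide
    simp only [h3, ne_eq, h20, not_false_eq_true, if_true, spanFactor, Matrix.cons_val_zero]
    rw [interp_inhomogeneity hξ, mul_right_comm, mul_comm _ (x a), hx, zero_mul]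
    exact Submodule.zero_mem _
  · have h20 : (1 : Fin 3) ≠ 2 := by decide
    simp only [h3, ne_eq, h20, not_false_eq_true, if_true]
    rw [interp_inhomogeneity hξ]
    refine Submodule.subset_span ⟨Function.update h a 2, ?_⟩
    rw [spanFamily_update]
    have e1 : spanFactor η c₁ c₂ ξ x 2 a = x a := rfl
    have e2 : spanFactor η c₁ c₂ ξ x 1 a = 1 := rfl
    rw [e1, e2]
    ring
  · simp only [h3, ne_eq, not_true_eq_false, if_false]
    have e1 : spanFactor η c₁ c₂ ξ x 2 a *
        (∏ b ∈ Finset.univ.erase a, spanFactor η c₁ c₂ ξ x (h b) b) * interp η ξ c₁ x (ξ a + η) =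
        d ξ (ξ a + η) •
          (spanFamily η c₁ c₂ ξ x (Function.update h a 1) * interp₂ η c₁ c₂ ξ x (ξ a)) := by
      rw [← mul_smul_comm, d_smul_interp₂ c₁ c₂ x hη hξ, spanFamily_update]
      have e1 : spanFactor η c₁ c₂ ξ x 2 a = x a := rfl
      have e2 : spanFactor η c₁ c₂ ξ x 1 a = 1 := rfl
      rw [e1, e2]
      ring
    rw [e1]
    exact Submodule.smul_mem _ _ (spanFamily_mul_interp₂_mem c₁ c₂ x hη hξ hx _ _)

/-- The fusion relations bound the dimension of the algebra generated by their solutions. -/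
lemma span_spanFamily_eq_top (hη : η ≠ 0) (hξ : InhomCond η ξ)
    (hx : ∀ a, x a * interp₂ η c₁ c₂ ξ x (ξ a + η) = 0)
    (hgen : Algebra.adjoin ℂ (Set.range x) = ⊤) :
    Submodule.span ℂ (Set.range (spanFamily η c₁ c₂ ξ x)) = ⊤ := by
  set W := Submodule.span ℂ (Set.range (spanFamily η c₁ c₂ ξ x)) with hW
  have hxW : ∀ a, ∀ w ∈ W, x a * w ∈ W := by
    intro a w hw
    induction hw using Submodule.span_induction with
    | mem w hw =>
      obtain ⟨h, rfl⟩ := hw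
      have := spanFamily_mul_interp_mem c₁ c₂ x hη hξ hx h (ξ a)
      rwa [interp_inhomogeneity hξ, mul_comm] at this
    | zero => simp
    | add y z _ _ hy hz => rw [mul_add]; exact W.add_mem hy hz
    | smul c y _ hy => rw [mul_smul_comm]; exact W.smul_mem c hy
  have h1 : (1 : A) ∈ W := Submodule.subset_span ⟨fun _ => 1, by simp [spanFamily, spanFactor]⟩
  have hall : ∀ y : A, ∀ w ∈ W, y * w ∈ W := by
    intro y
    have hy : y ∈ Algebra.adjoin ℂ (Set.range x) := hgen ▸ Algebra.mem_top
    induction hy using Algebra.adjoin_induction with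
    | mem y hy => obtain ⟨a, rfl⟩ := hy; exact hxW a
    | algebraMap r =>
      intro w hw
      rw [← Algebra.smul_def]
      exact W.smul_mem r hw
    | add y z _ _ hy hz => intro w hw; rw [add_mul]; exact W.add_mem (hy w hw) (hz w hw)
    | mul y z _ _ hy hz => intro w hw; rw [mul_assoc]; exact hy _ (hz w hw)
  rw [eq_top_iff]
  intro y _
  simpa using hall y 1 h1

lemma finrank_le_of_fusion (hη : η ≠ 0) (hξ : InhomCond η ξ)
    (hx : ∀ a, x a * interp₂ η c₁ c₂ ξ x (ξ a + η) = 0)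
    (hgen : Algebra.adjoin ℂ (Set.range x) = ⊤) :
    Module.Finite ℂ A ∧ Module.finrank ℂ A ≤ Fintype.card (Conf N) := by
  have h := span_spanFamily_eq_top c₁ c₂ x hη hξ hx hgen
  refine ⟨⟨⟨(Set.finite_range (spanFamily η c₁ c₂ ξ x)).toFinset, by simpa using h⟩⟩, ?_⟩
  rw [← finrank_top, ← h]
  exact finrank_range_le_card _

end FusionAlgebra

end GL12

end

/-! ### Completeness: eigenvectors from solutions of the cubic system -/

noncomputable section

namespace GL12

variable {N : ℕ} {η : ℂ} {ξ : Fin N → ℂ}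

/-! ### Eigenvectors and the SoV basis -/

lemma transfer_eq_interp {K : Matrix (Fin 3) (Fin 3) ℂ} (h : InhomCond η ξ) (u : ℂ) :
    transfer η K ξ u = interp η ξ (superTr K) (fun a => transfer η K ξ (ξ a)) u :=
  transfer_interpolation h u

lemma t₁_eq_interp (k₂ k₃ : ℂ) (x : Fin N → ℂ) (u : ℂ) :
    t₁ η k₂ k₃ ξ x u = interp η ξ (-(k₂ + k₃)) x u := by
  simp [t₁, interp, d]

lemma mem_solutionSet_iff (k₂ k₃ : ℂ) (x : Fin N → ℂ) : x ∈ solutionSet η k₂ k₃ ξ ↔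
    ∀ a, x a * interp₂ η (-(k₂ + k₃)) (k₂ * k₃) ξ x (ξ a + η) = 0 := by
  simp [solutionSet, interp₂, t₁_eq_interp, mul_assoc]

lemma fusedInterpolation_eq_interp₂ {K : Matrix (Fin 3) (Fin 3) ℂ} (h : InhomCond η ξ) (u : ℂ) :
    fusedInterpolation η K ξ u = interp₂ η (superTr K) ((superTr K ^ 2 + superTr (K * K)) / 2) ξ
      (fun a => transfer η K ξ (ξ a)) u := by
  simp only [interp₂, ← transfer_eq_interp h, fusedInterpolation]

lemma list_prod_mulVec {ι κ : Type*} [Fintype ι] [DecidableEq ι] {M : κ → Matrix ι ι ℂ} {c : κ → ℂ}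
    {v : ι → ℂ} (h : ∀ n, M n *ᵥ v = c n • v) (l : List κ) :
    (l.map M).prod *ᵥ v = (l.map c).prod • v := by
  induction l with
  | nil => simp
  | cons a l ih =>
    rw [List.map_cons, List.prod_cons, ← Matrix.mulVec_mulVec, ih, Matrix.mulVec_smul, h,
      List.map_cons, List.prod_cons, smul_smul, mul_comm]

lemma pow_mulVec {ι : Type*} [Fintype ι] [DecidableEq ι] {M : Matrix ι ι ℂ} {c : ℂ} {v : ι → ℂ}
    (h : M *ᵥ v = c • v) (n : ℕ) : M ^ n *ᵥ v = c ^ n • v := by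
  have := list_prod_mulVec (M := fun _ : ℕ => M) (c := fun _ => c) (fun _ => h) (List.replicate n 0)
  simpa using this

section

variable {K : Matrix (Fin 3) (Fin 3) ℂ}

/-- The SoV coordinates of an eigenvector separate, and the eigenvalue fixes them up to the single
number S · w. -/
lemma sovCovector_dotProduct {t : ℂ → ℂ} {w : Conf N → ℂ} (hw : IsEigen η K ξ t w)
    (S : Conf N → ℂ) (h : Fin N → Fin 3) :
    sovCovector η K ξ S h ⬝ᵥ w = (∏ n, t (ξ n) ^ (h n : ℕ)) * (S ⬝ᵥ w) := by
  rw [sovCovector, ← Matrix.dotProduct_mulVec, list_prod_mulVec (c := fun n => t (ξ n) ^ (h n : ℕ))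
    fun n => pow_mulVec (hw (ξ n)) _, dotProduct_smul, smul_eq_mul, List.prod_ofFn.symm,
    List.ofFn_eq_map]

lemma eq_of_sovCovector_dotProduct {S : Conf N → ℂ} (hS : IsSoVBasis η K ξ S) {v w : Conf N → ℂ}
    (h : ∀ g, sovCovector η K ξ S g ⬝ᵥ v = sovCovector η K ξ S g ⬝ᵥ w) : v = w := by
  have hall : ∀ c : Conf N → ℂ, c ⬝ᵥ v = c ⬝ᵥ w := by
    intro c
    have hc : c ∈ Submodule.span ℂ (Set.range (sovCovector η K ξ S)) := hS.2 ▸ Submodule.mem_top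
    induction hc using Submodule.span_induction with
    | mem c hc => obtain ⟨g, rfl⟩ := hc; exact h g
    | zero => simp
    | add c c' _ _ hc hc' => rw [add_dotProduct, add_dotProduct, hc, hc']
    | smul a c _ hc => rw [smul_dotProduct, smul_dotProduct, hc]
  funext σ
  simpa using hall (Pi.single σ 1)

/-- Joint eigenspaces are at most one-dimensional. -/
lemma eq_smul_of_isEigen {S : Conf N → ℂ} (hS : IsSoVBasis η K ξ S) {t : ℂ → ℂ}
    {v w : Conf N → ℂ} (hv : IsEigen η K ξ t v) (hw : IsEigen η K ξ t w) :
    (S ⬝ᵥ v) • w = (S ⬝ᵥ w) • v := by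
  refine eq_of_sovCovector_dotProduct hS fun g => ?_
  rw [dotProduct_smul, dotProduct_smul, sovCovector_dotProduct hv, sovCovector_dotProduct hw,
    smul_eq_mul, smul_eq_mul]
  ring

lemma dotProduct_ne_zero_of_isEigen {S : Conf N → ℂ} (hS : IsSoVBasis η K ξ S) {t : ℂ → ℂ}
    {v : Conf N → ℂ} (hv : IsEigen η K ξ t v) (hv0 : v ≠ 0) : S ⬝ᵥ v ≠ 0 := by
  intro h0
  refine hv0 (eq_of_sovCovector_dotProduct hS fun g => ?_)
  rw [sovCovector_dotProduct hv, h0]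
  simp

end

-- Passes the commutative bound to commuting elements of a noncommutative ring such as `Op N × ℂ`.
open scoped IsMulCommutative in
lemma finrank_adjoin_le_of_fusion {R : Type*} [Ring R] [Algebra ℂ R] {c₁ c₂ : ℂ} {z : Fin N → R}
    (hη : η ≠ 0) (hξ : InhomCond η ξ) (hcomm : ∀ a b, z a * z b = z b * z a)
    (hz : ∀ a, z a * interp₂ η c₁ c₂ ξ z (ξ a + η) = 0) :
    Module.Finite ℂ (Algebra.adjoin ℂ (Set.range z)) ∧
      Module.finrank ℂ (Algebra.adjoin ℂ (Set.range z)) ≤ Fintype.card (Conf N) := by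
  set B := Algebra.adjoin ℂ (Set.range z) with hB
  have : IsMulCommutative B := Algebra.isMulCommutative_adjoin ℂ (by
    rintro _ ⟨a, rfl⟩ _ ⟨b, rfl⟩
    exact hcomm a b)
  let zB : Fin N → B := fun a => ⟨z a, Algebra.subset_adjoin (Set.mem_range_self a)⟩
  have hgen : Algebra.adjoin ℂ (Set.range zB) = ⊤ := by
    rw [← Algebra.adjoin_adjoin_coe_preimage (s := Set.range z)]
    congr 1
    ext ⟨y, hy⟩
    simp [zB, Subtype.ext_iff]
  refine finrank_le_of_fusion c₁ c₂ zB hη hξ (fun a => Subtype.ext ?_) hgen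
  have e1 : ((zB a * interp₂ η c₁ c₂ ξ zB (ξ a + η) : B) : R) =
      z a * B.val (interp₂ η c₁ c₂ ξ zB (ξ a + η)) := rfl
  rw [e1, map_interp₂]
  exact hz a

section Completeness

variable {K₂ : Matrix (Fin 2) (Fin 2) ℂ} {k₂ k₃ : ℂ}

lemma transfer_mul_interp₂ (hη : η ≠ 0) (hξ : InhomCond η ξ)
    (hK : K₂.charpoly = (Polynomial.X - Polynomial.C k₂) * (Polynomial.X - Polynomial.C k₃))
    (a : Fin N) : transfer η (twist K₂) ξ (ξ a) * interp₂ η (-(k₂ + k₃)) (k₂ * k₃) ξ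
      (fun a => transfer η (twist K₂) ξ (ξ a)) (ξ a + η) = 0 := by
  have := transfer_mul_fusedInterpolation hη hξ (twist_isEven K₂) (twist_apply_zero K₂) a
  rwa [fusedInterpolation_eq_interp₂ hξ, superTr_twist hK, ← superTr_twist hK,
    superTr_twist_sq hK, superTr_twist hK] at this

lemma eigenvalueSpectrum_subset (hη : η ≠ 0) (hξ : InhomCond η ξ)
    (hK : K₂.charpoly = (Polynomial.X - Polynomial.C k₂) * (Polynomial.X - Polynomial.C k₃)) :
    eigenvalueSpectrum η (twist K₂) ξ ⊆ sigmaSet η k₂ k₃ ξ := by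
  rintro t ⟨v, hv0, hv⟩
  have hinj := smul_left_injective ℂ hv0
  have ht : ∀ u, t u = interp η ξ (-(k₂ + k₃)) (fun a => t (ξ a)) u := by
    intro u
    refine hinj ?_
    simp only
    rw [← hv u, transfer_interpolation hξ, superTr_twist hK, Matrix.add_mulVec, Matrix.sum_mulVec,
      interp, add_smul, Finset.sum_smul]
    simp only [Matrix.smul_mulVec, Matrix.one_mulVec, hv (ξ _), smul_eq_mul, mul_one, smul_smul]
  refine ⟨fun a => t (ξ a), (mem_solutionSet_iff _ _ _).2 fun a => hinj ?_, ?_⟩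
  · have h1 := congrArg (· *ᵥ v) (transfer_mul_interp₂ hη hξ hK a)
    have h2 : interp₂ η (-(k₂ + k₃)) (k₂ * k₃) ξ (fun a => transfer η (twist K₂) ξ (ξ a))
        (ξ a + η) *ᵥ v =
        interp₂ η (-(k₂ + k₃)) (k₂ * k₃) ξ (fun a => t (ξ a)) (ξ a + η) • v := by
      have hT : ∀ u, interp η ξ (-(k₂ + k₃)) (fun a => transfer η (twist K₂) ξ (ξ a)) u =
          transfer η (twist K₂) ξ u := fun u => by
        rw [← superTr_twist hK, ← transfer_eq_interp hξ]
      simp only [interp₂, hT, ← ht]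
      rw [Matrix.add_mulVec, Matrix.sum_mulVec, add_smul, Finset.sum_smul]
      simp only [Matrix.smul_mulVec, Matrix.one_mulVec, ← Matrix.mulVec_mulVec, Matrix.mulVec_smul,
        hv _, smul_eq_mul, mul_one, smul_smul]
      congr 1
      exact Finset.sum_congr rfl fun r _ => by ring_nf
    simp only [← Matrix.mulVec_mulVec, h2, Matrix.mulVec_smul, hv _, smul_smul,
      Matrix.zero_mulVec] at h1
    simp only [zero_smul]
    rw [mul_comm]
    exact h1
  · funext u
    rw [t₁_eq_interp, ht]

/-- Every solution of the cubic system is the character of a joint eigenvector. -/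
lemma exists_vector_of_mem_solutionSet (hη : η ≠ 0) (hξ : InhomCond η ξ)
    (hK : K₂.charpoly = (Polynomial.X - Polynomial.C k₂) * (Polynomial.X - Polynomial.C k₃))
    {S : Conf N → ℂ} (hS : IsSoVBasis η (twist K₂) ξ S) {x : Fin N → ℂ}
    (hx : x ∈ solutionSet η k₂ k₃ ξ) :
    ∃ v : Conf N → ℂ, ∀ b ∈ Algebra.adjoin ℂ
      (Set.range fun a => ((transfer η (twist K₂) ξ (ξ a), x a) : Op N × ℂ)),
        (S ᵥ* b.1) ⬝ᵥ v = b.2 := by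
  -- Pairing operators with the scalar solution puts both in one algebra satisfying the same
  -- relations, to which the bound 3^N applies.
  set z : Fin N → Op N × ℂ := fun a => (transfer η (twist K₂) ξ (ξ a), x a) with hz
  set B := Algebra.adjoin ℂ (Set.range z) with hB
  let zB : Fin N → B := fun a => ⟨z a, Algebra.subset_adjoin (Set.mem_range_self a)⟩
  have hrel : ∀ a, z a * interp₂ η (-(k₂ + k₃)) (k₂ * k₃) ξ z (ξ a + η) = 0 := by
    intro a
    refine Prod.ext ?_ ?_
    · have := map_interp₂ η (-(k₂ + k₃)) (k₂ * k₃) ξ z (AlgHom.fst ℂ (Op N) ℂ) (ξ a + η)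
      change transfer η (twist K₂) ξ (ξ a) * (AlgHom.fst ℂ (Op N) ℂ)
        (interp₂ η (-(k₂ + k₃)) (k₂ * k₃) ξ z (ξ a + η)) = 0
      rw [this]
      exact transfer_mul_interp₂ hη hξ hK a
    · have := map_interp₂ η (-(k₂ + k₃)) (k₂ * k₃) ξ z (AlgHom.snd ℂ (Op N) ℂ) (ξ a + η)
      change x a * (AlgHom.snd ℂ (Op N) ℂ)
        (interp₂ η (-(k₂ + k₃)) (k₂ * k₃) ξ z (ξ a + η)) = 0
      rw [this]
      exact (mem_solutionSet_iff _ _ _).1 hx a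
  obtain ⟨hfin, hle⟩ := finrank_adjoin_le_of_fusion hη hξ
    (fun a b => Prod.ext (transfer_commute (twist_isEven K₂) _ _).eq (mul_comm _ _)) hrel
  let θ : B →ₗ[ℂ] (Conf N → ℂ) :=
    { toFun := fun b => S ᵥ* b.1.1
      map_add' := fun b c => Matrix.vecMul_add _ _ _
      map_smul' := fun r b => Matrix.vecMul_smul _ _ _ }
  have hsurj : Function.Surjective θ := by
    rw [← LinearMap.range_eq_top, eq_top_iff, ← hS.2, Submodule.span_le]
    rintro _ ⟨h, rfl⟩
    refine ⟨((List.finRange N).map fun n => zB n ^ (h n : ℕ)).prod, ?_⟩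
    have e : (AlgHom.fst ℂ (Op N) ℂ)
        (B.val ((List.finRange N).map fun n => zB n ^ (h n : ℕ)).prod) =
        ((List.finRange N).map fun n => transfer η (twist K₂) ξ (ξ n) ^ (h n : ℕ)).prod := by
      rw [map_list_prod, map_list_prod, List.map_map, List.map_map]
      rfl
    change S ᵥ* _ = _
    rw [sovCovector, ← e]
    rfl
  -- The upper bound from fusion meets the lower bound from the SoV basis, so θ is bijective and b ↦
  -- b.2 becomes a functional on covectors, represented by a vector.
  have hrank : Module.finrank ℂ B = Module.finrank ℂ (Conf N → ℂ) := by
    refine le_antisymm ?_ (LinearMap.finrank_le_finrank_of_surjective hsurj)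
    rw [Module.finrank_pi]
    exact hle
  have hinj : Function.Injective θ :=
    (LinearMap.injective_iff_surjective_of_finrank_eq_finrank hrank).2 hsurj
  let e := LinearEquiv.ofBijective θ ⟨hinj, hsurj⟩
  let ψ : B →ₗ[ℂ] ℂ := (LinearMap.snd ℂ (Op N) ℂ).comp B.val.toLinearMap
  let φ : (Conf N → ℂ) →ₗ[ℂ] ℂ := ψ.comp e.symm.toLinearMap
  refine ⟨fun σ => φ (Pi.single σ 1), fun b hb => ?_⟩
  have h1 : φ (θ ⟨b, hb⟩) = b.2 := by
    have : e.symm (θ ⟨b, hb⟩) = ⟨b, hb⟩ := e.symm_apply_apply ⟨b, hb⟩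
    change ψ (e.symm (θ ⟨b, hb⟩)) = b.2
    rw [this]
    rfl
  rw [← h1, LinearMap.pi_apply_eq_sum_univ φ]
  simp only [dotProduct, smul_eq_mul]
  refine Finset.sum_congr rfl fun σ _ => ?_
  congr 2
  ext τ
  simp [Pi.single_apply, eq_comm]

lemma exists_eigenvector (hη : η ≠ 0) (hξ : InhomCond η ξ)
    (hK : K₂.charpoly = (Polynomial.X - Polynomial.C k₂) * (Polynomial.X - Polynomial.C k₃))
    {S : Conf N → ℂ} (hS : IsSoVBasis η (twist K₂) ξ S) {t : ℂ → ℂ}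
    (ht : t ∈ sigmaSet η k₂ k₃ ξ) : ∃ v : Conf N → ℂ, v ≠ 0 ∧ IsEigen η (twist K₂) ξ t v ∧
      (∀ w, IsEigen η (twist K₂) ξ t w → ∃ c : ℂ, w = c • v) ∧
      ∀ h : Fin N → Fin 3, sovCovector η (twist K₂) ξ S h ⬝ᵥ v = ∏ n, t (ξ n) ^ (h n : ℕ) := by
  obtain ⟨x, hx, rfl⟩ := ht
  obtain ⟨v, hv⟩ := exists_vector_of_mem_solutionSet hη hξ hK hS hx
  set z : Fin N → Op N × ℂ := fun a => (transfer η (twist K₂) ξ (ξ a), x a) with hz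
  have hSv : S ⬝ᵥ v = 1 := by
    have := hv 1 (Subalgebra.one_mem _)
    simpa using this
  -- Both components are the same interpolation formula in the generators.
  have hmem : ∀ u, ((transfer η (twist K₂) ξ u, t₁ η k₂ k₃ ξ x u) : Op N × ℂ) ∈
      Algebra.adjoin ℂ (Set.range z) := by
    intro u
    have e : ((transfer η (twist K₂) ξ u, t₁ η k₂ k₃ ξ x u) : Op N × ℂ) =
        interp η ξ (-(k₂ + k₃)) z u := by
      refine Prod.ext ?_ ?_
      · have := map_interp η ξ z (AlgHom.fst ℂ (Op N) ℂ) (-(k₂ + k₃)) u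
        change _ = (AlgHom.fst ℂ (Op N) ℂ) (interp η ξ (-(k₂ + k₃)) z u)
        rw [this, ← superTr_twist hK]
        exact transfer_eq_interp hξ u
      · have := map_interp η ξ z (AlgHom.snd ℂ (Op N) ℂ) (-(k₂ + k₃)) u
        change _ = (AlgHom.snd ℂ (Op N) ℂ) (interp η ξ (-(k₂ + k₃)) z u)
        rw [this]
        exact t₁_eq_interp k₂ k₃ x u
    rw [e, interp]
    exact Subalgebra.add_mem _ (Subalgebra.smul_mem _ (Subalgebra.one_mem _) _)
      (Subalgebra.sum_mem _ fun a _ => Subalgebra.smul_mem _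
        (Algebra.subset_adjoin (Set.mem_range_self a)) _)
  -- Since b ↦ b.2 is multiplicative, inserting T(u) after a monomial multiplies its pairing with v
  -- by t₁(u); the SoV covectors detect equality of vectors.
  have heig : IsEigen η (twist K₂) ξ (t₁ η k₂ k₃ ξ x) v := by
    intro u
    refine eq_of_sovCovector_dotProduct hS fun h => ?_
    have hp : (((List.finRange N).map fun n => z n ^ (h n : ℕ)).prod) ∈
        Algebra.adjoin ℂ (Set.range z) := by
      refine Subalgebra.list_prod_mem _ fun y hy => ?_
      obtain ⟨n, -, rfl⟩ := List.mem_map.1 hy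
      exact Subalgebra.pow_mem _ (Algebra.subset_adjoin (Set.mem_range_self n)) _
    have e1 : (((List.finRange N).map fun n => z n ^ (h n : ℕ)).prod).1 =
        ((List.finRange N).map fun n => transfer η (twist K₂) ξ (ξ n) ^ (h n : ℕ)).prod := by
      change (AlgHom.fst ℂ (Op N) ℂ) _ = _
      rw [map_list_prod, List.map_map]
      rfl
    have h1 := hv _ hp
    have h2 := hv _ (Subalgebra.mul_mem _ hp (hmem u))
    rw [Prod.fst_mul, Prod.snd_mul, e1] at h2
    rw [e1] at h1
    rw [dotProduct_smul, sovCovector, h1, Matrix.dotProduct_mulVec, Matrix.vecMul_vecMul, h2,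
      smul_eq_mul, mul_comm]
  refine ⟨v, ?_, heig, fun w hw => ⟨S ⬝ᵥ w, ?_⟩, fun h => ?_⟩
  · rintro rfl
    simp at hSv
  · have := eq_smul_of_isEigen hS heig hw
    rwa [hSv, one_smul] at this
  · rw [sovCovector_dotProduct heig, hSv, mul_one]

end Completeness

end GL12

end

/-! ### Diagonalizability from the trace form -/

noncomputable section

namespace GL12

variable {N : ℕ} {η : ℂ} {ξ : Fin N → ℂ}

/-! ### Diagonalizability -/

/-- The monomials in the values of the transfer matrix at the inhomogeneities. -/
def transferMonomial (η : ℂ) (K : Matrix (Fin 3) (Fin 3) ℂ) (ξ : Fin N → ℂ) (h : Fin N → Fin 3) :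
    Op N :=
  ((List.finRange N).map fun n => transfer η K ξ (ξ n) ^ (h n : ℕ)).prod

/-- The Gram matrix of the trace form on these monomials. -/
def traceGram (η : ℂ) (K : Matrix (Fin 3) (Fin 3) ℂ) (ξ : Fin N → ℂ) : Op N :=
  Matrix.of fun g h => (transferMonomial η K ξ g * transferMonomial η K ξ h).trace

lemma sovCovector_eq (K : Matrix (Fin 3) (Fin 3) ℂ) (S : Conf N → ℂ) (h : Fin N → Fin 3) :
    sovCovector η K ξ S h = S ᵥ* transferMonomial η K ξ h := rfl

variable {K₂ : Matrix (Fin 2) (Fin 2) ℂ} {k₂ k₃ : ℂ}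

lemma transferMonomial_mem (K : Matrix (Fin 3) (Fin 3) ℂ) (h : Fin N → Fin 3) :
    transferMonomial η K ξ h ∈ Algebra.adjoin ℂ (Set.range fun a => transfer η K ξ (ξ a)) := by
  refine Subalgebra.list_prod_mem _ fun y hy => ?_
  obtain ⟨n, -, rfl⟩ := List.mem_map.1 hy
  exact Subalgebra.pow_mem _ (Algebra.subset_adjoin (Set.mem_range_self n)) _

lemma linearIndependent_transferMonomial {K : Matrix (Fin 3) (Fin 3) ℂ} {S : Conf N → ℂ}
    (hS : IsSoVBasis η K ξ S) : LinearIndependent ℂ (transferMonomial η K ξ) := by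
  let θ : Op N →ₗ[ℂ] (Conf N → ℂ) :=
    { toFun := fun M => S ᵥ* M
      map_add' := fun b c => Matrix.vecMul_add _ _ _
      map_smul' := fun r b => Matrix.vecMul_smul _ _ _ }
  exact LinearIndependent.of_comp θ hS.1

/-- The 3^N monomials are independent because their images under S are, and the fusion bound leaves
room for no more. -/
lemma exists_sum_transferMonomial (hη : η ≠ 0) (hξ : InhomCond η ξ)
    (hK : K₂.charpoly = (Polynomial.X - Polynomial.C k₂) * (Polynomial.X - Polynomial.C k₃))
    {S : Conf N → ℂ} (hS : IsSoVBasis η (twist K₂) ξ S) {M : Op N}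
    (hM : M ∈ Algebra.adjoin ℂ (Set.range fun a => transfer η (twist K₂) ξ (ξ a))) :
    ∃ c : (Fin N → Fin 3) → ℂ, M = ∑ h, c h • transferMonomial η (twist K₂) ξ h := by
  set B := Algebra.adjoin ℂ (Set.range fun a => transfer η (twist K₂) ξ (ξ a)) with hB
  obtain ⟨hfin, hle⟩ := finrank_adjoin_le_of_fusion hη hξ
    (fun a b => (transfer_commute (twist_isEven K₂) (ξ a) (ξ b)).eq) (transfer_mul_interp₂ hη hξ hK)
  let m : (Fin N → Fin 3) → B := fun h => ⟨_, transferMonomial_mem (twist K₂) h⟩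
  have hm : LinearIndependent ℂ m :=
    LinearIndependent.of_comp B.val.toLinearMap (linearIndependent_transferMonomial hS)
  have hcard : Fintype.card (Fin N → Fin 3) = Module.finrank ℂ B :=
    le_antisymm hm.fintype_card_le_finrank hle
  have hspan := hm.span_eq_top_of_card_eq_finrank' hcard
  have hMs : (⟨M, hM⟩ : B) ∈ Submodule.span ℂ (Set.range m) := hspan ▸ Submodule.mem_top
  obtain ⟨c, hc⟩ := (Submodule.mem_span_range_iff_exists_fun ℂ).1 hMs
  refine ⟨c, ?_⟩
  have := congrArg B.val hc
  rw [map_sum] at this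
  simpa [m] using this.symm

-- A nilpotent M in this commutative algebra has nilpotent, hence traceless, products with every
-- monomial, so its coefficients lie in the kernel of the Gram matrix.
open scoped IsMulCommutative in
lemma isReduced_adjoin (hη : η ≠ 0) (hξ : InhomCond η ξ)
    (hK : K₂.charpoly = (Polynomial.X - Polynomial.C k₂) * (Polynomial.X - Polynomial.C k₃))
    {S : Conf N → ℂ} (hS : IsSoVBasis η (twist K₂) ξ S) (hG : (traceGram η (twist K₂) ξ).det ≠ 0)
    {M : Op N} (hM : M ∈ Algebra.adjoin ℂ (Set.range fun a => transfer η (twist K₂) ξ (ξ a)))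
    (hnil : IsNilpotent M) : M = 0 := by
  have hcomm : IsMulCommutative
      (Algebra.adjoin ℂ (Set.range fun a => transfer η (twist K₂) ξ (ξ a))) :=
    Algebra.isMulCommutative_adjoin ℂ (by
      rintro _ ⟨a, rfl⟩ _ ⟨b, rfl⟩
      exact (transfer_commute (twist_isEven K₂) (ξ a) (ξ b)).eq)
  obtain ⟨c, hc⟩ := exists_sum_transferMonomial hη hξ hK hS hM
  have h0 : c ᵥ* traceGram η (twist K₂) ξ = 0 := by
    funext h
    have hCM : Commute M (transferMonomial η (twist K₂) ξ h) :=
      congrArg Subtype.val (hcomm.is_comm.comm ⟨M, hM⟩ ⟨_, transferMonomial_mem (twist K₂) h⟩)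
    have := (Matrix.isNilpotent_trace_of_isNilpotent (hCM.isNilpotent_mul_right hnil)).eq_zero
    rw [hc, Finset.sum_mul, Matrix.trace_sum] at this
    simpa [Matrix.vecMul, dotProduct, traceGram] using this
  have := Matrix.eq_zero_of_vecMul_eq_zero hG h0
  rw [hc, this]
  simp

-- In a reduced finite-dimensional algebra the minimal polynomial of an element is squarefree.
open scoped IsMulCommutative in
lemma isSemisimple_transfer (hη : η ≠ 0) (hξ : InhomCond η ξ)
    (hK : K₂.charpoly = (Polynomial.X - Polynomial.C k₂) * (Polynomial.X - Polynomial.C k₃))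
    {S : Conf N → ℂ} (hS : IsSoVBasis η (twist K₂) ξ S) (hG : (traceGram η (twist K₂) ξ).det ≠ 0)
    (a : Fin N) :
    Module.End.IsSemisimple (Matrix.toLin' (transfer η (twist K₂) ξ (ξ a))) := by
  set B := Algebra.adjoin ℂ (Set.range fun a => transfer η (twist K₂) ξ (ξ a)) with hB
  have hcomm : IsMulCommutative B :=
    Algebra.isMulCommutative_adjoin ℂ (by
      rintro _ ⟨a, rfl⟩ _ ⟨b, rfl⟩
      exact (transfer_commute (twist_isEven K₂) (ξ a) (ξ b)).eq)
  have : IsReduced B := ⟨fun y hy => Subtype.ext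
    (isReduced_adjoin hη hξ hK hS hG y.2 (hy.map B.val))⟩
  have hfin : Module.Finite ℂ B := (finrank_adjoin_le_of_fusion hη hξ
    (fun a b => (transfer_commute (twist_isEven K₂) (ξ a) (ξ b)).eq)
    (transfer_mul_interp₂ hη hξ hK)).1
  let y : B := ⟨transfer η (twist K₂) ξ (ξ a), Algebra.subset_adjoin (Set.mem_range_self a)⟩
  refine Module.End.isSemisimple_of_squarefree_aeval_eq_zero
    ((minpoly.isRadical ℂ y).squarefree (minpoly.ne_zero (.of_finite ℂ y))) ?_
  have h1 : Polynomial.aeval (transfer η (twist K₂) ξ (ξ a)) (minpoly ℂ y) = 0 := by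
    have := Polynomial.aeval_algHom_apply B.val y (minpoly ℂ y)
    rw [minpoly.aeval, map_zero] at this
    exact this
  have h2 := Polynomial.aeval_algHom_apply
    (Matrix.toLinAlgEquiv' (R := ℂ) (n := Conf N)).toAlgHom (transfer η (twist K₂) ξ (ξ a))
    (minpoly ℂ y)
  rw [h1, map_zero] at h2
  exact h2

lemma diagonalizableSimple_of_gram (hη : η ≠ 0) (hξ : InhomCond η ξ)
    (hK : K₂.charpoly = (Polynomial.X - Polynomial.C k₂) * (Polynomial.X - Polynomial.C k₃))
    {S : Conf N → ℂ} (hS : IsSoVBasis η (twist K₂) ξ S)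
    (hG : (traceGram η (twist K₂) ξ).det ≠ 0) : DiagonalizableSimple η (twist K₂) ξ := by
  let T : Fin N → Module.End ℂ (Conf N → ℂ) := fun a =>
    Matrix.toLin' (transfer η (twist K₂) ξ (ξ a))
  have hss : ∀ a μ, (T a).maxGenEigenspace μ = (T a).eigenspace μ := fun a μ =>
    (isSemisimple_transfer hη hξ hK hS hG a).isFinitelySemisimple.maxGenEigenspace_eq_eigenspace μ
  have hTc : ∀ a b, Commute (T a) (T b) := fun a b => by
    change T a * T b = T b * T a
    change Matrix.toLin' _ ∘ₗ Matrix.toLin' _ = Matrix.toLin' _ ∘ₗ Matrix.toLin' _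
    rw [← Matrix.toLin'_mul, ← Matrix.toLin'_mul, (transfer_commute (twist_isEven K₂) _ _).eq]
  let V : (Fin N → ℂ) → Submodule ℂ (Conf N → ℂ) := fun χ => ⨅ a, (T a).eigenspace (χ a)
  have hVtop : ⨆ χ, V χ = ⊤ := by
    have := Module.End.iSup_iInf_maxGenEigenspace_eq_top_of_iSup_maxGenEigenspace_eq_top_of_commute
      T (fun a b _ => hTc a b) fun a => Module.End.iSup_maxGenEigenspace_eq_top (T a)
    simpa only [hss] using this
  have hVind : iSupIndep V := by
    have := Module.End.independent_iInf_maxGenEigenspace_of_forall_mapsTo T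
      fun a b φ => Module.End.mapsTo_maxGenEigenspace_of_comm (hTc b a) φ
    simpa only [hss] using this
  have hVeig : ∀ χ, ∀ v ∈ V χ, IsEigen η (twist K₂) ξ (interp η ξ (superTr (twist K₂)) χ) v := by
    intro χ v hv u
    have hv' : ∀ a, transfer η (twist K₂) ξ (ξ a) *ᵥ v = χ a • v := by
      intro a
      have := (Submodule.mem_iInf _).1 hv a
      rwa [Module.End.mem_eigenspace_iff, Matrix.toLin'_apply] at this
    rw [transfer_interpolation hξ, Matrix.add_mulVec, Matrix.sum_mulVec, interp, add_smul,
      Finset.sum_smul]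
    simp only [Matrix.smul_mulVec, Matrix.one_mulVec, hv', smul_eq_mul, mul_one, smul_smul]
  -- The joint eigenspaces decompose the space and, by the SoV property, each nonzero one is a line.
  -- One vector from each therefore gives a basis, and distinct χ give distinct eigenvalue
  -- functions.
  let J := {χ : Fin N → ℂ // V χ ≠ ⊥}
  have hex : ∀ χ : J, ∃ v ∈ V χ, v ≠ 0 := fun χ => Submodule.exists_mem_ne_zero_of_ne_bot χ.2
  choose v hvV hv0 using hex
  have hli : LinearIndependent ℂ v :=
    (hVind.comp Subtype.val_injective).linearIndependent _ hvV hv0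
  have hspan : ⊤ ≤ Submodule.span ℂ (Set.range v) := by
    rw [← hVtop, iSup_le_iff]
    intro χ w hw
    by_cases hχ : V χ = ⊥
    · rw [hχ, Submodule.mem_bot] at hw
      rw [hw]
      exact Submodule.zero_mem _
    · have e := eq_smul_of_isEigen hS (hVeig χ _ (hvV ⟨χ, hχ⟩)) (hVeig χ w hw)
      have hne := dotProduct_ne_zero_of_isEigen hS (hVeig χ _ (hvV ⟨χ, hχ⟩)) (hv0 ⟨χ, hχ⟩)
      have : w = ((S ⬝ᵥ v ⟨χ, hχ⟩)⁻¹ * (S ⬝ᵥ w)) • v ⟨χ, hχ⟩ := by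
        rw [mul_smul, ← e, smul_smul, inv_mul_cancel₀ hne, one_smul]
      rw [this]
      exact Submodule.smul_mem _ _ (Submodule.subset_span (Set.mem_range_self _))
  let b := Module.Basis.mk hli hspan
  let e : J ≃ Conf N := b.indexEquiv (Pi.basisFun ℂ (Conf N))
  refine ⟨b.reindex e, fun σ => interp η ξ (superTr (twist K₂)) (e.symm σ).1, fun σ τ hστ => ?_,
    fun σ => ?_⟩
  · refine e.symm.injective (Subtype.ext (funext fun a => ?_))
    have := congrFun hστ (ξ a)
    simpa only [interp_inhomogeneity hξ] using this
  · have : (b.reindex e) σ = v (e.symm σ) := by simp [b]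
    rw [this]
    exact hVeig _ _ (hvV _)

end GL12

end

/-! ### Genericity: decoupling limit and polynomial dependence -/

noncomputable section

namespace GL12

variable {N : ℕ}

/-! ### Tensor products of operators at the sites -/

/-- The ungraded tensor product of matrices at the individual sites. -/
def tensorHom (N : ℕ) : (Fin N → Matrix (Fin 3) (Fin 3) ℂ) →* Op N where
  toFun X := Matrix.of fun σ τ => ∏ n, X n (σ n) (τ n)
  map_one' := by
    ext σ τ
    by_cases h : σ = τ
    · subst h; simp
    · obtain ⟨n, hn⟩ := Function.ne_iff.1 h
      rw [Matrix.of_apply, Matrix.one_apply_ne h]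
      exact Finset.prod_eq_zero (Finset.mem_univ n) (by simp [hn])
  map_mul' X Y := by
    ext σ τ
    simp only [Matrix.of_apply, Matrix.mul_apply, Pi.mul_apply, ← Finset.prod_mul_distrib]
    rw [Finset.prod_univ_sum, Fintype.piFinset_univ]

lemma tensorHom_apply (X : Fin N → Matrix (Fin 3) (Fin 3) ℂ) (σ τ : Conf N) :
    tensorHom N X σ τ = ∏ n, X n (σ n) (τ n) := rfl

lemma det_tensorHom_ne_zero {X : Fin N → Matrix (Fin 3) (Fin 3) ℂ} (h : ∀ n, (X n).det ≠ 0) :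
    (tensorHom N X).det ≠ 0 := by
  have hX : IsUnit X := Pi.isUnit_iff.2 fun n =>
    (Matrix.isUnit_iff_isUnit_det _).2 (isUnit_iff_ne_zero.2 (h n))
  exact ((Matrix.isUnit_iff_isUnit_det _).1 (hX.map (tensorHom N))).ne_zero

lemma trace_tensorHom (X : Fin N → Matrix (Fin 3) (Fin 3) ℂ) :
    (tensorHom N X).trace = ∏ n, (X n).trace := by
  simp only [Matrix.trace, Matrix.diag, tensorHom_apply]
  rw [Finset.prod_univ_sum, Fintype.piFinset_univ]

lemma productCovector_vecMul_tensorHom (s : Fin N → Fin 3 → ℂ)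
    (X : Fin N → Matrix (Fin 3) (Fin 3) ℂ) :
    productCovector s ᵥ* tensorHom N X = productCovector fun n => s n ᵥ* X n := by
  funext σ
  simp only [Matrix.vecMul, dotProduct, productCovector, tensorHom_apply,
    ← Finset.prod_mul_distrib]
  rw [Finset.prod_univ_sum, Fintype.piFinset_univ]

/-- Even operators carry no graded signs, so products of twists at different sites are ordinary
tensor products and their determinants and traces reduce to single sites. -/
lemma siteOp_eq_tensorHom (a : Fin N) {X : Matrix (Fin 3) (Fin 3) ℂ} (hX : IsEvenMatrix X) :
    siteOp a X = tensorHom N (Pi.mulSingle a X) := by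
  have hE : siteOp a X = ∑ i, ∑ j, X i j • (Matrix.of fun σ τ =>
      if τ a = j ∧ σ = Function.update τ a i then (1 : ℂ) else 0 : Op N) := by
    refine Finset.sum_congr rfl fun i _ => Finset.sum_congr rfl fun j _ => ?_
    by_cases h0 : X i j = 0
    · simp [h0]
    congr 1
    ext σ τ
    rw [siteE_apply, hX i j h0, Even.neg_one_pow ⟨parity j * leftParity a τ, by ring⟩]
    rfl
  rw [hE]
  ext σ τ
  rw [tensorHom_apply, ← Finset.mul_prod_erase _ _ (Finset.mem_univ a), Pi.mulSingle_eq_same]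
  simp only [Matrix.sum_apply, Matrix.smul_apply, Matrix.of_apply, smul_eq_mul, mul_ite, mul_one,
    mul_zero, ite_and, Finset.sum_ite_eq, Finset.mem_univ, if_true]
  by_cases h : σ = Function.update τ a (σ a)
  · have h1 : ∏ n ∈ Finset.univ.erase a, (Pi.mulSingle a X : Fin N → Matrix (Fin 3) (Fin 3) ℂ) n
        (σ n) (τ n) = 1 := by
      refine Finset.prod_eq_one fun n hn => ?_
      have hna := Finset.ne_of_mem_erase hn
      have : σ n = τ n := by rw [h, Function.update_of_ne hna]
      rw [Pi.mulSingle_eq_of_ne hna, this, Matrix.one_apply_eq]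
    rw [h1, mul_one, Finset.sum_eq_single (σ a)]
    · rw [if_pos h]
    · intro i _ hi
      refine if_neg fun h2 => hi ?_
      have := congrFun h2 a
      simpa using this.symm
    · simp
  · obtain ⟨n, hn⟩ := Function.ne_iff.1 h
    have hna : n ≠ a := by rintro rfl; simp at hn
    rw [Function.update_of_ne hna] at hn
    have h1 : ∏ n ∈ Finset.univ.erase a, (Pi.mulSingle a X : Fin N → Matrix (Fin 3) (Fin 3) ℂ) n
        (σ n) (τ n) = 0 := by
      refine Finset.prod_eq_zero (Finset.mem_erase.2 ⟨hna, Finset.mem_univ n⟩) ?_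
      rw [Pi.mulSingle_eq_of_ne hna, Matrix.one_apply_ne hn]
    rw [h1, mul_zero]
    refine Finset.sum_eq_zero fun i _ => if_neg fun h2 => h ?_
    have := congrFun h2 a
    rw [Function.update_self] at this
    rw [this, ← h2]

lemma list_prod_mulSingle {M : Type*} [Monoid M] (x : Fin N → M) :
    ((List.finRange N).map fun n => (Pi.mulSingle n (x n) : Fin N → M)).prod = x := by
  have key : ∀ l : List (Fin N), l.Nodup → ∀ m,
      (l.map fun n => (Pi.mulSingle n (x n) : Fin N → M)).prod m = if m ∈ l then x m else 1 := by
    intro l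
    induction l with
    | nil => simp
    | cons a l ih =>
      intro hl m
      rw [List.nodup_cons] at hl
      rw [List.map_cons, List.prod_cons, Pi.mul_apply, ih hl.2 m]
      by_cases h : m = a
      · subst h; simp [hl.1]
      · simp [h]
  funext m
  simp [key _ (List.nodup_finRange N) m]

lemma list_prod_siteOp_pow {K : Matrix (Fin 3) (Fin 3) ℂ} (hK : IsEvenMatrix K) (h : Fin N → ℕ) :
    ((List.finRange N).map fun n => siteOp n K ^ h n).prod = tensorHom N fun n => K ^ h n := by
  have : (fun n : Fin N => siteOp n K ^ h n) =
      (tensorHom N) ∘ fun n => Pi.mulSingle n (K ^ h n) := by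
    funext n
    rw [siteOp_eq_tensorHom n hK, ← map_pow, Function.comp_apply, Pi.mulSingle_pow]
  rw [this, ← List.map_map, ← map_list_prod, list_prod_mulSingle]

/-! ### The limit of well separated inhomogeneities -/

open Filter Topology

/-- Inhomogeneities on a line, with distances proportional to `s`. -/
def separated (N : ℕ) (s : ℕ) : Fin N → ℂ := fun n => s * (n : ℕ)

lemma tendsto_inv_separated {a n : Fin N} :
    Tendsto (fun s => (separated N s a - separated N s n)⁻¹) atTop (𝓝 0) := by
  have h := (tendsto_inv_atTop_nhds_zero_nat (𝕜 := ℂ)).mul_const (((a : ℕ) - (n : ℕ) : ℂ)⁻¹)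
  rw [zero_mul] at h
  refine h.congr fun s => ?_
  rw [separated, separated, ← mul_sub, mul_inv]

lemma separated_sub_ne_zero {a n : Fin N} (h : a ≠ n) {s : ℕ} (hs : s ≠ 0) :
    separated N s a - separated N s n ≠ 0 := by
  rw [separated, separated, ← mul_sub]
  refine mul_ne_zero (by exact_mod_cast hs) (sub_ne_zero.2 ?_)
  exact_mod_cast fun e => h (Fin.ext e)

lemma list_prod_map_smul {ι A : Type*} [Ring A] [Algebra ℂ A] (l : List ι) (c : ι → ℂ) (M : ι → A) :
    (l.map fun n => c n • M n).prod = (l.map c).prod • (l.map M).prod := by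
  induction l with
  | nil => simp
  | cons a l ih => simp only [List.map_cons, List.prod_cons, ih, smul_mul_smul_comm]

/-- In `transfer_inhomogeneity`, each R(ξ_a - ξ_n)/(ξ_a - ξ_n) tends to 1 as the distances grow,
leaving only K at site a. -/
lemma exists_tendsto_transfer {η : ℂ} (hη : η ≠ 0) {K : Matrix (Fin 3) (Fin 3) ℂ}
    (hK : IsEvenMatrix K) (a : Fin N) : ∃ c : ℕ → ℂ, (∀ s, s ≠ 0 → c s ≠ 0) ∧
      Tendsto (fun s => c s • transfer η K (separated N s) (separated N s a)) atTop
        (𝓝 (siteOp a K)) := by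
  obtain ⟨l₁, l₂, hl, -, -, h₁, h₂, h₁₂, -⟩ := exists_sites_split a
  let q : ℕ → Fin N → ℂ := fun s n => (separated N s a - separated N s n)⁻¹
  have hq : ∀ l : List (Fin N), a ∉ l → Tendsto (fun s => (l.map fun n => q s n •
      rMatrix η a n (separated N s a - separated N s n)).prod) atTop (𝓝 1) := by
    intro l hal
    have h1 : ∀ n ∈ l, Tendsto (fun s => q s n •
        rMatrix η a n (separated N s a - separated N s n)) atTop (𝓝 1) := by
      intro n hn
      have h2 : Tendsto (fun s => (1 : Op N) + (q s n * η) • gradedPerm a n) atTop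
          (𝓝 (1 + ((0 : ℂ) * η) • gradedPerm a n)) :=
        tendsto_const_nhds.add ((tendsto_inv_separated.mul_const η).smul_const _)
      rw [zero_mul, zero_smul, add_zero] at h2
      refine h2.congr' ?_
      filter_upwards [eventually_ne_atTop 0] with s hs
      have hne := separated_sub_ne_zero (fun e => hal (e ▸ hn) : a ≠ n) hs
      rw [rMatrix, smul_add, smul_smul, smul_smul, inv_mul_cancel₀ hne, one_smul]
    have := tendsto_list_prod l h1
    simpa using this
  refine ⟨fun s => η⁻¹ * ((l₂.map (q s)).prod * (l₁.map (q s)).prod), fun s hs => ?_, ?_⟩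
  · have hprod : ∀ l : List (Fin N), a ∉ l → (l.map (q s)).prod ≠ 0 := by
      intro l hal h0
      obtain ⟨n, hn, hn0⟩ := List.mem_map.1 (List.prod_eq_zero_iff.1 h0)
      exact inv_ne_zero (separated_sub_ne_zero (fun e => hal (e ▸ hn) : a ≠ n) hs) hn0
    exact mul_ne_zero (inv_ne_zero hη) (mul_ne_zero (hprod _ h₂) (hprod _ h₁))
  · have h := ((hq l₂ h₂).mul_const (siteOp a K)).mul (hq l₁ h₁)
    rw [one_mul, mul_one] at h
    refine h.congr fun s => ?_
    rw [transfer_inhomogeneity η _ hK hl h₁ h₂ h₁₂, list_prod_map_smul, list_prod_map_smul,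
      smul_mul_assoc, smul_mul_smul_comm, smul_smul]
    congr 1
    field_simp

lemma exists_tendsto_transferMonomial {η : ℂ} (hη : η ≠ 0) {K : Matrix (Fin 3) (Fin 3) ℂ}
    (hK : IsEvenMatrix K) : ∃ c : ℕ → (Fin N → Fin 3) → ℂ, (∀ s h, s ≠ 0 → c s h ≠ 0) ∧
      ∀ h, Tendsto (fun s => c s h • transferMonomial η K (separated N s) h) atTop
        (𝓝 (tensorHom N fun n => K ^ (h n : ℕ))) := by
  choose c hc0 hc using fun a : Fin N => exists_tendsto_transfer hη hK a
  refine ⟨fun s h => ((List.finRange N).map fun n => c n s ^ (h n : ℕ)).prod,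
    fun s h hs h0 => ?_, fun h => ?_⟩
  · obtain ⟨n, hn, hn0⟩ := List.mem_map.1 (List.prod_eq_zero_iff.1 h0)
    exact pow_ne_zero _ (hc0 n s hs) hn0
  · rw [← list_prod_siteOp_pow hK]
    have := tendsto_list_prod (List.finRange N) fun n _ => (hc n).pow (h n : ℕ)
    refine this.congr fun s => ?_
    rw [transferMonomial, ← list_prod_map_smul]
    simp only [smul_pow]

/-- The matrix whose rows are the SoV covectors. -/
def sovMatrix (η : ℂ) (K : Matrix (Fin 3) (Fin 3) ℂ) (ξ : Fin N → ℂ) (S : Conf N → ℂ) : Op N :=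
  Matrix.of (sovCovector η K ξ S)

lemma isSoVBasis_of_det_ne_zero {η : ℂ} {K : Matrix (Fin 3) (Fin 3) ℂ} {ξ : Fin N → ℂ}
    {S : Conf N → ℂ} (h : (sovMatrix η K ξ S).det ≠ 0) : IsSoVBasis η K ξ S := by
  have hli : LinearIndependent ℂ (sovCovector η K ξ S) :=
    Matrix.linearIndependent_rows_of_det_ne_zero h
  exact ⟨hli, hli.span_eq_top_of_card_eq_finrank' (by rw [Module.finrank_pi])⟩

/-- Rescaling rows and columns multiplies the determinant by scalars, so a nonzero limit forces a
nonzero determinant at some finite stage. -/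
lemma exists_det_ne_zero_of_tendsto {ι : Type*} [Fintype ι] [DecidableEq ι]
    {F : ℕ → Matrix ι ι ℂ} {c c' : ℕ → ι → ℂ} {M : Matrix ι ι ℂ} (hM : M.det ≠ 0)
    (hF : ∀ i j, Tendsto (fun s => c s i * F s i j * c' s j) atTop (𝓝 (M i j))) :
    ∃ s, (F s).det ≠ 0 := by
  have h1 : Tendsto (fun s => (Matrix.diagonal (c s) * F s * Matrix.diagonal (c' s)).det) atTop
      (𝓝 M.det) := by
    refine ((continuous_id.matrix_det).tendsto M).comp ?_
    refine tendsto_pi_nhds.2 fun i => tendsto_pi_nhds.2 fun j => ?_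
    simpa [Matrix.mul_diagonal, Matrix.diagonal_mul] using hF i j
  obtain ⟨s, hs⟩ := (h1.eventually_ne hM).exists
  rw [Matrix.det_mul, Matrix.det_mul] at hs
  exact ⟨s, right_ne_zero_of_mul (left_ne_zero_of_mul hs)⟩

lemma exists_det_sovMatrix_ne_zero {η : ℂ} (hη : η ≠ 0) {K : Matrix (Fin 3) (Fin 3) ℂ}
    (hK : IsEvenMatrix K) {s : Fin N → Fin 3 → ℂ}
    (hs : ∀ n, (Matrix.of fun j : Fin 3 => s n ᵥ* K ^ (j : ℕ)).det ≠ 0) :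
    ∃ ξ : Fin N → ℂ, (sovMatrix η K ξ (productCovector s)).det ≠ 0 := by
  obtain ⟨c, -, hc⟩ := exists_tendsto_transferMonomial (N := N) hη hK
  obtain ⟨r, hr⟩ := exists_det_ne_zero_of_tendsto
    (F := fun r => sovMatrix η K (separated N r) (productCovector s)) (c := c)
    (c' := fun _ _ => 1) (det_tensorHom_ne_zero hs) (by
      intro h σ
      have h1 : Tendsto (fun r => productCovector s ᵥ*
          (c r h • transferMonomial η K (separated N r) h)) atTop
          (𝓝 (productCovector s ᵥ* tensorHom N fun n => K ^ (h n : ℕ))) :=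
        ((continuous_const.matrix_vecMul continuous_id).tendsto _).comp (hc h)
      rw [productCovector_vecMul_tensorHom] at h1
      refine (tendsto_pi_nhds.1 h1 σ).congr fun r => ?_
      rw [Matrix.vecMul_smul]
      simp [sovMatrix, sovCovector_eq])
  exact ⟨_, hr⟩

lemma exists_det_traceGram_ne_zero {η : ℂ} (hη : η ≠ 0) {K : Matrix (Fin 3) (Fin 3) ℂ}
    (hK : IsEvenMatrix K)
    (hG : (Matrix.of fun i j : Fin 3 => (K ^ (i : ℕ) * K ^ (j : ℕ)).trace).det ≠ 0) :
    ∃ ξ : Fin N → ℂ, (traceGram η K ξ).det ≠ 0 := by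
  obtain ⟨c, -, hc⟩ := exists_tendsto_transferMonomial (N := N) hη hK
  obtain ⟨r, hr⟩ := exists_det_ne_zero_of_tendsto (F := fun r => traceGram η K (separated N r))
    (c := c) (c' := c) (det_tensorHom_ne_zero (N := N) fun _ => hG) (by
      intro g h
      have h1 := ((continuous_id.matrix_trace).tendsto _).comp ((hc g).mul (hc h))
      rw [← map_mul] at h1
      simp only [id, trace_tensorHom, Pi.mul_apply] at h1
      refine h1.congr fun r => ?_
      simp only [Function.comp_apply, smul_mul_smul_comm, Matrix.trace_smul, traceGram,
        Matrix.of_apply, smul_eq_mul]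
      ring)
  exact ⟨_, hr⟩

/-! ### Polynomial dependence on the inhomogeneities -/

section PolyDependence

variable {κ : Type*}

/-- Polynomial functions of several variables. -/
def IsMvPoly (g : (κ → ℂ) → ℂ) : Prop := ∃ P : MvPolynomial κ ℂ, ∀ ξ, MvPolynomial.eval ξ P = g ξ

lemma IsMvPoly.const (c : ℂ) : IsMvPoly fun _ : κ → ℂ => c := ⟨MvPolynomial.C c, by simp⟩

lemma IsMvPoly.apply (i : κ) : IsMvPoly fun ξ : κ → ℂ => ξ i := ⟨MvPolynomial.X i, by simp⟩

lemma IsMvPoly.add {g g' : (κ → ℂ) → ℂ} (h : IsMvPoly g) (h' : IsMvPoly g') :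
    IsMvPoly fun ξ => g ξ + g' ξ := by
  obtain ⟨P, hP⟩ := h
  obtain ⟨P', hP'⟩ := h'
  exact ⟨P + P', by simp [hP, hP']⟩

lemma IsMvPoly.mul {g g' : (κ → ℂ) → ℂ} (h : IsMvPoly g) (h' : IsMvPoly g') :
    IsMvPoly fun ξ => g ξ * g' ξ := by
  obtain ⟨P, hP⟩ := h
  obtain ⟨P', hP'⟩ := h'
  exact ⟨P * P', by simp [hP, hP']⟩

lemma IsMvPoly.sum {ι : Type*} (s : Finset ι) {g : ι → (κ → ℂ) → ℂ} (h : ∀ i, IsMvPoly (g i)) :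
    IsMvPoly fun ξ => ∑ i ∈ s, g i ξ := by
  choose P hP using h
  exact ⟨∑ i ∈ s, P i, by simp [hP]⟩

lemma IsMvPoly.mul_apply {ι : Type*} [Fintype ι] {F G : (κ → ℂ) → Matrix ι ι ℂ}
    (hF : ∀ i j, IsMvPoly fun ξ => F ξ i j)
    (hG : ∀ i j, IsMvPoly fun ξ => G ξ i j) (i j : ι) : IsMvPoly fun ξ => (F ξ * G ξ) i j := by
  simp only [Matrix.mul_apply]
  exact IsMvPoly.sum _ fun k => (hF i k).mul (hG k j)

variable {ι : Type*} [Fintype ι] [DecidableEq ι]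

lemma IsMvPoly.list_prod_apply {γ : Type*} (l : List γ) {F : γ → (κ → ℂ) → Matrix ι ι ℂ}
    (hF : ∀ k i j, IsMvPoly fun ξ => F k ξ i j) (i j : ι) :
    IsMvPoly fun ξ => (l.map fun k => F k ξ).prod i j := by
  induction l generalizing i j with
  | nil => exact IsMvPoly.const _
  | cons a l ih =>
    simp only [List.map_cons, List.prod_cons]
    exact IsMvPoly.mul_apply (hF a) ih i j

lemma IsMvPoly.pow_apply {F : (κ → ℂ) → Matrix ι ι ℂ} (hF : ∀ i j, IsMvPoly fun ξ => F ξ i j)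
    (n : ℕ) (i j : ι) : IsMvPoly fun ξ => (F ξ ^ n) i j := by
  have := IsMvPoly.list_prod_apply (List.replicate n ()) (F := fun _ => F) (fun _ => hF) i j
  simpa using this

lemma IsMvPoly.det {F : (κ → ℂ) → Matrix ι ι ℂ} (hF : ∀ i j, IsMvPoly fun ξ => F ξ i j) :
    IsMvPoly fun ξ => (F ξ).det := by
  choose P hP using hF
  refine ⟨(Matrix.of P).det, fun ξ => ?_⟩
  rw [RingHom.map_det]
  congr 1
  ext i j
  simp [hP]

lemma IsMvPoly.exists_ne_zero {g : (κ → ℂ) → ℂ} (h : IsMvPoly g) (hg : ∃ ξ, g ξ ≠ 0) :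
    ∃ P : MvPolynomial κ ℂ, P ≠ 0 ∧ ∀ ξ, MvPolynomial.eval ξ P = g ξ := by
  obtain ⟨P, hP⟩ := h
  obtain ⟨ξ, hξ⟩ := hg
  refine ⟨P, ?_, hP⟩
  rintro rfl
  exact hξ (by rw [← hP ξ, map_zero])

end PolyDependence

lemma isMvPoly_rMatrix (η : ℂ) (a n : Fin N) (σ τ : Conf N) :
    IsMvPoly fun ξ : Fin N → ℂ => rMatrix η a n (ξ a - ξ n) σ τ := by
  have h : IsMvPoly fun ξ : Fin N → ℂ => (ξ a + (-1) * ξ n) * (1 : Op N) σ τ +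
      η * gradedPerm a n σ τ :=
    (((IsMvPoly.apply a).add ((IsMvPoly.const (-1)).mul (IsMvPoly.apply n))).mul
      (IsMvPoly.const _)).add (IsMvPoly.const _)
  have e : (fun ξ : Fin N → ℂ => rMatrix η a n (ξ a - ξ n) σ τ) = fun ξ : Fin N → ℂ =>
      (ξ a + (-1) * ξ n) * (1 : Op N) σ τ + η * gradedPerm a n σ τ := by
    funext ξ
    rw [rMatrix, Matrix.add_apply, Matrix.smul_apply, Matrix.smul_apply, smul_eq_mul, smul_eq_mul,
      neg_one_mul, sub_eq_add_neg]
  rw [e]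
  exact h

lemma isMvPoly_transfer (η : ℂ) {K : Matrix (Fin 3) (Fin 3) ℂ} (hK : IsEvenMatrix K)
    (a : Fin N) (σ τ : Conf N) : IsMvPoly fun ξ => transfer η K ξ (ξ a) σ τ := by
  obtain ⟨l₁, l₂, hl, -, -, h₁, h₂, h₁₂, -⟩ := exists_sites_split a
  have hL : ∀ (l : List (Fin N)) (σ τ : Conf N), IsMvPoly fun ξ : Fin N → ℂ =>
      (l.map fun n => rMatrix η a n (ξ a - ξ n)).prod σ τ := fun l =>
    IsMvPoly.list_prod_apply l (F := fun n ξ => rMatrix η a n (ξ a - ξ n))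
      fun n => isMvPoly_rMatrix η a n
  have h := IsMvPoly.mul_apply (IsMvPoly.mul_apply (hL l₂) (G := fun _ => siteOp a K)
    fun _ _ => IsMvPoly.const _) (hL l₁) σ τ
  have h' := (IsMvPoly.const η).mul h
  have e : (fun ξ : Fin N → ℂ => transfer η K ξ (ξ a) σ τ) = fun ξ : Fin N → ℂ =>
      η * ((l₂.map fun n => rMatrix η a n (ξ a - ξ n)).prod * siteOp a K *
        (l₁.map fun n => rMatrix η a n (ξ a - ξ n)).prod) σ τ := by
    funext ξ
    rw [transfer_inhomogeneity η _ hK hl h₁ h₂ h₁₂, Matrix.smul_apply, smul_eq_mul]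
  rw [e]
  exact h'

lemma isMvPoly_transferMonomial (η : ℂ) {K : Matrix (Fin 3) (Fin 3) ℂ} (hK : IsEvenMatrix K)
    (h : Fin N → Fin 3) (σ τ : Conf N) : IsMvPoly fun ξ => transferMonomial η K ξ h σ τ := by
  unfold transferMonomial
  exact IsMvPoly.list_prod_apply (List.finRange N)
    (F := fun n ξ => transfer η K ξ (ξ n) ^ (h n : ℕ))
    (fun a => IsMvPoly.pow_apply (F := fun ξ => transfer η K ξ (ξ a)) (isMvPoly_transfer η hK a) _)
    σ τ

lemma isMvPoly_det_sovMatrix (η : ℂ) {K : Matrix (Fin 3) (Fin 3) ℂ} (hK : IsEvenMatrix K)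
    (S : Conf N → ℂ) : IsMvPoly fun ξ => (sovMatrix η K ξ S).det := by
  refine IsMvPoly.det fun h σ => ?_
  exact IsMvPoly.sum Finset.univ fun ρ =>
    (IsMvPoly.const (S ρ)).mul (isMvPoly_transferMonomial η hK h ρ σ)

lemma isMvPoly_det_traceGram (η : ℂ) {K : Matrix (Fin 3) (Fin 3) ℂ} (hK : IsEvenMatrix K) :
    IsMvPoly fun ξ : Fin N → ℂ => (traceGram η K ξ).det := by
  refine IsMvPoly.det fun g h => ?_
  exact IsMvPoly.sum Finset.univ fun ρ => IsMvPoly.mul_apply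
    (isMvPoly_transferMonomial η hK g) (isMvPoly_transferMonomial η hK h) ρ ρ

/-- Here ξ is fixed and S varies, as needed for almost every covector. -/
lemma isMvPoly_det_sovMatrix_covector (η : ℂ) (K : Matrix (Fin 3) (Fin 3) ℂ) (ξ : Fin N → ℂ) :
    IsMvPoly fun S : Conf N → ℂ => (sovMatrix η K ξ S).det := by
  refine IsMvPoly.det fun h σ => ?_
  exact IsMvPoly.sum Finset.univ fun ρ =>
    (IsMvPoly.apply ρ).mul (IsMvPoly.const (transferMonomial η K ξ h ρ σ))

end GL12

end

/-! ### Single-site conditions on the twist -/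

noncomputable section

namespace GL12

/-! ### The twist matrix -/

/-- The kernel of the matrix with rows s, sK, sK² is K-stable by the cubic relation and lies in the
kernel of s. If nonzero it contains an eigenvector of K, on which s would vanish. -/
lemma det_vecMul_pow_ne_zero {K : Matrix (Fin 3) (Fin 3) ℂ} {s : Fin 3 → ℂ} {c₁ c₂ : ℂ}
    (hK : K ^ 3 = c₁ • K ^ 2 + c₂ • K)
    (hs : ∀ (μ : ℂ) (v : Fin 3 → ℂ), v ≠ 0 → K *ᵥ v = μ • v → s ⬝ᵥ v ≠ 0) :
    (Matrix.of fun j : Fin 3 => s ᵥ* K ^ (j : ℕ)).det ≠ 0 := by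
  intro hdet
  obtain ⟨v, hv0, hv⟩ := Matrix.exists_mulVec_eq_zero_iff.2 hdet
  let W : Submodule ℂ (Fin 3 → ℂ) :=
    LinearMap.ker (Matrix.toLin' (Matrix.of fun j : Fin 3 => s ᵥ* K ^ (j : ℕ)))
  have hW : ∀ w, w ∈ W ↔ s ⬝ᵥ w = 0 ∧ s ⬝ᵥ (K *ᵥ w) = 0 ∧ s ⬝ᵥ (K ^ 2 *ᵥ w) = 0 := by
    intro w
    rw [LinearMap.mem_ker, Matrix.toLin'_apply, funext_iff, Fin.forall_fin_succ,
      Fin.forall_fin_two]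
    have hj : ∀ j : Fin 3, ((Matrix.of fun j : Fin 3 => s ᵥ* K ^ (j : ℕ)) *ᵥ w) j =
        s ⬝ᵥ (K ^ (j : ℕ) *ᵥ w) := fun j => (Matrix.dotProduct_mulVec s (K ^ (j : ℕ)) w).symm
    rw [hj, hj, hj]
    simp
  have hinv : ∀ w ∈ W, Matrix.toLin' K w ∈ W := by
    intro w hw
    rw [hW] at hw
    rw [hW, Matrix.toLin'_apply]
    refine ⟨hw.2.1, ?_, ?_⟩
    · rw [Matrix.mulVec_mulVec, ← sq]
      exact hw.2.2
    · rw [Matrix.mulVec_mulVec, ← pow_succ, hK, Matrix.add_mulVec, Matrix.smul_mulVec,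
        Matrix.smul_mulVec, dotProduct_add, dotProduct_smul, dotProduct_smul, hw.2.1, hw.2.2]
      simp
  have : Nontrivial W := ⟨⟨⟨v, hv⟩, 0, fun h => hv0 (congrArg Subtype.val h)⟩⟩
  obtain ⟨μ, hμ⟩ := Module.End.exists_eigenvalue ((Matrix.toLin' K).restrict hinv)
  obtain ⟨w, hw⟩ := hμ.exists_hasEigenvector
  refine hs μ w.1 (fun h => hw.2 (Subtype.ext h)) ?_ ((hW w.1).1 w.2).1
  have := congrArg Subtype.val hw.apply_eq_smul
  simpa using this

section

variable {K₂ : Matrix (Fin 2) (Fin 2) ℂ} {k₂ k₃ : ℂ}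

lemma twist_pow_three
    (hK : K₂.charpoly = (Polynomial.X - Polynomial.C k₂) * (Polynomial.X - Polynomial.C k₃)) :
    twist K₂ ^ 3 = (k₂ + k₃) • twist K₂ ^ 2 + (-(k₂ * k₃)) • twist K₂ := by
  rw [← (trace_det_of_charpoly hK).1, ← (trace_det_of_charpoly hK).2]
  ext i j
  fin_cases i <;> fin_cases j <;>
    simp [twist, pow_succ, Matrix.mul_apply, Fin.sum_univ_three] <;> ring

/-- Newton's recursion for the eigenvalues 0, k₂, k₃. The exponent is n + 1 because the zero
eigenvalue contributes to the trace of the zeroth power. -/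
lemma trace_twist_pow
    (hK : K₂.charpoly = (Polynomial.X - Polynomial.C k₂) * (Polynomial.X - Polynomial.C k₃))
    (n : ℕ) : (twist K₂ ^ (n + 1)).trace = k₂ ^ (n + 1) + k₃ ^ (n + 1) := by
  obtain ⟨htr, hdet⟩ := trace_det_of_charpoly hK
  induction n using Nat.strong_induction_on with
  | _ n ih =>
    match n with
    | 0 => simp [twist, Matrix.trace_fin_three, htr]
    | 1 =>
      have h : (twist K₂ ^ 2).trace =
          (K₂ 0 0 + K₂ 1 1) ^ 2 - 2 * (K₂ 0 0 * K₂ 1 1 - K₂ 0 1 * K₂ 1 0) := by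
        simp [twist, Matrix.trace_fin_three, sq]
        ring
      rw [h, htr, hdet]
      ring
    | n + 2 =>
      have e : twist K₂ ^ (n + 2 + 1) =
          (k₂ + k₃) • twist K₂ ^ (n + 1 + 1) + (-(k₂ * k₃)) • twist K₂ ^ (n + 1) := by
        rw [show n + 2 + 1 = n + 3 from rfl, pow_add, twist_pow_three hK, mul_add, mul_smul_comm,
          mul_smul_comm, ← pow_add, ← pow_succ]
      rw [e, Matrix.trace_add, Matrix.trace_smul, Matrix.trace_smul, ih (n + 1) (by omega),
        ih n (by omega), smul_eq_mul, smul_eq_mul]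
      ring

lemma det_trace_twist_ne_zero
    (hK : K₂.charpoly = (Polynomial.X - Polynomial.C k₂) * (Polynomial.X - Polynomial.C k₃))
    (h₂₃ : k₂ ≠ k₃) (h₂ : k₂ ≠ 0) (h₃ : k₃ ≠ 0) :
    (Matrix.of fun i j : Fin 3 => (twist K₂ ^ (i : ℕ) * twist K₂ ^ (j : ℕ)).trace).det ≠ 0 := by
  have h1 := trace_twist_pow hK 0
  have h2 := trace_twist_pow hK 1
  have h3 := trace_twist_pow hK 2
  have h4 := trace_twist_pow hK 3
  norm_num at h1 h2 h3 h4
  have e : (Matrix.of fun i j : Fin 3 => (twist K₂ ^ (i : ℕ) * twist K₂ ^ (j : ℕ)).trace).det =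
      -- The Gram matrix of power sums has determinant the squared Vandermonde of 0, k₂, k₃.
      (k₂ * k₃ * (k₂ - k₃)) ^ 2 := by
    simp only [← pow_add]
    simp [Matrix.det_fin_three, h1, h2, h3, h4]
    ring
  rw [e]
  exact pow_ne_zero _ (mul_ne_zero (mul_ne_zero h₂ h₃) (sub_ne_zero.2 h₂₃))

/-- The covectors `(p, q)` of the odd part that do not vanish on any eigenvector. -/
lemma exists_odd_covector
    (hK : K₂.charpoly = (Polynomial.X - Polynomial.C k₂) * (Polynomial.X - Polynomial.C k₃))
    (h₂₃ : k₂ ≠ k₃) : ∃ p q : ℂ,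
      K₂ 0 1 * p ^ 2 + (K₂ 1 1 - K₂ 0 0) * (p * q) - K₂ 1 0 * q ^ 2 ≠ 0 := by
  -- The quadratic form is the determinant of the rows (p, q) and (p, q)K₂. If it vanished
  -- identically, K₂ would be scalar, contradicting the discriminant (k₂ - k₃)².
  by_contra! h
  have hb : K₂ 0 1 = 0 := by simpa using h 1 0
  have hc : K₂ 1 0 = 0 := by simpa using h 0 1
  have ha : K₂ 1 1 - K₂ 0 0 = 0 := by simpa [hb, hc] using h 1 1
  obtain ⟨htr, hdet⟩ := trace_det_of_charpoly hK
  refine h₂₃ (sub_eq_zero.1 (pow_eq_zero_iff two_ne_zero |>.1 ?_))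
  linear_combination (K₂ 1 1 - K₂ 0 0) * ha + 4 * K₂ 1 0 * hb -
    (K₂ 0 0 + K₂ 1 1 + k₂ + k₃) * htr + 4 * hdet

lemma exists_covector
    (hK : K₂.charpoly = (Polynomial.X - Polynomial.C k₂) * (Polynomial.X - Polynomial.C k₃))
    (h₂₃ : k₂ ≠ k₃) (h₂ : k₂ ≠ 0) (h₃ : k₃ ≠ 0) : ∃ s : Fin 3 → ℂ,
      ∀ (μ : ℂ) (v : Fin 3 → ℂ), v ≠ 0 → twist K₂ *ᵥ v = μ • v → s ⬝ᵥ v ≠ 0 := by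
  obtain ⟨p, q, hpq⟩ := exists_odd_covector hK h₂₃
  obtain ⟨-, hdet⟩ := trace_det_of_charpoly hK
  have hD := mul_ne_zero h₂ h₃
  rw [← hdet] at hD
  -- The entry 1 handles the even eigenvector of eigenvalue 0; for μ ≠ 0 the even component of v
  -- vanishes and (p, q) decides. For μ = 0 the odd part vanishes since K₂ is invertible.
  refine ⟨![1, p, q], fun μ v hv hKv hsv => hv ?_⟩
  have e0 : 0 = μ * v 0 := by
    simpa only [twist, Matrix.mulVec, dotProduct, Fin.sum_univ_three, Matrix.of_apply,
      Matrix.cons_val, zero_mul, add_zero, Pi.smul_apply, smul_eq_mul] using congrFun hKv 0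
  have e1 : K₂ 0 0 * v 1 + K₂ 0 1 * v 2 = μ * v 1 := by
    simpa [twist, Matrix.mulVec, dotProduct, Fin.sum_univ_three] using congrFun hKv 1
  have e2 : K₂ 1 0 * v 1 + K₂ 1 1 * v 2 = μ * v 2 := by
    simpa [twist, Matrix.mulVec, dotProduct, Fin.sum_univ_three] using congrFun hKv 2
  have es : v 0 + p * v 1 + q * v 2 = 0 := by
    simpa [dotProduct, Fin.sum_univ_three] using hsv
  suffices h : v 0 = 0 ∧ v 1 = 0 ∧ v 2 = 0 by
    funext i
    fin_cases i
    exacts [h.1, h.2.1, h.2.2]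
  by_cases hμ : μ = 0
  · subst hμ
    have h1 : v 1 = 0 := (mul_eq_zero.1 (show (K₂ 0 0 * K₂ 1 1 - K₂ 0 1 * K₂ 1 0) * v 1 = 0 by
      linear_combination K₂ 1 1 * e1 - K₂ 0 1 * e2)).resolve_left hD
    have h2 : v 2 = 0 := (mul_eq_zero.1 (show (K₂ 0 0 * K₂ 1 1 - K₂ 0 1 * K₂ 1 0) * v 2 = 0 by
      linear_combination K₂ 0 0 * e2 - K₂ 1 0 * e1)).resolve_left hD
    exact ⟨by simpa [h1, h2] using es, h1, h2⟩
  · have h0 : v 0 = 0 := (mul_eq_zero.1 e0.symm).resolve_left hμ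
    rw [h0, zero_add] at es
    have h1 : v 1 = 0 := (mul_eq_zero.1 (show
        (K₂ 0 1 * p ^ 2 + (K₂ 1 1 - K₂ 0 0) * (p * q) - K₂ 1 0 * q ^ 2) * v 1 = 0 by
      linear_combination (K₂ 0 1 * p + (K₂ 1 1 - μ) * q) * es - p * q * e1 -
        q ^ 2 * e2)).resolve_left hpq
    have h2 : v 2 = 0 := (mul_eq_zero.1 (show
        (K₂ 0 1 * p ^ 2 + (K₂ 1 1 - K₂ 0 0) * (p * q) - K₂ 1 0 * q ^ 2) * v 2 = 0 by
      linear_combination (-K₂ 1 0 * q - (K₂ 0 0 - μ) * p) * es + p * q * e2 +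
        p ^ 2 * e1)).resolve_left hpq
    exact ⟨h0, h1, h2⟩

end

end GL12

end

/-! ### The main theorem -/

theorem theorem3p1 (N : ℕ) (η : ℂ) (hη : η ≠ 0)
    (K₂ : Matrix (Fin 2) (Fin 2) ℂ) (k₂ k₃ : ℂ)
    (hK : K₂.charpoly = (Polynomial.X - Polynomial.C k₂) * (Polynomial.X - Polynomial.C k₃))
    (h₂₃ : k₂ ≠ k₃) (h₂ : k₂ ≠ 0) (h₃ : k₃ ≠ 0) :
    (∃ P : MvPolynomial (Fin N) ℂ, P ≠ 0 ∧
      ∀ ξ : Fin N → ℂ, GL12.InhomCond η ξ → MvPolynomial.eval ξ P ≠ 0 →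
        GL12.eigenvalueSpectrum η (GL12.twist K₂) ξ = GL12.sigmaSet η k₂ k₃ ξ ∧
        GL12.DiagonalizableSimple η (GL12.twist K₂) ξ ∧
        (∃ Q : MvPolynomial (GL12.Conf N) ℂ, Q ≠ 0 ∧
          ∀ S : GL12.Conf N → ℂ, MvPolynomial.eval S Q ≠ 0 →
            GL12.IsSoVBasis η (GL12.twist K₂) ξ S) ∧
        (∀ S : GL12.Conf N → ℂ, GL12.IsSoVBasis η (GL12.twist K₂) ξ S →
          ∀ t ∈ GL12.sigmaSet η k₂ k₃ ξ, ∃ v : GL12.Conf N → ℂ,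
            v ≠ 0 ∧ GL12.IsEigen η (GL12.twist K₂) ξ t v ∧
            (∀ w, GL12.IsEigen η (GL12.twist K₂) ξ t w → ∃ c : ℂ, w = c • v) ∧
            ∀ h : Fin N → Fin 3,
              GL12.sovCovector η (GL12.twist K₂) ξ S h ⬝ᵥ v = ∏ n, t (ξ n) ^ (h n : ℕ))) ∧
    (∀ s : Fin N → Fin 3 → ℂ,
      (∀ (n : Fin N) (μ : ℂ) (v : Fin 3 → ℂ), v ≠ 0 → GL12.twist K₂ *ᵥ v = μ • v →
        s n ⬝ᵥ v ≠ 0) →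
      ∃ P : MvPolynomial (Fin N) ℂ, P ≠ 0 ∧
        ∀ ξ : Fin N → ℂ, GL12.InhomCond η ξ → MvPolynomial.eval ξ P ≠ 0 →
          GL12.IsSoVBasis η (GL12.twist K₂) ξ (GL12.productCovector s)) := by
  have heven := GL12.twist_isEven K₂
  have hsov : ∀ s : Fin N → Fin 3 → ℂ, (∀ (n : Fin N) (μ : ℂ) (v : Fin 3 → ℂ), v ≠ 0 →
      GL12.twist K₂ *ᵥ v = μ • v → s n ⬝ᵥ v ≠ 0) → ∃ P : MvPolynomial (Fin N) ℂ, P ≠ 0 ∧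
      ∀ ξ, MvPolynomial.eval ξ P =
        (GL12.sovMatrix η (GL12.twist K₂) ξ (GL12.productCovector s)).det := fun s hs =>
    (GL12.isMvPoly_det_sovMatrix η heven _).exists_ne_zero
      (GL12.exists_det_sovMatrix_ne_zero hη heven fun n =>
        GL12.det_vecMul_pow_ne_zero (GL12.twist_pow_three hK) (hs n))
  refine ⟨?_, fun s hs => ?_⟩
  · obtain ⟨s₀, hs₀⟩ := GL12.exists_covector hK h₂₃ h₂ h₃
    obtain ⟨P, hP0, hP⟩ := hsov (fun _ => s₀) fun _ => hs₀
    obtain ⟨G, hG0, hG⟩ := (GL12.isMvPoly_det_traceGram (N := N) η heven).exists_ne_zero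
      (GL12.exists_det_traceGram_ne_zero hη heven (GL12.det_trace_twist_ne_zero hK h₂₃ h₂ h₃))
    -- P ensures that the product of copies of s₀ is an SoV covector, and G that the trace form is
    -- nondegenerate.
    refine ⟨P * G, mul_ne_zero hP0 hG0, fun ξ hξ hξP => ?_⟩
    rw [map_mul, hP, hG] at hξP
    have hdet := left_ne_zero_of_mul hξP
    have hS := GL12.isSoVBasis_of_det_ne_zero hdet
    refine ⟨Set.Subset.antisymm (GL12.eigenvalueSpectrum_subset hη hξ hK) fun t ht => ?_,
      GL12.diagonalizableSimple_of_gram hη hξ hK hS (right_ne_zero_of_mul hξP), ?_,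
      fun S hS t ht => GL12.exists_eigenvector hη hξ hK hS ht⟩
    · obtain ⟨v, hv0, hv, -⟩ := GL12.exists_eigenvector hη hξ hK hS ht
      exact ⟨v, hv0, hv⟩
    -- At this ξ the SoV determinant, as a polynomial in S, is nonzero at the product covector,
    -- hence nonzero as a polynomial.
    · obtain ⟨Q, hQ0, hQ⟩ :=
        (GL12.isMvPoly_det_sovMatrix_covector η (GL12.twist K₂) ξ).exists_ne_zero ⟨_, hdet⟩
      exact ⟨Q, hQ0, fun S hSQ => GL12.isSoVBasis_of_det_ne_zero (hQ S ▸ hSQ)⟩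
  · obtain ⟨P, hP0, hP⟩ := hsov s hs
    exact ⟨P, hP0, fun ξ _ hξP => GL12.isSoVBasis_of_det_ne_zero (hP ξ ▸ hξP)⟩
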